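/- Let $G$ be a connected compact semisimple Lie group with Lie algebra $\mathfrak g$, let $\mathrm{Kil}$ be the negative of its Killing form, let $\mu\in\mathfrak g'$, and let $K$ be the stability subgroup of $\mu$ for the coadjoint action, so that $G/K$ is the coadjoint orbit of $\mu$. Let $\mathfrak k$ be the Lie algebra of $K$ and $\mathfrak m=\mathfrak k^{\perp}$ for $\mathrm{Kil}$. Put $\omega(X,Y)=\mu([X,Y])$, let $\Gamma$ be the operator on $\mathfrak m$ with $\omega(X,Y)=\mathrm{Kil}(\Gamma X,Y)$, let $\Gamma=|\Gamma|J_\diamond$ be its polar decomposition with respect to $\mathrm{Kil}$, and put $g_\diamond(X,Y)=\omega(X,J_\diamond Y)$. This determines a unique pair $(g_\diamond,J_\diamond)$ of an inner product on $\mathfrak m$ and a complex structure orthogonal for it, both invariant under $\mathrm{Ad}(K)$. View the smooth functions on $G/K$ as the smooth right $K$-invariant functions on $G$, and the vector fields on $G/K$ as $$\mathcal T(G/K)=\{V\in C^\infty(G,\mathfrak m): V(xs)=\mathrm{Ad}_s^{-1}V(x)\ \text{ for } x\in G,\ s\in K\},$$ on which $G$ acts by translation and $g_\diamond$, $J_\diamond$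 act pointwise; $V$ differentiates a function $f$ on $G$ (with values in any finite-dimensional vector space) by $(\partial_Vf)(x)=\frac{d}{dt}\big|_{t=0}f(x\exp(tV(x)))$. Let $\mathfrak m_J$ be $\mathfrak m$ with $iX=J_\diamond X$ and the inner product $\langle X,Y\rangle_J=g_\diamond(X,Y)+i\,g_\diamond(J_\diamond X,Y)$. Let $\mathcal S=\bigwedge^*\mathfrak m_J$ be its complex exterior algebra, with the inner product determined by $\langle X_1\wedge\dots\wedge X_p,\,Y_1\wedge\dots\wedge Y_q\rangle=\delta_{pq}\det[\langle X_k,Y_l\rangle_J]$, with the action $\widetilde{\mathrm{Ad}}$ of $K$ by algebra automorphisms extending $\mathrm{Ad}$ on $\mathfrak m_J$, and with the Clifford action $\kappa(X)=i(a(X)+a^\dagger(X))$, where $a^\dagger(X)\varphi=X\wedge\varphi$ and $a(X)(X_1\wedge\dots\wedge X_p)=\sum_j(-1)^{j-1}\langle X,X_j\rangle_J\,X_1\wedge\dots\wedge\widehat{X_j}\wedge\dots\wedge X_p$. For a character $\chi$ of $K$ (a continuous homomorphism from $K$ to the unit circle) let $$\mathcal S(G/K,\chi)=\{\psi\in C^\infty(G,\mathcal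 S):\psi(xs)=\bar\chi(s)\,\widetilde{\mathrm{Ad}}{}_s^{-1}\psi(x)\ \text{ for } x\in G,\ s\in K\},$$ with the inner product $\langle\psi,\varphi\rangle=\int_G\langle\psi(x),\varphi(x)\rangle\,dx$ for a Haar measure on $G$. Let $\nabla$ be any $G$-invariant connection on $\mathcal T(G/K)$ that is compatible with $g_\diamond$ and commutes with $J_\diamond$. Write $\nabla_V=\partial_V+L_V$, so that each $L_V(x)$ is a complex linear endomorphism of $\mathfrak m_J$; extend it to a derivation $L_V^{\mathcal S}(x)$ of the exterior algebra $\mathcal S$, and put $\nabla^{\mathcal S}_V\psi=\partial_V\psi+L_V^{\mathcal S}\psi$ for $\psi\in\mathcal S(G/K,\chi)$. Let $\mathrm{grad}\,\psi=\sum_kU_k\otimes\varphi_k$, with $U_k\in\mathcal T(G/K)$ and $\varphi_k\in\mathcal S(G/K,\chi)$, be the tensor such that $\nabla^{\mathcal S}_V\psi=\sum_kg_\diamond(U_k,V)\varphi_k$ for all $V\in\mathcal T(G/K)$. The Dirac operator of $\nabla$ and $\chi$ is $D^\nabla\psi=\kappa(\mathrm{grad}\,\psi)=\sum_k\kappa(U_k)\varphi_k$;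 it is a well-defined linear operator on $\mathcal S(G/K,\chi)$. Then for every such $\nabla$ and every character $\chi$ of $K$, the Dirac operator $D^\nabla$ on $\mathcal S(G/K,\chi)$ is formally self-adjoint: $$\langle D^\nabla\psi,\varphi\rangle=\langle\psi,D^\nabla\varphi\rangle\qquad\text{for all }\psi,\varphi\in\mathcal S(G/K,\chi).$$ -/

import Mathlib

open scoped Manifold ContDiff

namespace CoadjointDirac

noncomputable section LieGroupPart

variable {E : Type*} [NormedAddCommGroup E] [NormedSpace ℝ E]
  {G : Type*} [TopologicalSpace G] [ChartedSpace E G] [Group G]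

/-- A smooth Lie group is smooth enough for Mathlib's Lie bracket on the tangent space at `1`. -/
instance instLEInftyMinSmoothness : ENat.LEInfty (minSmoothness ℝ 3) :=
  ⟨by rw [minSmoothness_of_isRCLikeNormedField]; exact ENat.LEInfty.out⟩

variable [LieGroup 𝓘(ℝ, E) ∞ G]


variable (E G) in
/-- The Lie algebra `𝔤` of `G`: the tangent space at `1`, with the bracket of left-invariant
fields. -/
abbrev LieAlg := GroupLieAlgebra 𝓘(ℝ, E) G

lemma contMDiff_conj (g : G) : ContMDiff 𝓘(ℝ, E) 𝓘(ℝ, E) ∞ (fun x : G => g * x * g⁻¹) :=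
  contMDiff_mul_right.comp contMDiff_mul_left

variable (E) in
/-- The adjoint action `Ad_g` on `𝔤`: the derivative at `1` of `x ↦ g x g⁻¹`. -/
def Ad (g : G) : LieAlg E G →ₗ[ℝ] LieAlg E G :=
  (mfderiv 𝓘(ℝ, E) 𝓘(ℝ, E) (fun x : G => g * x * g⁻¹) 1 : E →L[ℝ] E).toLinearMap

lemma mfderiv_congr_point {p q : G} (h : p = q) (f : G → G) (v : E) :
   (mfderiv 𝓘(ℝ, E) 𝓘(ℝ, E) f p : E →L[ℝ] E) v =  (mfderiv 𝓘(ℝ, E) 𝓘(ℝ, E) f q : E →L[ℝ] E) v := by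
  subst h; rfl

lemma Ad_mul_apply (g h : G) (X : LieAlg E G) : Ad E (g * h) X = Ad E g (Ad E h X) := by
  have e : (fun x : G => g * h * x * (g * h)⁻¹) =
      (fun x : G => g * x * g⁻¹) ∘ (fun x : G => h * x * h⁻¹) := by
    ext x; simp [mul_assoc]
  have hg := ((contMDiff_conj (E := E) g).mdifferentiable (by simp)) (h * 1 * h⁻¹)
  have hh := ((contMDiff_conj (E := E) h).mdifferentiable (by simp)) 1
  have key := mfderiv_comp (I := 𝓘(ℝ, E)) (I' := 𝓘(ℝ, E)) (I'' := 𝓘(ℝ, E)) (1 : G) hg hh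
  change (mfderiv 𝓘(ℝ, E) 𝓘(ℝ, E) (fun x : G => g * h * x * (g * h)⁻¹) 1 : E →L[ℝ] E) X = _
  rw [e, key]
  exact mfderiv_congr_point (by simp) _ _

lemma Ad_one_apply (X : LieAlg E G) : Ad E (1 : G) X = X := by
  have e : (fun x : G => 1 * x * 1⁻¹) = id := by ext x; simp
  change (mfderiv 𝓘(ℝ, E) 𝓘(ℝ, E) (fun x : G => 1 * x * 1⁻¹) 1 : E →L[ℝ] E) X = _
  rw [e, mfderiv_id]; rfl

lemma Ad_inv_Ad (g : G) (X : LieAlg E G) : Ad E g⁻¹ (Ad E g X) = X := by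
  rw [← Ad_mul_apply, inv_mul_cancel, Ad_one_apply]

lemma Ad_Ad_inv (g : G) (X : LieAlg E G) : Ad E g (Ad E g⁻¹ X) = X := by
  rw [← Ad_mul_apply, mul_inv_cancel, Ad_one_apply]

lemma mfderiv_conj_comp (g h x : G) (v : E) :
    (mfderiv 𝓘(ℝ, E) 𝓘(ℝ, E) (fun y : G => g * y * g⁻¹) (h * x * h⁻¹) : E →L[ℝ] E)
      ((mfderiv 𝓘(ℝ, E) 𝓘(ℝ, E) (fun y : G => h * y * h⁻¹) x : E →L[ℝ] E) v) =
      (mfderiv 𝓘(ℝ, E) 𝓘(ℝ, E) (fun y : G => (g * h) * y * (g * h)⁻¹) x : E →L[ℝ] E) v := by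
  have e : (fun x : G => g * h * x * (g * h)⁻¹) =
      (fun x : G => g * x * g⁻¹) ∘ (fun x : G => h * x * h⁻¹) := by
    ext x; simp [mul_assoc]
  have hg := ((contMDiff_conj (E := E) g).mdifferentiable (by simp)) (h * x * h⁻¹)
  have hh := ((contMDiff_conj (E := E) h).mdifferentiable (by simp)) x
  rw [e, mfderiv_comp (I := 𝓘(ℝ, E)) (I' := 𝓘(ℝ, E)) (I'' := 𝓘(ℝ, E)) x hg hh]
  rfl

lemma mfderiv_conj_one (x : G) (v : E) :
    (mfderiv 𝓘(ℝ, E) 𝓘(ℝ, E) (fun y : G => (1 : G) * y * (1 : G)⁻¹) x : E →L[ℝ] E) v = v := by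
  have e : (fun x : G => 1 * x * 1⁻¹) = id := by ext x; simp
  rw [e, mfderiv_id]; rfl

lemma mfderiv_conj_mulInvariant (g x : G) (v : LieAlg E G) :
    (mfderiv 𝓘(ℝ, E) 𝓘(ℝ, E) (fun y : G => g * y * g⁻¹) x : E →L[ℝ] E)
      (mulInvariantVectorField v x : E) =
      (mulInvariantVectorField (Ad E g v) (g * x * g⁻¹) : E) := by
  have h1 : MDifferentiableAt 𝓘(ℝ, E) 𝓘(ℝ, E) (fun y : G => x * y) 1 :=
    (contMDiff_mul_left (I := 𝓘(ℝ, E)) (n := ∞)).mdifferentiable (by simp) 1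
  have h2 := ((contMDiff_conj (E := E) g).mdifferentiable (by simp)) (x * 1)
  have h3 : MDifferentiableAt 𝓘(ℝ, E) 𝓘(ℝ, E) (fun y : G => g * x * g⁻¹ * y) (g * 1 * g⁻¹) :=
    (contMDiff_mul_left (I := 𝓘(ℝ, E)) (n := ∞)).mdifferentiable (by simp) _
  have h4 := ((contMDiff_conj (E := E) g).mdifferentiable (by simp)) 1
  have e : (fun y : G => g * y * g⁻¹) ∘ (fun y : G => x * y) =
      (fun y : G => g * x * g⁻¹ * y) ∘ (fun y : G => g * y * g⁻¹) := by
    ext y; simp [mul_assoc]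
  have k1 := mfderiv_comp (I := 𝓘(ℝ, E)) (I' := 𝓘(ℝ, E)) (I'' := 𝓘(ℝ, E)) (1 : G) h2 h1
  have k2 := mfderiv_comp (I := 𝓘(ℝ, E)) (I' := 𝓘(ℝ, E)) (I'' := 𝓘(ℝ, E)) (1 : G) h3 h4
  rw [e, k2] at k1
  have k3 : (mfderiv 𝓘(ℝ, E) 𝓘(ℝ, E) (fun y : G => g * x * g⁻¹ * y) (g * 1 * g⁻¹) : E →L[ℝ] E)
      ((mfderiv 𝓘(ℝ, E) 𝓘(ℝ, E) (fun y : G => g * y * g⁻¹) 1 : E →L[ℝ] E) v) =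
      (mfderiv 𝓘(ℝ, E) 𝓘(ℝ, E) (fun y : G => g * y * g⁻¹) (x * 1) : E →L[ℝ] E)
      ((mfderiv 𝓘(ℝ, E) 𝓘(ℝ, E) (fun y : G => x * y) 1 : E →L[ℝ] E) v) :=
    congrArg (fun A : E →L[ℝ] E => A v) k1
  exact (mfderiv_congr_point (mul_one x).symm _ _).trans
    (k3.symm.trans (mfderiv_congr_point (by simp) _ _))

open VectorField in
lemma mpullback_conj (g : G) (v : LieAlg E G) :
    mpullback 𝓘(ℝ, E) 𝓘(ℝ, E) (fun x : G => g * x * g⁻¹) (mulInvariantVectorField (Ad E g v)) =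
      mulInvariantVectorField v := by
  ext x
  let A : E →L[ℝ] E := mfderiv 𝓘(ℝ, E) 𝓘(ℝ, E) (fun y : G => g * y * g⁻¹) x
  let B : E →L[ℝ] E := mfderiv 𝓘(ℝ, E) 𝓘(ℝ, E) (fun y : G => g⁻¹ * y * g⁻¹⁻¹) (g * x * g⁻¹)
  have hBA : B.comp A = ContinuousLinearMap.id ℝ E := by
    ext w
    change B (A w) = w
    refine (mfderiv_conj_comp g⁻¹ g x w).trans ?_
    rw [inv_mul_cancel]; exact mfderiv_conj_one x w
  have hAB : A.comp B = ContinuousLinearMap.id ℝ E := by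
    ext w
    change A (B w) = w
    have hx : x = g⁻¹ * (g * x * g⁻¹) * g⁻¹⁻¹ := by group
    have : A (B w) = (mfderiv 𝓘(ℝ, E) 𝓘(ℝ, E) (fun y : G => g * y * g⁻¹)
        (g⁻¹ * (g * x * g⁻¹) * g⁻¹⁻¹) : E →L[ℝ] E) (B w) := mfderiv_congr_point hx _ _
    rw [this]
    refine (mfderiv_conj_comp g g⁻¹ (g * x * g⁻¹) w).trans ?_
    rw [mul_inv_cancel]; exact mfderiv_conj_one _ w
  have hinv : A.inverse = B := ContinuousLinearMap.inverse_eq hAB hBA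
  have key := mfderiv_conj_mulInvariant g x v
  change A.inverse (mulInvariantVectorField (Ad E g v) (g * x * g⁻¹) : E) = _
  rw [← key, hinv]
  exact congrArg (fun C : E →L[ℝ] E => C (mulInvariantVectorField v x : E)) hBA

variable [CompleteSpace E]

open VectorField in
lemma Ad_lie (g : G) (X Y : LieAlg E G) : Ad E g ⁅X, Y⁆ = ⁅Ad E g X, Ad E g Y⁆ := by
  have key : mulInvariantVectorField (I := 𝓘(ℝ, E)) ⁅X, Y⁆ =
      mulInvariantVectorField (Ad E g⁻¹ ⁅Ad E g X, Ad E g Y⁆) := by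
    ext x
    rw [GroupLieAlgebra.bracket_def X Y, mulInvariantVector_mlieBracket, ← mpullback_conj g X,
      ← mpullback_conj g Y, ← mpullback_conj g (Ad E g⁻¹ ⁅Ad E g X, Ad E g Y⁆), Ad_Ad_inv,
      GroupLieAlgebra.bracket_def, mulInvariantVector_mlieBracket,
      mpullback_mlieBracket (n := ∞)]
    · exact mdifferentiableAt_mulInvariantVectorField _
    · exact mdifferentiableAt_mulInvariantVectorField _
    · exact (contMDiff_conj g).contMDiffAt
    · rw [minSmoothness_of_isRCLikeNormedField]; exact ENat.LEInfty.out
  have h1 : ∀ v : LieAlg E G, (mulInvariantVectorField (I := 𝓘(ℝ, E)) v (1 : G) : E) = v := by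
    intro v
    have e : (fun y : G => (1 : G) * y) = id := by ext; simp
    change (mfderiv 𝓘(ℝ, E) 𝓘(ℝ, E) (fun y : G => (1 : G) * y) 1 : E →L[ℝ] E) v = v
    rw [e, mfderiv_id]; rfl
  have h2 : ⁅X, Y⁆ = Ad E g⁻¹ ⁅Ad E g X, Ad E g Y⁆ :=
    (h1 _).symm.trans ((congrFun key 1).trans (h1 _))
  rw [h2, Ad_Ad_inv]

/-- `Ad_g` as an automorphism of the Lie algebra. -/
def AdEquiv (g : G) : LieAlg E G ≃ₗ⁅ℝ⁆ LieAlg E G :=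
  { Ad E g with
    map_lie' := fun {X Y} => Ad_lie g X Y
    invFun := Ad E g⁻¹
    left_inv := Ad_inv_Ad g
    right_inv := Ad_Ad_inv g }

variable (E G) in
/-- The negative of the Killing form of `𝔤`. -/
def Kil : LieAlg E G →ₗ[ℝ] LieAlg E G →ₗ[ℝ] ℝ := -killingForm ℝ (LieAlg E G)

lemma Kil_Ad (g : G) (X Y : LieAlg E G) : Kil E G (Ad E g X) (Ad E g Y) = Kil E G X Y := by
  have := LieAlgebra.killingForm_of_equiv_apply (AdEquiv g) X Y
  simp only [Kil, LinearMap.neg_apply, neg_inj]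
  exact this

end LieGroupPart
noncomputable section HermitianPart

/-- An inner product `g` on a real vector space `V` together with an orthogonal complex structure
`J`. -/
structure HermitianStructure (V : Type*) [AddCommGroup V] [Module ℝ V] where
  J : V →ₗ[ℝ] V
  g : V →ₗ[ℝ] V →ₗ[ℝ] ℝ
  J_J : ∀ X, J (J X) = -X
  g_symm : ∀ X Y, g X Y = g Y X
  g_pos : ∀ X, X ≠ 0 → 0 < g X X
  g_J : ∀ X Y, g (J X) (J Y) = g X Y

namespace HermitianStructure

section VS
variable {V : Type*} [AddCommGroup V] [Module ℝ V] (h : HermitianStructure V)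

lemma g_J_left (X Y : V) : h.g (h.J X) Y = -h.g X (h.J Y) := by
  have := h.g_J X (h.J Y)
  rw [h.J_J] at this
  rw [← this]; simp

/-- The complex vector space structure on `V` in which `i X = J X`. -/
@[reducible]
def complexModule : Module ℂ V where
  smul z X := z.re • X + z.im • h.J X
  one_smul X := by
    change (1 : ℂ).re • X + (1 : ℂ).im • h.J X = X
    simp
  mul_smul z w X := by
    change (z * w).re • X + (z * w).im • h.J X =
      z.re • (w.re • X + w.im • h.J X) + z.im • h.J (w.re • X + w.im • h.J X)
    simp only [Complex.mul_re, Complex.mul_im, map_add, map_smul, h.J_J]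
    module
  smul_zero z := by
    change z.re • (0 : V) + z.im • h.J 0 = 0
    simp
  smul_add z X Y := by
    change z.re • (X + Y) + z.im • h.J (X + Y) =
      (z.re • X + z.im • h.J X) + (z.re • Y + z.im • h.J Y)
    simp only [map_add]
    module
  add_smul z w X := by
    change (z + w).re • X + (z + w).im • h.J X =
      (z.re • X + z.im • h.J X) + (w.re • X + w.im • h.J X)
    simp only [Complex.add_re, Complex.add_im]
    module
  zero_smul X := by
    change (0 : ℂ).re • X + (0 : ℂ).im • h.J X = 0
    simp

/-- The complex inner product `⟨X, Y⟩_J = g(X, Y) + i g(J X, Y)`, linear in the second variable. -/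
@[reducible]
def complexCore : @InnerProductSpace.Core ℂ V _ _ h.complexModule :=
  letI := h.complexModule
  { inner := fun X Y => (h.g X Y : ℂ) + (h.g (h.J X) Y : ℂ) * Complex.I
    conj_inner_symm := fun X Y => by
      have := h.g_J_left Y X
      rw [h.g_symm Y (h.J X)] at this
      simp [h.g_symm Y X, this]
    re_inner_nonneg := fun X => by
      by_cases hX : X = 0
      · simp [hX]
      · simpa using (h.g_pos X hX).le
    add_left := fun X Y Z => by
      simp only [map_add, LinearMap.add_apply, Complex.ofReal_add]
      ring
    smul_left := fun X Y z => by
      change ((h.g (z.re • X + z.im • h.J X) Y : ℝ) : ℂ)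
        + ((h.g (h.J (z.re • X + z.im • h.J X)) Y : ℝ) : ℂ) * Complex.I = _
      simp only [map_add, LinearMap.add_apply, map_smul, h.J_J, LinearMap.smul_apply, smul_eq_mul,
        map_neg, LinearMap.neg_apply]
      apply Complex.ext <;> simp
    definite := fun X hX => by
      by_contra hne
      have h1 := h.g_pos X hne
      have h2 := congrArg Complex.re hX
      simp at h2
      exact h1.ne' h2 }

/-- The real vector space `V`, viewed as the complex inner product space `V_J`: `i` acts as `J` and
the inner product is `⟨X, Y⟩_J = g(X, Y) + i g(J X, Y)`; see `smul_toCplx` and `inner_toCplx`. -/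
def Cplx (_h : HermitianStructure V) : Type _ := V

instance instNormedCplx : NormedAddCommGroup h.Cplx :=
  letI := h.complexModule
  @InnerProductSpace.Core.toNormedAddCommGroup ℂ V _ _ _ h.complexCore

instance instInnerCplx : InnerProductSpace ℂ h.Cplx :=
  letI := h.complexModule
  @InnerProductSpace.ofCore ℂ V _ _ _ h.complexCore.toCore

/-- The identity map from `V` to `V_J`. -/
def toCplx : V ≃ₗ[ℝ] h.Cplx where
  toFun X := X
  invFun X := X
  map_add' _ _ := rfl
  map_smul' r X := by
    change r • X = (r : ℂ).re • X + (r : ℂ).im • h.J X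
    simp
  left_inv _ := rfl
  right_inv _ := rfl

lemma smul_toCplx (z : ℂ) (X : V) : z • h.toCplx X = h.toCplx (z.re • X + z.im • h.J X) := rfl

lemma inner_toCplx (X Y : V) :
    inner ℂ (h.toCplx X) (h.toCplx Y) = (h.g X Y : ℂ) + (h.g (h.J X) Y : ℂ) * Complex.I := rfl

instance instFiniteCplx [FiniteDimensional ℝ V] : FiniteDimensional ℂ h.Cplx :=
  haveI : FiniteDimensional ℝ h.Cplx := h.toCplx.finiteDimensional
  FiniteDimensional.right ℝ ℂ h.Cplx

/-- A real endomorphism commuting with `J` is complex linear. -/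
def cplxMap (T : V →ₗ[ℝ] V) (hT : ∀ X, T (h.J X) = h.J (T X)) : h.Cplx →ₗ[ℂ] h.Cplx where
  toFun X := h.toCplx (T (h.toCplx.symm X))
  map_add' X Y := by simp
  map_smul' z X := by
    obtain ⟨X, rfl⟩ := h.toCplx.surjective X
    rw [smul_toCplx]
    simp [smul_toCplx, hT]

end VS
end HermitianStructure

section ExteriorAlgebraPart

variable {M : Type*} [NormedAddCommGroup M] [InnerProductSpace ℂ M]

/-- The algebra homomorphism `φ ↦ φ + ε T(φ)` to the dual numbers over the exterior algebra, where
`T` stands for its extension to a derivation; on vectors it is `X ↦ X + ε T X`. -/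
def extDerivAux (T : M →ₗ[ℂ] M) : ExteriorAlgebra ℂ M →ₐ[ℂ] DualNumber (ExteriorAlgebra ℂ M) :=
  ExteriorAlgebra.lift ℂ
    ⟨(TrivSqZeroExt.inlAlgHom ℂ (ExteriorAlgebra ℂ M) (ExteriorAlgebra ℂ M)).toLinearMap ∘ₗ
        ExteriorAlgebra.ι ℂ +
      ((TrivSqZeroExt.inrHom (ExteriorAlgebra ℂ M) (ExteriorAlgebra ℂ M)).restrictScalars ℂ) ∘ₗ
        ExteriorAlgebra.ι ℂ ∘ₗ T, fun X => by
      have h := ExteriorAlgebra.ι_add_mul_swap (R := ℂ) X (T X)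
      ext
      · simp
      · simp [add_comm, h]⟩

/-- The derivation of the exterior algebra that extends the endomorphism `T` of `M`;
see `extDeriv_ι` and `extDeriv_mul`. -/
def extDeriv (T : M →ₗ[ℂ] M) : ExteriorAlgebra ℂ M →ₗ[ℂ] ExteriorAlgebra ℂ M where
  toFun φ := (extDerivAux T φ).snd
  map_add' := by simp
  map_smul' := by simp

lemma extDerivAux_fst (T : M →ₗ[ℂ] M) (φ : ExteriorAlgebra ℂ M) : (extDerivAux T φ).fst = φ := by
  have : (TrivSqZeroExt.fstHom ℂ (ExteriorAlgebra ℂ M) (ExteriorAlgebra ℂ M)).comp (extDerivAux T) =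
      AlgHom.id ℂ _ := by
    ext X
    simp [extDerivAux]
  exact congrArg (fun f : ExteriorAlgebra ℂ M →ₐ[ℂ] ExteriorAlgebra ℂ M => f φ) this

lemma extDeriv_ι (T : M →ₗ[ℂ] M) (X : M) :
    extDeriv T (ExteriorAlgebra.ι ℂ X) = ExteriorAlgebra.ι ℂ (T X) := by
  simp [extDeriv, extDerivAux]

lemma extDeriv_mul (T : M →ₗ[ℂ] M) (φ ψ : ExteriorAlgebra ℂ M) :
    extDeriv T (φ * ψ) = extDeriv T φ * ψ + φ * extDeriv T ψ := by
  simp [extDeriv, extDerivAux_fst, add_comm]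

lemma liftAlternating_single (p q : ℕ) (f : M [⋀^Fin p]→ₗ[ℂ] ℂ) (Y : Fin q → M) :
    ExteriorAlgebra.liftAlternating (R := ℂ) (Pi.single p f) (ExteriorAlgebra.ιMulti ℂ q Y) =
      if e : p = q then f (fun i => Y (Fin.cast e i)) else 0 := by
  rw [ExteriorAlgebra.liftAlternating_apply_ιMulti]
  split_ifs with e
  · subst e; simp
  · rw [Pi.single_eq_of_ne (Ne.symm e)]; rfl

variable [FiniteDimensional ℂ M]

variable (M) in
/-- The basis of the exterior algebra formed by the products `e_{j₁} ∧ ⋯ ∧ e_{jₚ}`, `j₁ < ⋯ < jₚ`, of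
elements of an orthonormal basis of `M`. -/
def extBasis : Module.Basis (Finset (Fin (Module.finrank ℂ M))) ℂ (ExteriorAlgebra ℂ M) :=
  (stdOrthonormalBasis ℂ M).toBasis.ExteriorAlgebra

/-- The inner product of the exterior algebra, conjugate linear in the first variable. It is the one
determined by `⟨X₁ ∧ ⋯ ∧ X_p, Y₁ ∧ ⋯ ∧ Y_q⟩ = δ_{pq} det ⟨X_k, Y_l⟩`; see `extInner_ιMulti`. -/
def extInner (φ ψ : ExteriorAlgebra ℂ M) : ℂ :=
  ∑ s, starRingEnd ℂ ((extBasis M).repr φ s) * (extBasis M).repr ψ s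

lemma extBasis_repr_ιMulti (t : Finset (Fin (Module.finrank ℂ M))) (q : ℕ) (Y : Fin q → M) :
    (extBasis M).repr (ExteriorAlgebra.ιMulti ℂ q Y) t =
      if e : t.card = q then
        (Matrix.of fun i j => inner ℂ (stdOrthonormalBasis ℂ M
          (Set.powersetCard.ofFinEmbEquiv.symm (Set.powersetCard.ofCard (n := t.card) rfl) j))
          (Y (Fin.cast e i))).det else 0 := by
  have key : (extBasis M).coord t = ExteriorAlgebra.liftAlternating (R := ℂ) (Pi.single t.card
      ((exteriorPower.ιMultiDual ℂ t.card (stdOrthonormalBasis ℂ M).toBasis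
        (Set.powersetCard.ofCard (n := t.card) rfl)).compAlternatingMap
          (exteriorPower.ιMulti ℂ t.card))) := by
    refine (extBasis M).ext fun s => ?_
    rw [Module.Basis.coord_apply, Module.Basis.repr_self]
    by_cases e : s.card = t.card
    · rw [extBasis, ExteriorAlgebra.basis_apply_ofCard _ e, ExteriorAlgebra.ιMulti_family,
        liftAlternating_single, dif_pos rfl]
      by_cases hst : t = s
      · subst hst
        have := exteriorPower.ιMultiDual_apply_diag ℂ t.card (stdOrthonormalBasis ℂ M).toBasis
          (Set.powersetCard.ofCard (n := t.card) rfl)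
        rw [Finsupp.single_eq_same]
        exact this.symm
      · have := exteriorPower.ιMultiDual_apply_nondiag ℂ t.card (stdOrthonormalBasis ℂ M).toBasis
          (Set.powersetCard.ofCard (n := t.card) rfl) (Set.powersetCard.ofCard e)
          (fun h => hst (congrArg Subtype.val h))
        rw [Finsupp.single_eq_of_ne hst]
        exact this.symm
    · rw [extBasis, ExteriorAlgebra.basis_apply_ofCard (n := s.card) _ rfl,
        ExteriorAlgebra.ιMulti_family,
        liftAlternating_single, dif_neg (Ne.symm e),
        Finsupp.single_eq_of_ne (fun h => e (by rw [h]))]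
  have := congrArg (fun f => f (ExteriorAlgebra.ιMulti ℂ q Y)) key
  simp only [Module.Basis.coord_apply] at this
  rw [this, liftAlternating_single]
  split_ifs with e
  · rw [LinearMap.compAlternatingMap_apply, exteriorPower.ιMultiDual_apply_ιMulti]
    congr 1
    ext i j
    simp [OrthonormalBasis.repr_apply_apply]
  · rfl

/-- The formula that determines the inner product of the exterior algebra. -/
lemma extInner_ιMulti (p q : ℕ) (X : Fin p → M) (Y : Fin q → M) :
    extInner (ExteriorAlgebra.ιMulti ℂ p X) (ExteriorAlgebra.ιMulti ℂ q Y) =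
      if e : p = q then (Matrix.of fun k l => inner ℂ (X k) (Y (Fin.cast e l))).det else 0 := by
  have key : ∑ s, starRingEnd ℂ ((extBasis M).repr (ExteriorAlgebra.ιMulti ℂ p X) s) •
      (extBasis M).coord s = ExteriorAlgebra.liftAlternating (R := ℂ) (Pi.single p
        ((exteriorPower.pairingDual ℂ M p (exteriorPower.ιMulti ℂ p
          fun k => (innerₛₗ ℂ (X k) : Module.Dual ℂ M))).compAlternatingMap
            (exteriorPower.ιMulti ℂ p))) := by
    refine (extBasis M).ext fun t => ?_
    simp only [LinearMap.sum_apply, LinearMap.smul_apply, Module.Basis.coord_apply,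
      Module.Basis.repr_self, smul_eq_mul]
    rw [Finset.sum_eq_single t (fun s _ hs => by rw [Finsupp.single_eq_of_ne hs, mul_zero])
      (by simp), Finsupp.single_eq_same, mul_one, extBasis_repr_ιMulti]
    have hb : extBasis M t = ExteriorAlgebra.ιMulti ℂ t.card (fun i => stdOrthonormalBasis ℂ M
        (Set.powersetCard.ofFinEmbEquiv.symm (Set.powersetCard.ofCard (n := t.card) rfl) i)) := by
      rw [extBasis, ExteriorAlgebra.basis_apply_ofCard (n := t.card) _ rfl,
        ← OrthonormalBasis.coe_toBasis]
      rfl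
    rw [hb, liftAlternating_single]
    by_cases e : p = t.card
    · subst e
      rw [dif_pos rfl, dif_pos rfl, LinearMap.compAlternatingMap_apply,
        exteriorPower.pairingDual_ιMulti_ιMulti, RingHom.map_det, ← Matrix.det_transpose]
      congr 1
      ext i j
      simp
    · rw [dif_neg e, dif_neg (Ne.symm e), map_zero]
  have := congrArg (fun f => f (ExteriorAlgebra.ιMulti ℂ q Y)) key
  simp only [LinearMap.sum_apply, LinearMap.smul_apply, Module.Basis.coord_apply,
    smul_eq_mul] at this
  rw [extInner, this, liftAlternating_single]
  split_ifs with e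
  · rw [LinearMap.compAlternatingMap_apply, exteriorPower.pairingDual_ιMulti_ιMulti,
      ← Matrix.det_transpose]
    congr 1
  · rfl

/-- The exterior algebra as an inner product space. -/
@[reducible]
def extCore : InnerProductSpace.Core ℂ (ExteriorAlgebra ℂ M) where
  inner := extInner
  conj_inner_symm φ ψ := by simp [extInner, mul_comm]
  re_inner_nonneg φ := by
    simp only [extInner, map_sum]
    refine Finset.sum_nonneg fun s _ => ?_
    rw [← Complex.normSq_eq_conj_mul_self]
    simpa using Complex.normSq_nonneg _
  add_left φ ψ χ := by simp [extInner, add_mul, Finset.sum_add_distrib]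
  smul_left φ ψ z := by simp [extInner, Finset.mul_sum, mul_assoc]
  definite φ h := by
    have h' : ∑ s, Complex.normSq ((extBasis M).repr φ s) = 0 := by
      have := congrArg Complex.re h
      simp only [extInner, ← Complex.normSq_eq_conj_mul_self] at this
      simpa using this
    rw [Finset.sum_eq_zero_iff_of_nonneg (fun _ _ => Complex.normSq_nonneg _)] at h'
    apply (extBasis M).ext_elem
    intro s
    simpa using h' s

end ExteriorAlgebraPart

section FockOperators

variable {M : Type*} [NormedAddCommGroup M] [InnerProductSpace ℂ M]

/-- The creation operator `φ ↦ X ∧ φ`. -/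
def fockCreate (X : M) : ExteriorAlgebra ℂ M →ₗ[ℂ] ExteriorAlgebra ℂ M :=
  LinearMap.mulLeft ℂ (ExteriorAlgebra.ι ℂ X)

/-- The annihilation operator, `X₁ ∧ ⋯ ∧ X_p ↦ ∑ⱼ (-1)^(j-1) ⟨X, Xⱼ⟩ X₁ ∧ ⋯ X̂ⱼ ⋯ ∧ X_p`;
see `fockAnnihilate_one` and `fockAnnihilate_ι_mul`. -/
def fockAnnihilate (X : M) : ExteriorAlgebra ℂ M →ₗ[ℂ] ExteriorAlgebra ℂ M :=
  CliffordAlgebra.contractLeft (Q := (0 : QuadraticForm ℂ M))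
    (innerₛₗ ℂ X : Module.Dual ℂ M)

lemma fockAnnihilate_one (X : M) : fockAnnihilate X 1 = 0 :=
  CliffordAlgebra.contractLeft_one ..

lemma fockAnnihilate_ι_mul (X Y : M) (φ : ExteriorAlgebra ℂ M) :
    fockAnnihilate X (ExteriorAlgebra.ι ℂ Y * φ) =
      inner ℂ X Y • φ - ExteriorAlgebra.ι ℂ Y * fockAnnihilate X φ :=
  CliffordAlgebra.contractLeft_ι_mul ..

/-- Clifford multiplication by `X`, namely `i` times the sum of annihilation and creation by `X`. -/
def fockClifford (X : M) : ExteriorAlgebra ℂ M →ₗ[ℂ] ExteriorAlgebra ℂ M :=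
  Complex.I • (fockAnnihilate X + fockCreate X)

lemma fockClifford_relation (X Y : M) (φ : ExteriorAlgebra ℂ M) :
    fockClifford X (fockClifford Y φ) + fockClifford Y (fockClifford X φ) =
      (-(inner ℂ X Y + inner ℂ Y X) : ℂ) • φ := by
  have h0 : ExteriorAlgebra.ι ℂ X * (ExteriorAlgebra.ι ℂ Y * φ) +
      ExteriorAlgebra.ι ℂ Y * (ExteriorAlgebra.ι ℂ X * φ) = 0 := by
    rw [← mul_assoc, ← mul_assoc, ← add_mul, ExteriorAlgebra.ι_add_mul_swap, zero_mul]
  have h1 : fockAnnihilate X (fockAnnihilate Y φ) = -fockAnnihilate Y (fockAnnihilate X φ) :=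
    CliffordAlgebra.contractLeft_comm ..
  simp only [fockClifford, fockCreate, LinearMap.smul_apply, LinearMap.add_apply, map_smul, map_add,
    LinearMap.mulLeft_apply, fockAnnihilate_ι_mul, h1, eq_neg_of_add_eq_zero_left h0]
  have hI : Complex.I * Complex.I = -1 := Complex.I_mul_I
  match_scalars
  all_goals first
    | ring1
    | linear_combination (inner ℂ X Y + inner ℂ Y X) * hI

end FockOperators

section Spinors

namespace HermitianStructure
variable {V : Type*} [AddCommGroup V] [Module ℝ V] [FiniteDimensional ℝ V]
  (h : HermitianStructure V)

/-- The space `𝒮` of spinors: the complex exterior algebra of `V_J`, with its inner product. -/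
def Spinor : Type _ := ExteriorAlgebra ℂ h.Cplx

instance instNormedSpinor : NormedAddCommGroup h.Spinor :=
  @InnerProductSpace.Core.toNormedAddCommGroup ℂ (ExteriorAlgebra ℂ h.Cplx) _ _ _ extCore

instance instInnerSpinor : InnerProductSpace ℂ h.Spinor :=
  @InnerProductSpace.ofCore ℂ (ExteriorAlgebra ℂ h.Cplx) _ _ _ extCore.toCore

/-- The identity map from the exterior algebra of `V_J` to the spinors. -/
def toSpinor : ExteriorAlgebra ℂ h.Cplx ≃ₗ[ℂ] h.Spinor where
  toFun φ := φ
  invFun φ := φ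
  map_add' _ _ := rfl
  map_smul' _ _ := rfl
  left_inv _ := rfl
  right_inv _ := rfl

instance instFiniteSpinor : FiniteDimensional ℂ h.Spinor :=
  haveI : FiniteDimensional ℂ (ExteriorAlgebra ℂ h.Cplx) := (extBasis h.Cplx).finiteDimensional_of_finite
  h.toSpinor.finiteDimensional

/-- The spinor `X₁ ∧ ⋯ ∧ X_p`. -/
def wedge (p : ℕ) (X : Fin p → V) : h.Spinor :=
  h.toSpinor (ExteriorAlgebra.ιMulti ℂ p (fun k => h.toCplx (X k)))

/-- The formula that determines the inner product of spinors. -/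
lemma inner_wedge (p q : ℕ) (X : Fin p → V) (Y : Fin q → V) :
    inner ℂ (h.wedge p X) (h.wedge q Y) = if e : p = q then (Matrix.of fun k l =>
      inner ℂ (h.toCplx (X k)) (h.toCplx (Y (Fin.cast e l)))).det else 0 :=
  extInner_ιMulti p q _ _

/-- An operator on the exterior algebra of `V_J`, as an operator on spinors. -/
def onSpinor (T : ExteriorAlgebra ℂ h.Cplx →ₗ[ℂ] ExteriorAlgebra ℂ h.Cplx) :
    h.Spinor →ₗ[ℂ] h.Spinor :=
  h.toSpinor.toLinearMap ∘ₗ T ∘ₗ h.toSpinor.symm.toLinearMap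

/-- The Clifford action `κ(X)` of a vector `X` of `V` on spinors; see `clifford_relation`. -/
def cliffordAction (X : V) : h.Spinor →ₗ[ℂ] h.Spinor := h.onSpinor (fockClifford (h.toCplx X))

/-- The exterior algebra endomorphism of spinors induced by an endomorphism of `V_J`. -/
def spinorMap (T : h.Cplx →ₗ[ℂ] h.Cplx) : h.Spinor →ₗ[ℂ] h.Spinor :=
  h.onSpinor (ExteriorAlgebra.map T).toLinearMap

/-- The exterior algebra derivation of spinors that extends an endomorphism of `V_J`. -/
def spinorDeriv (T : h.Cplx →ₗ[ℂ] h.Cplx) : h.Spinor →ₗ[ℂ] h.Spinor := h.onSpinor (extDeriv T)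

/-- The relation `XY + YX = -2 g(X, Y)`, so that `κ` is a representation of the Clifford algebra. -/
lemma clifford_relation (X Y : V) (φ : h.Spinor) :
    h.cliffordAction X (h.cliffordAction Y φ) + h.cliffordAction Y (h.cliffordAction X φ) =
      (-2 * h.g X Y : ℂ) • φ := by
  have h2 : (-(inner ℂ (h.toCplx X) (h.toCplx Y) + inner ℂ (h.toCplx Y) (h.toCplx X)) : ℂ)
      = -2 * h.g X Y := by
    rw [h.inner_toCplx, h.inner_toCplx, h.g_J_left Y X, h.g_symm Y (h.J X), h.g_symm Y X]
    push_cast; ring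
  rw [← h2]
  exact fockClifford_relation (h.toCplx X) (h.toCplx Y) φ

end HermitianStructure
end Spinors
end HermitianPart
noncomputable section HomogeneousPart


variable {E : Type*} [NormedAddCommGroup E] [NormedSpace ℝ E]
  {G : Type*} [TopologicalSpace G] [ChartedSpace E G] [Group G] [LieGroup 𝓘(ℝ, E) ∞ G]

/-- The coadjoint action: `(Ad'_g μ)(X) = μ(Ad_{g⁻¹} X)`. -/
def coAd (g : G) (μ : Module.Dual ℝ (LieAlg E G)) : Module.Dual ℝ (LieAlg E G) := μ ∘ₗ Ad E g⁻¹

/-- The stability subgroup `K` of `μ` for the coadjoint action. -/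
def stabilizer (μ : Module.Dual ℝ (LieAlg E G)) : Subgroup G where
  carrier := {s | coAd s μ = μ}
  one_mem' := by
    ext X
    simp [coAd, Ad_one_apply]
  mul_mem' {s t} hs ht := by
    ext X
    have h1 := LinearMap.congr_fun (show coAd s μ = μ from hs) X
    have h2 := LinearMap.congr_fun (show coAd t μ = μ from ht) (Ad E s⁻¹ X)
    simp only [coAd, LinearMap.comp_apply] at h1 h2 ⊢
    rw [mul_inv_rev, Ad_mul_apply, h2, h1]
  inv_mem' {s} hs := by
    ext X
    have h1 := LinearMap.congr_fun (show coAd s μ = μ from hs) (Ad E s X)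
    simp only [coAd, LinearMap.comp_apply, Ad_inv_Ad, inv_inv] at h1 ⊢
    exact h1.symm

variable (E) in
/-- The Lie algebra `𝔨` of a subgroup `K`: the velocities at `0` of the smooth one-parameter subgroups
of `G` that lie in `K`. -/
def lieOf (K : Subgroup G) : Set (LieAlg E G) :=
  {X | ∃ γ : ℝ → G, ContMDiff 𝓘(ℝ, ℝ) 𝓘(ℝ, E) ∞ γ ∧ (∀ s t, γ (s + t) = γ s * γ t) ∧
    (∀ t, γ t ∈ K) ∧ (mfderiv 𝓘(ℝ, ℝ) 𝓘(ℝ, E) γ 0 : ℝ →L[ℝ] E) 1 = X}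

lemma Ad_mem_lieOf {K : Subgroup G} {s : G} (hs : s ∈ K) {X : LieAlg E G} (hX : X ∈ lieOf E K) :
    Ad E s X ∈ lieOf E K := by
  obtain ⟨γ, h1, h2, h3, h4⟩ := hX
  refine ⟨fun t => s * γ t * s⁻¹, (contMDiff_conj s).comp h1, fun a b => by
    simp [h2], fun t => K.mul_mem (K.mul_mem hs (h3 t)) (K.inv_mem hs), ?_⟩
  have h0 : γ 0 = 1 := by simpa using h2 0 0
  have k := mfderiv_comp (I := 𝓘(ℝ, ℝ)) (I' := 𝓘(ℝ, E)) (I'' := 𝓘(ℝ, E)) (0 : ℝ)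
    ((contMDiff_conj (E := E) s).mdifferentiable (by simp) (γ 0))
    (h1.mdifferentiable (by simp) 0)
  change (mfderiv 𝓘(ℝ, ℝ) 𝓘(ℝ, E) ((fun x : G => s * x * s⁻¹) ∘ γ) 0 : ℝ →L[ℝ] E) 1 = _
  rw [k]
  refine (mfderiv_congr_point h0 _ _).trans ?_
  exact congrArg (Ad E s) h4

variable [CompleteSpace E]

variable (E) in
/-- `𝔪`, the orthogonal complement of `𝔨` in `𝔤` for `Kil`. (As a vector space `𝔤` is `E`, whose norm
serves to speak of smooth functions with values in `𝔪`.) -/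
def tangent (K : Subgroup G) : Submodule ℝ E where
  carrier := {X | ∀ Y ∈ lieOf E K, Kil E G Y X = 0}
  zero_mem' Y _ := (Kil E G Y).map_zero
  add_mem' {X X'} hX hX' Y hY := by
    have := (Kil E G Y).map_add X X'
    rw [hX Y hY, hX' Y hY, add_zero] at this
    exact this
  smul_mem' r X hX Y hY := by
    have := (Kil E G Y).map_smul r X
    rw [hX Y hY, smul_zero] at this
    exact this

/-- The adjoint action of `s ∈ K` on `𝔪`. -/
def adTangent {K : Subgroup G} (s : K) : tangent E K →ₗ[ℝ] tangent E K :=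
  LinearMap.restrict (show E →ₗ[ℝ] E from Ad E (s : G)) (fun X hX Y hY => by
    have h1 := hX (Ad E (s : G)⁻¹ Y) (Ad_mem_lieOf (K.inv_mem s.2) hY)
    have h2 := Kil_Ad (s : G) (Ad E (s : G)⁻¹ Y) X
    rw [Ad_Ad_inv, h1] at h2
    exact h2)

variable (E) in
/-- A homogeneous almost Hermitian structure on `G/K`: an inner product and an orthogonal complex
structure on `𝔪`, both invariant under the adjoint action of `K`. -/
structure AlmostHermitian (K : Subgroup G) extends HermitianStructure (tangent E K) where
  J_Ad : ∀ (s : K) X, J (adTangent s X) = adTangent s (J X)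
  g_Ad : ∀ (s : K) X Y, g (adTangent s X) (adTangent s Y) = g X Y

/-- The Kirillov–Kostant–Souriau form `ω(X, Y) = μ([X, Y])`. -/
def kks (μ : Module.Dual ℝ (LieAlg E G)) (X Y : LieAlg E G) : ℝ := μ ⁅X, Y⁆

/-- `H` is the canonical Kähler structure `(g_⋄, J_⋄)` of the coadjoint orbit of `μ`: if `Γ` is the
operator on `𝔪` with `ω(X, Y) = Kil(Γ X, Y)`, then `Γ = |Γ| J_⋄` is its polar decomposition for `Kil`
(`|Γ|` symmetric and positive, `J_⋄` orthogonal), and `g_⋄(X, Y) = ω(X, J_⋄ Y)`. -/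
structure IsKahler (μ : Module.Dual ℝ (LieAlg E G)) (H : AlmostHermitian E (stabilizer μ)) :
    Prop where
  polar : ∃ Γ absΓ : tangent E (stabilizer μ) →ₗ[ℝ] tangent E (stabilizer μ),
    (∀ X Y : tangent E (stabilizer μ), kks μ (X : E) (Y : E) = Kil E G (Γ X : E) (Y : E)) ∧
    (∀ X, Γ X = absΓ (H.J X)) ∧
    (∀ X Y : tangent E (stabilizer μ), Kil E G (absΓ X : E) (Y : E) = Kil E G (X : E) (absΓ Y : E)) ∧
    (∀ X : tangent E (stabilizer μ), 0 ≤ Kil E G (absΓ X : E) (X : E)) ∧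
    (∀ X Y : tangent E (stabilizer μ), Kil E G (H.J X : E) (H.J Y : E) = Kil E G (X : E) (Y : E))
  metric : ∀ X Y : tangent E (stabilizer μ), H.g X Y = kks μ (X : E) (H.J Y : E)

/-- The derivative at `x` of `f` along the left-invariant vector field of `X ∈ 𝔤`, that is, the
derivative of `f (x exp (t X))` at `t = 0`. -/
def dirDeriv {F : Type*} [NormedAddCommGroup F] [NormedSpace ℝ F] (X : E) (f : G → F) (x : G) : F :=
  (mfderiv 𝓘(ℝ, E) 𝓘(ℝ, F) f x : E →L[ℝ] F) (mulInvariantVectorField (X : LieAlg E G) x)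

variable (E) in
/-- The algebra `A` of smooth real functions on `G/K`, as right `K`-invariant functions on `G`. -/
def Functions (K : Subgroup G) : Subalgebra ℝ (G → ℝ) where
  carrier := {f | ContMDiff 𝓘(ℝ, E) 𝓘(ℝ, ℝ) ∞ f ∧ ∀ (x : G) (s : K), f (x * s) = f x}
  mul_mem' {f f'} hf hf' := ⟨hf.1.mul hf'.1, fun x s => by simp [hf.2, hf'.2]⟩
  add_mem' {f f'} hf hf' := ⟨hf.1.add hf'.1, fun x s => by simp [hf.2, hf'.2]⟩
  algebraMap_mem' r := ⟨contMDiff_const, fun _ _ => rfl⟩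

variable (E) in
/-- The tangent vector fields of `G/K`: the smooth `V : G → 𝔪` with `V(x s) = Ad_s⁻¹ V(x)` for `s ∈ K`. -/
def VectorFields (K : Subgroup G) : Submodule ℝ (G → tangent E K) where
  carrier := {V | ContMDiff 𝓘(ℝ, E) 𝓘(ℝ, tangent E K) ∞ V ∧
    ∀ (x : G) (s : K), V (x * s) = adTangent s⁻¹ (V x)}
  zero_mem' := ⟨contMDiff_const, fun _ _ => by simp⟩
  add_mem' {V W} hV hW := ⟨hV.1.add hW.1, fun x s => by simp [hV.2, hW.2]⟩
  smul_mem' r V hV := ⟨by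
    have := (ContinuousLinearMap.contMDiff (n := ∞)
      (r • ContinuousLinearMap.id ℝ (tangent E K))).comp hV.1
    exact this, fun x s => by simp [hV.2]⟩

/-- The product of a vector field by a function on `G/K`. -/
def mulField {K : Subgroup G} (f : Functions E K) (V : VectorFields E K) : VectorFields E K :=
  ⟨fun x => f.1 x • V.1 x, ⟨f.2.1.smul V.2.1, fun x s => by simp [f.2.2, V.2.2]⟩⟩

/-- The action of `G` on vector fields by translation: `(λ_y V)(x) = V(y⁻¹ x)`. -/
def translate {K : Subgroup G} (y : G) (V : VectorFields E K) : VectorFields E K :=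
  ⟨fun x => V.1 (y⁻¹ * x), ⟨V.2.1.comp contMDiff_mul_left, fun x s => by
    change V.1 (y⁻¹ * (x * s)) = adTangent s⁻¹ (V.1 (y⁻¹ * x))
    rw [← mul_assoc, V.2.2]⟩⟩

/-- The derivative `δ_V f` of a function on `G/K` along a vector field. -/
def diffFun {K : Subgroup G} (V : VectorFields E K) (f : Functions E K) (x : G) : ℝ :=
  dirDeriv (V.1 x : E) f.1 x

variable (E) in
/-- A connection on the tangent bundle of `G/K`: `∇_V W` is `toFun V W`. -/
structure Connection (K : Subgroup G) where
  toFun : VectorFields E K → VectorFields E K → VectorFields E K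
  add_left : ∀ V V' W, toFun (V + V') W = toFun V W + toFun V' W
  smul_left : ∀ f V W, toFun (mulField f V) W = mulField f (toFun V W)
  add_right : ∀ V W W', toFun V (W + W') = toFun V W + toFun V W'
  leibniz : ∀ V (f : Functions E K) W x,
    (toFun V (mulField f W)).1 x = diffFun V f x • W.1 x + f.1 x • (toFun V W).1 x

variable [FiniteDimensional ℝ E]

/-- The pointwise action of `J` on vector fields. -/
def AlmostHermitian.JField {K : Subgroup G} (H : AlmostHermitian E K) (V : VectorFields E K) :
    VectorFields E K :=
  ⟨fun x => H.J (V.1 x), ⟨(LinearMap.toContinuousLinearMap H.J).contMDiff.comp V.2.1, fun x s => by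
    change H.J (V.1 (x * s)) = adTangent s⁻¹ (H.J (V.1 x))
    rw [V.2.2, H.J_Ad]⟩⟩

namespace Connection
variable {K : Subgroup G}

/-- `∇` is `G`-invariant. -/
def IsInvariant (D : Connection E K) : Prop :=
  ∀ y V W, translate y (D.toFun V W) = D.toFun (translate y V) (translate y W)

/-- `∇` is compatible with the Riemannian metric: `δ_U g(V, W) = g(∇_U V, W) + g(V, ∇_U W)`. -/
def IsCompatible (D : Connection E K) (H : AlmostHermitian E K) : Prop :=
  ∀ (U V W : VectorFields E K) (x : G),
    dirDeriv (U.1 x : E) (fun z => H.g (V.1 z) (W.1 z)) x =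
      H.g ((D.toFun U V).1 x) (W.1 x) + H.g (V.1 x) ((D.toFun U W).1 x)

/-- `∇` commutes with `J`. -/
def CommutesWithJ (D : Connection E K) (H : AlmostHermitian E K) : Prop :=
  ∀ V W, D.toFun V (H.JField W) = H.JField (D.toFun V W)

/-- The endomorphism `L_V(x)` of `𝔪_J` with `(∇_V W - ∇ᶜ_V W)(x) = L_V(x) (W(x))` for all `W`, where
`(∇ᶜ_V W)(x)` is the derivative of `W` at `x` along `V(x)` (the canonical connection). It exists when
`∇` commutes with `J`, because `∇ - ∇ᶜ` is linear over the functions on `G/K`, and it is unique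
because every vector of `𝔪` is the value at `x` of a vector field. -/
def form (D : Connection E K) (H : AlmostHermitian E K) (V : VectorFields E K) (x : G) :
    H.Cplx →ₗ[ℂ] H.Cplx :=
  Classical.epsilon fun T => ∀ W : VectorFields E K,
    T (H.toCplx (W.1 x)) = H.toCplx ((D.toFun V W).1 x - dirDeriv (V.1 x : E) W.1 x)

end Connection

namespace AlmostHermitian
variable {K : Subgroup G}

/-- The action of `s ∈ K` on spinors induced by its adjoint action on `𝔪_J`. -/
def spinorAd (H : AlmostHermitian E K) (s : K) : H.Spinor →ₗ[ℂ] H.Spinor :=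
  H.spinorMap (H.cplxMap (adTangent s) (fun X => (H.J_Ad s X).symm))

/-- The spinor fields on `G/K` for the character `χ` of `K`: the smooth `ψ : G → 𝒮` such that
`ψ(x s) = χ̄(s) Ad_s⁻¹ ψ(x)` for `s ∈ K`. -/
def SpinorFields (H : AlmostHermitian E K) (χ : K →ₜ* Circle) : Submodule ℂ (G → H.Spinor) where
  carrier := {ψ | ContMDiff 𝓘(ℝ, E) 𝓘(ℝ, H.Spinor) ∞ ψ ∧
    ∀ (x : G) (s : K), ψ (x * s) = starRingEnd ℂ (χ s : ℂ) • H.spinorAd s⁻¹ (ψ x)}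
  zero_mem' := ⟨contMDiff_const, fun _ _ => by simp⟩
  add_mem' {ψ φ} hψ hφ := ⟨hψ.1.add hφ.1, fun x s => by simp [hψ.2, hφ.2]⟩
  smul_mem' z ψ hψ := ⟨by
    have := ((ContinuousLinearMap.restrictScalars ℝ
      (z • ContinuousLinearMap.id ℂ H.Spinor)).contMDiff (n := ∞)).comp hψ.1
    exact this, fun x s => by simp [hψ.2, smul_comm z]⟩

/-- The connection on spinor fields induced by `∇`: `∇ˢ_V ψ = ∇ᶜ_V ψ + L_V ψ`, where `∇ᶜ_V ψ` is the
derivative of `ψ` along `V` and `L_V(x)` acts on spinors as a derivation. -/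
def spinorConnection (H : AlmostHermitian E K) (D : Connection E K) (V : VectorFields E K)
    (ψ : G → H.Spinor) (x : G) : H.Spinor :=
  dirDeriv (V.1 x : E) ψ x + H.spinorDeriv (D.form H V x) (ψ x)

/-- `𝒟` is the Dirac operator of `∇` and `χ`, that is `𝒟 ψ = κ(grad ψ)`. Here `grad ψ = ∑ₖ Uₖ ⊗ φₖ` is
the tensor that the metric identifies with `V ↦ ∇ˢ_V ψ`, so `∇ˢ_V ψ = ∑ₖ g(Uₖ, V) φₖ` for all `V`, and
`κ(grad ψ) = ∑ₖ κ(Uₖ) φₖ`. -/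
def IsDirac (H : AlmostHermitian E K) (D : Connection E K) (χ : K →ₜ* Circle)
    (𝒟 : H.SpinorFields χ →ₗ[ℂ] H.SpinorFields χ) : Prop :=
  ∀ ψ : H.SpinorFields χ, ∃ (n : ℕ) (U : Fin n → VectorFields E K) (φ : Fin n → H.SpinorFields χ),
    (∀ (V : VectorFields E K) (x : G),
      H.spinorConnection D V ψ.1 x = ∑ k, (H.g ((U k).1 x) (V.1 x) : ℂ) • (φ k).1 x) ∧
    ∀ x, (𝒟 ψ).1 x = ∑ k, H.cliffordAction ((U k).1 x) ((φ k).1 x)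

/-- `⟨𝒟 ψ, φ⟩ = ⟨ψ, 𝒟 φ⟩` for all spinor fields, for the `L²` inner product given by the invariant
measure `ν`; the integrand is a right `K`-invariant function, and its integral over `G/K` is the
integral over `G`. -/
def IsFormallySelfAdjoint [MeasurableSpace G] (ν : MeasureTheory.Measure G) (H : AlmostHermitian E K)
    (χ : K →ₜ* Circle) (𝒟 : H.SpinorFields χ →ₗ[ℂ] H.SpinorFields χ) : Prop :=
  ∀ ψ φ : H.SpinorFields χ,
    ∫ x, inner ℂ ((𝒟 ψ).1 x) (φ.1 x) ∂ν = ∫ x, inner ℂ (ψ.1 x) ((𝒟 φ).1 x) ∂ν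

end AlmostHermitian
end HomogeneousPart

end CoadjointDirac
open CoadjointDirac

/-!
The average of an inner product over Haar measure is invariant, so every `ad X` is skew for it and,
`𝔤` being semisimple, `Kil` is positive definite. Uniqueness of the polar decomposition then gives
uniqueness of `(g_⋄, J_⋄)` and its invariance under `Ad(K)`.

The canonical connection `∂` is invariant, so an invariant connection is `∇_V = ∂_V + A(V)` for a
single `Ad(K)`-invariant bilinear map `A` on `𝔪`, and compatibility makes the operators `A(X)`
skew-Hermitian on `𝔪_J`. In an orthonormal frame the Dirac operator is `D ψ = ∑ⱼ κ(eⱼ) ∇_{eⱼ} ψ`.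
As `κ(X)` is skew-Hermitian and `[A(X), κ(Y)] = κ(A(X) Y)`, the Leibniz rule turns
`⟨D ψ, φ⟩ - ⟨ψ, D φ⟩` into a sum of derivatives along left-invariant fields, whose integrals over
`G` vanish because Haar measure is right invariant, plus a Clifford product with `∑ⱼ A(eⱼ) eⱼ`. The
latter is a vector of `𝔪` fixed by `Ad(K)`. It commutes with the vector of `𝔨` that represents `μ`,
hence lies in `𝔨 ∩ 𝔪 = 0`.
-/

namespace CoadjointDirac

noncomputable section DerivativesAtOne

variable {E : Type*} [NormedAddCommGroup E] [NormedSpace ℝ E]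
  {F : Type*} [NormedAddCommGroup F] [NormedSpace ℝ F]
  {G : Type*} [TopologicalSpace G] [ChartedSpace E G]

variable (E) in
/-- The derivative at `1` of a function on `G`, as a linear map on the model space `E`, which is the
tangent space at `1`. -/
def derivOne [One G] (f : G → F) : E →L[ℝ] F := mfderiv 𝓘(ℝ, E) 𝓘(ℝ, F) f 1

lemma mfderiv_apply_congr_point {p q : G} (h : p = q) (f : G → F) (v : E) :
    (mfderiv 𝓘(ℝ, E) 𝓘(ℝ, F) f p : E →L[ℝ] F) v = (mfderiv 𝓘(ℝ, E) 𝓘(ℝ, F) f q : E →L[ℝ] F) v := by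
  subst h; rfl

lemma derivOne_comp [One G] {f : G → F} {c : G → G} (hc1 : c 1 = 1)
    (hf : MDifferentiableAt 𝓘(ℝ, E) 𝓘(ℝ, F) f 1) (hc : MDifferentiableAt 𝓘(ℝ, E) 𝓘(ℝ, E) c 1)
    (X : E) :
    derivOne E (fun x => f (c x)) X =
      derivOne E f ((mfderiv 𝓘(ℝ, E) 𝓘(ℝ, E) c 1 : E →L[ℝ] E) X) := by
  have hfc : MDifferentiableAt 𝓘(ℝ, E) 𝓘(ℝ, F) f (c 1) := by rwa [hc1]
  have hcomp := mfderiv_comp (I := 𝓘(ℝ, E)) (I' := 𝓘(ℝ, E)) (I'' := 𝓘(ℝ, F)) (1 : G) hfc hc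
  exact (congrArg (fun A : E →L[ℝ] F => A X) hcomp).trans (mfderiv_apply_congr_point hc1 _ _)

lemma derivOne_eq_fderiv [One G] {f : G → F} (hf : MDifferentiableAt 𝓘(ℝ, E) 𝓘(ℝ, F) f 1) :
    derivOne E f =
      fderiv ℝ (f ∘ (extChartAt 𝓘(ℝ, E) (1 : G)).symm) (extChartAt 𝓘(ℝ, E) (1 : G) 1) := by
  refine (if_pos hf).trans ?_
  simp only [writtenInExtChartAt, modelWithCornersSelf_coe, Set.range_id, fderivWithin_univ]
  rfl

lemma derivOne_extChartAt_one [One G] [IsManifold 𝓘(ℝ, E) 1 G] :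
    derivOne E (extChartAt 𝓘(ℝ, E) (1 : G)) = ContinuousLinearMap.id ℝ E :=
  mfderiv_extChartAt_self

lemma inTangentCoordinates_const [IsManifold 𝓘(ℝ, E) 1 G] {N : Type*} (p : G)
    (A : N → E →L[ℝ] F) (f : N → F) (x₀ : N) :
    inTangentCoordinates 𝓘(ℝ, E) 𝓘(ℝ, F) (fun _ : N => p) f A x₀ = A := by
  ext1 x
  refine (inTangentCoordinates_eq (I := 𝓘(ℝ, E)) (I' := 𝓘(ℝ, F)) (fun _ : N => p) f A (x₀ := x₀)
    (x := x) (mem_chart_source E p) (by rw [chartAt_self_eq]; exact Set.mem_univ _)).trans ?_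
  ext v
  simp only [ContinuousLinearMap.comp_apply]
  rw [(tangentBundleCore 𝓘(ℝ, E) G).coordChange_self _ _ (mem_chart_source E p)]
  simp

variable [One G] [IsManifold 𝓘(ℝ, E) ∞ G]

lemma contMDiffAt_derivOne {f : G → G → F} {x : G}
    (hf : ContMDiffAt (𝓘(ℝ, E).prod 𝓘(ℝ, E)) 𝓘(ℝ, F) ∞ (Function.uncurry f) (x, 1)) :
    ContMDiffAt 𝓘(ℝ, E) 𝓘(ℝ, E →L[ℝ] F) ∞ (fun z => derivOne E (f z)) x := by
  rw [← inTangentCoordinates_const (1 : G) (fun z : G => derivOne E (f z)) (fun z => f z 1) x]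
  exact ContMDiffAt.mfderiv (m := ∞) (n := ∞) f (fun _ => (1 : G)) hf contMDiffAt_const (by simp)

lemma contMDiffAt_derivOne_apply {f : G → G → F} {x : G}
    (hf : ContMDiffAt (𝓘(ℝ, E).prod 𝓘(ℝ, E)) 𝓘(ℝ, F) ∞ (Function.uncurry f) (x, 1)) (X : E) :
    ContMDiffAt 𝓘(ℝ, E) 𝓘(ℝ, F) ∞ (fun z => derivOne E (f z) X) x :=
  (ContinuousLinearMap.apply ℝ F X).contMDiff.contMDiffAt.comp x (contMDiffAt_derivOne hf)

end DerivativesAtOne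

noncomputable section DirectionalDerivatives

variable {E : Type*} [NormedAddCommGroup E] [NormedSpace ℝ E]
  {F : Type*} [NormedAddCommGroup F] [NormedSpace ℝ F]
  {F' : Type*} [NormedAddCommGroup F'] [NormedSpace ℝ F']
  {F'' : Type*} [NormedAddCommGroup F''] [NormedSpace ℝ F'']
  {G : Type*} [TopologicalSpace G] [ChartedSpace E G] [Group G]

lemma mulInvariantVectorField_one (X : LieAlg E G) :
    (mulInvariantVectorField (I := 𝓘(ℝ, E)) X (1 : G) : E) = X := by
  have hid : (fun y : G => (1 : G) * y) = id := by ext; simp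
  change (mfderiv 𝓘(ℝ, E) 𝓘(ℝ, E) (fun y : G => (1 : G) * y) 1 : E →L[ℝ] E) X = X
  rw [hid, mfderiv_id]; rfl

lemma dirDeriv_one (X : E) (f : G → F) : dirDeriv X f 1 = derivOne E f X :=
  congrArg (mfderiv 𝓘(ℝ, E) 𝓘(ℝ, F) f 1 : E →L[ℝ] F) (mulInvariantVectorField_one (G := G) X)

lemma dirDeriv_congr {X : E} {f f' : G → F} {x : G} (h : f =ᶠ[nhds x] f') :
    dirDeriv X f x = dirDeriv X f' x := by
  unfold dirDeriv
  rw [h.mfderiv_eq]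
  rfl

lemma dirDeriv_const (X : E) (c : F) (x : G) : dirDeriv X (fun _ : G => c) x = 0 := by
  unfold dirDeriv
  rw [mfderiv_const]; rfl

lemma dirDeriv_clm_comp (X : E) (A : F →L[ℝ] F') {f : G → F} {x : G}
    (hf : MDifferentiableAt 𝓘(ℝ, E) 𝓘(ℝ, F) f x) :
    dirDeriv X (fun y => A (f y)) x = A (dirDeriv X f x) := by
  have h := (A.hasMFDerivAt (x := f x)).comp x hf.hasMFDerivAt
  change (mfderiv 𝓘(ℝ, E) 𝓘(ℝ, F') (A ∘ f) x : E →L[ℝ] F') _ = _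
  rw [h.mfderiv]; rfl

lemma dirDeriv_add (X : E) {f f' : G → F} {x : G}
    (hf : MDifferentiableAt 𝓘(ℝ, E) 𝓘(ℝ, F) f x) (hf' : MDifferentiableAt 𝓘(ℝ, E) 𝓘(ℝ, F) f' x) :
    dirDeriv X (fun y => f y + f' y) x = dirDeriv X f x + dirDeriv X f' x := by
  have h := hf.hasMFDerivAt.add hf'.hasMFDerivAt
  change (mfderiv 𝓘(ℝ, E) 𝓘(ℝ, F) (f + f') x : E →L[ℝ] F) _ = _
  rw [h.mfderiv]; rfl

lemma dirDeriv_bilin (X : E) (B : F →L[ℝ] F' →L[ℝ] F'') {f : G → F} {f' : G → F'} {x : G}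
    (hf : MDifferentiableAt 𝓘(ℝ, E) 𝓘(ℝ, F) f x)
    (hf' : MDifferentiableAt 𝓘(ℝ, E) 𝓘(ℝ, F') f' x) :
    dirDeriv X (fun y => B (f y) (f' y)) x =
      B (dirDeriv X f x) (f' x) + B (f x) (dirDeriv X f' x) := by
  have hpair : HasMFDerivAt 𝓘(ℝ, E) 𝓘(ℝ, F × F') (fun y => (f y, f' y)) x
      ((mfderiv 𝓘(ℝ, E) 𝓘(ℝ, F) f x : E →L[ℝ] F).prod
        (mfderiv 𝓘(ℝ, E) 𝓘(ℝ, F') f' x : E →L[ℝ] F')) := by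
    rw [modelWithCornersSelf_prod, ← chartedSpaceSelf_prod]
    exact hf.hasMFDerivAt.prodMk hf'.hasMFDerivAt
  have h := HasMFDerivAt.comp (I' := 𝓘(ℝ, F × F')) x
    (B.hasFDerivAt_of_bilinear hasFDerivAt_fst hasFDerivAt_snd).hasMFDerivAt hpair
  change (mfderiv 𝓘(ℝ, E) 𝓘(ℝ, F'')
    ((fun p : F × F' => B p.1 p.2) ∘ fun y => (f y, f' y)) x : E →L[ℝ] F'') _ = _
  rw [h.mfderiv, add_comm]; rfl

variable [LieGroup 𝓘(ℝ, E) ∞ G]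

lemma mdifferentiableAt_mul_left (x y : G) :
    MDifferentiableAt 𝓘(ℝ, E) 𝓘(ℝ, E) (fun y : G => x * y) y :=
  (contMDiff_mul_left (I := 𝓘(ℝ, E)) (n := ∞)).mdifferentiable (by simp) y

lemma mdifferentiableAt_mul_right (x y : G) :
    MDifferentiableAt 𝓘(ℝ, E) 𝓘(ℝ, E) (fun y : G => y * x) y :=
  (contMDiff_mul_right (I := 𝓘(ℝ, E)) (n := ∞)).mdifferentiable (by simp) y

lemma dirDeriv_eq_derivOne (X : E) {f : G → F} {x : G}
    (hf : MDifferentiableAt 𝓘(ℝ, E) 𝓘(ℝ, F) f x) :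
    dirDeriv X f x = derivOne E (fun y => f (x * y)) X := by
  have hf' : MDifferentiableAt 𝓘(ℝ, E) 𝓘(ℝ, F) f (x * 1) := by rwa [mul_one]
  have hcomp := mfderiv_comp (I := 𝓘(ℝ, E)) (I' := 𝓘(ℝ, E)) (I'' := 𝓘(ℝ, F)) (1 : G) hf'
    (mdifferentiableAt_mul_left x 1)
  change _ = (mfderiv 𝓘(ℝ, E) 𝓘(ℝ, F) (f ∘ fun y => x * y) 1 : E →L[ℝ] F) X
  rw [hcomp, mul_one]
  rfl

lemma contMDiffAt_comp_mul {f : G → F} {x y : G}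
    (hf : ContMDiffAt 𝓘(ℝ, E) 𝓘(ℝ, F) ∞ f (x * y)) :
    ContMDiffAt (𝓘(ℝ, E).prod 𝓘(ℝ, E)) 𝓘(ℝ, F) ∞
      (Function.uncurry fun x y : G => f (x * y)) (x, y) :=
  ContMDiffAt.comp (g := f) (x, y) hf (contMDiff_mul 𝓘(ℝ, E) ∞).contMDiffAt

lemma dirDeriv_eventuallyEq_derivOne (X : E) {f : G → F} {x : G}
    (hf : ContMDiffAt 𝓘(ℝ, E) 𝓘(ℝ, F) ∞ f x) :
    dirDeriv X f =ᶠ[nhds x] fun z => derivOne E (fun y => f (z * y)) X := by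
  filter_upwards [(contMDiffAt_iff_contMDiffAt_nhds (n := 1) (by simp)).1 (hf.of_le (by simp))]
    with z hz
  exact dirDeriv_eq_derivOne X (hz.mdifferentiableAt (by simp))

lemma contMDiffAt_dirDeriv (X : E) {f : G → F} {x : G}
    (hf : ContMDiffAt 𝓘(ℝ, E) 𝓘(ℝ, F) ∞ f x) :
    ContMDiffAt 𝓘(ℝ, E) 𝓘(ℝ, F) ∞ (dirDeriv X f) x :=
  (contMDiffAt_derivOne_apply (contMDiffAt_comp_mul (by rwa [mul_one])) X).congr_of_eventuallyEq
    (dirDeriv_eventuallyEq_derivOne X hf)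

lemma contMDiff_dirDeriv (X : E) {f : G → F} (hf : ContMDiff 𝓘(ℝ, E) 𝓘(ℝ, F) ∞ f) :
    ContMDiff 𝓘(ℝ, E) 𝓘(ℝ, F) ∞ (dirDeriv X f) :=
  fun x => contMDiffAt_dirDeriv X (hf x)

/-- The derivative of `f` at `x` as a linear function of the direction. -/
def dirDerivₗ (f : G → F) (x : G) : E →ₗ[ℝ] F where
  toFun X := dirDeriv X f x
  map_add' X Y :=
    (congrArg (mfderiv 𝓘(ℝ, E) 𝓘(ℝ, F) f x : E →L[ℝ] F)
      (congrFun (mulInvariantVectorField_add (I := 𝓘(ℝ, E)) (G := G) X Y) x)).trans (map_add _ _ _)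
  map_smul' c X :=
    (congrArg (mfderiv 𝓘(ℝ, E) 𝓘(ℝ, F) f x : E →L[ℝ] F)
      (congrFun (mulInvariantVectorField_smul (I := 𝓘(ℝ, E)) (G := G) c X) x)).trans
        (map_smul _ _ _)

lemma dirDeriv_comp_mul_left (X : E) (y : G) {f : G → F} {x : G}
    (hf : MDifferentiableAt 𝓘(ℝ, E) 𝓘(ℝ, F) f (y * x)) :
    dirDeriv X (fun z => f (y * z)) x = dirDeriv X f (y * x) := by
  rw [dirDeriv_eq_derivOne X hf,
    dirDeriv_eq_derivOne (f := fun z => f (y * z)) X (hf.comp x (mdifferentiableAt_mul_left y x))]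
  simp only [mul_assoc]

variable (E) in
/-- The adjoint action on the model space `E`, which is the underlying vector space of `𝔤`; the
complement `𝔪` is a subspace of `E` rather than of `LieAlg E G`. -/
def adE (g : G) : E →ₗ[ℝ] E := Ad E g

lemma derivOne_comp_conj (X : E) (g : G) {f : G → F} (hf : MDifferentiableAt 𝓘(ℝ, E) 𝓘(ℝ, F) f 1) :
    derivOne E (fun y => f (g * y * g⁻¹)) X = derivOne E f (adE E g X) :=
  derivOne_comp (c := fun y => g * y * g⁻¹) (by simp) hf
    ((contMDiff_conj g).mdifferentiable (by simp) 1) X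

lemma dirDeriv_comp_mul_right (X : E) (s : G) {f : G → F} {x : G}
    (hf : MDifferentiableAt 𝓘(ℝ, E) 𝓘(ℝ, F) f (x * s)) :
    dirDeriv X (fun z => f (z * s)) x = dirDeriv (adE E s⁻¹ X) f (x * s) := by
  have hconj : (fun y : G => f (x * y * s)) = fun y => f (x * s * (s⁻¹ * y * s⁻¹⁻¹)) := by
    ext y; simp [mul_assoc]
  have hf1 : MDifferentiableAt 𝓘(ℝ, E) 𝓘(ℝ, F) (fun y => f (x * s * y)) 1 :=
    MDifferentiableAt.comp (I' := 𝓘(ℝ, E)) (g := f) 1 (by rwa [mul_one])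
      (mdifferentiableAt_mul_left _ _)
  rw [dirDeriv_eq_derivOne _ hf,
    dirDeriv_eq_derivOne (f := fun z => f (z * s)) X (hf.comp x (mdifferentiableAt_mul_right s x)),
    hconj]
  exact derivOne_comp_conj X s⁻¹ hf1

lemma contMDiff_adE (X : E) : ContMDiff 𝓘(ℝ, E) 𝓘(ℝ, E) ∞ (fun g : G => adE E g X) := by
  intro g
  set φ := extChartAt 𝓘(ℝ, E) (1 : G)
  have hφ : ContMDiffAt 𝓘(ℝ, E) 𝓘(ℝ, E) ∞ φ (1 : G) := contMDiffAt_extChartAt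
  -- The chart at `1` has derivative the identity there, so it does not change `Ad`.
  have hread : (fun z : G => adE E z X) = fun z => derivOne E (fun y => φ (z * y * z⁻¹)) X := by
    ext z
    rw [derivOne_comp_conj X z (hφ.mdifferentiableAt (by simp)), derivOne_extChartAt_one]
    rfl
  rw [hread]
  refine contMDiffAt_derivOne_apply (ContMDiffAt.comp (g := φ) (g, 1) ?_
    ((contMDiff_fst.mul contMDiff_snd).mul contMDiff_fst.inv).contMDiffAt) X
  simpa using hφ

end DirectionalDerivatives

section MixedPartials

variable {E₁ : Type*} [NormedAddCommGroup E₁] [NormedSpace ℝ E₁]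
  {E₂ : Type*} [NormedAddCommGroup E₂] [NormedSpace ℝ E₂]
  {F : Type*} [NormedAddCommGroup F] [NormedSpace ℝ F] {f : E₁ × E₂ → F} {a : E₁} {b : E₂}

lemma fderiv_partial_left (hf : DifferentiableAt ℝ f (a, b)) (X : E₁) :
    fderiv ℝ (fun u => f (u, b)) a X = fderiv ℝ f (a, b) (X, 0) := by
  have h : HasFDerivAt (fun u => f (u, b)) _ a :=
    HasFDerivAt.comp (g := f) a hf.hasFDerivAt
      ((hasFDerivAt_id (𝕜 := ℝ) a).prodMk (hasFDerivAt_const b a))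
  rw [h.fderiv]
  simp

lemma fderiv_partial_right (hf : DifferentiableAt ℝ f (a, b)) (Y : E₂) :
    fderiv ℝ (fun v => f (a, v)) b Y = fderiv ℝ f (a, b) (0, Y) := by
  have h : HasFDerivAt (fun v => f (a, v)) _ b :=
    HasFDerivAt.comp (g := f) b hf.hasFDerivAt
      ((hasFDerivAt_const a b).prodMk (hasFDerivAt_id (𝕜 := ℝ) b))
  rw [h.fderiv]
  simp

lemma fderiv_partial_comm (hf : ContDiffAt ℝ 2 f (a, b)) (X : E₁) (Y : E₂) :
    fderiv ℝ (fun u => fderiv ℝ (fun v => f (u, v)) b Y) a X =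
      fderiv ℝ (fun v => fderiv ℝ (fun u => f (u, v)) a X) b Y := by
  have hd : ∀ᶠ p in nhds (a, b), DifferentiableAt ℝ f p := by
    filter_upwards [hf.eventually (by simp)] with p hp
    exact hp.differentiableAt (by simp)
  have hY : (fun u => fderiv ℝ (fun v => f (u, v)) b Y) =ᶠ[nhds a]
      fun u => fderiv ℝ f (u, b) (0, Y) := by
    filter_upwards [((Continuous.prodMk_left b).tendsto a).eventually hd] with u hu
    exact fderiv_partial_right hu Y
  have hX : (fun v => fderiv ℝ (fun u => f (u, v)) a X) =ᶠ[nhds b]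
      fun v => fderiv ℝ f (a, v) (X, 0) := by
    filter_upwards [((Continuous.prodMk_right a).tendsto b).eventually hd] with v hv
    exact fderiv_partial_left hv X
  have hf' : DifferentiableAt ℝ (fderiv ℝ f) (a, b) :=
    (hf.fderiv_right (m := 1) (by norm_cast)).differentiableAt (by simp)
  have hsymm : IsSymmSndFDerivAt ℝ f (a, b) := hf.isSymmSndFDerivAt (by simp)
  rw [hY.fderiv_eq, hX.fderiv_eq,
    fderiv_partial_left (f := fun p => fderiv ℝ f p (0, Y)) (hf'.clm_apply (by fun_prop)),
    fderiv_partial_right (f := fun p => fderiv ℝ f p (X, 0)) (hf'.clm_apply (by fun_prop)),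
    fderiv_clm_apply hf' (by fun_prop), fderiv_clm_apply hf' (by fun_prop)]
  simpa using hsymm.eq (X, 0) (0, Y)

variable {E : Type*} [NormedAddCommGroup E] [NormedSpace ℝ E]
  {G : Type*} [TopologicalSpace G] [ChartedSpace E G] [One G] [IsManifold 𝓘(ℝ, E) ∞ G]
  {f : G → G → F}

lemma contDiffAt_chartOne_pair
    (hf : ContMDiffAt (𝓘(ℝ, E).prod 𝓘(ℝ, E)) 𝓘(ℝ, F) ∞ (Function.uncurry f) (1, 1)) :
    let φ := extChartAt 𝓘(ℝ, E) (1 : G)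
    ContDiffAt ℝ ∞ (fun p : E × E => f (φ.symm p.1) (φ.symm p.2)) (φ 1, φ 1) := by
  intro φ
  have hφ1 : φ.symm (φ 1) = 1 := extChartAt_to_inv (1 : G)
  have hφ : ContMDiffAt 𝓘(ℝ, E) 𝓘(ℝ, E) ∞ φ.symm (φ 1) :=
    (contMDiffOn_extChartAt_symm (1 : G)).contMDiffAt (extChartAt_target_mem_nhds (1 : G))
  rw [← contMDiffAt_iff_contDiffAt]
  have hfst : ContMDiffAt 𝓘(ℝ, E × E) 𝓘(ℝ, E) ∞ (fun p : E × E => φ.symm p.1) (φ 1, φ 1) :=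
    ContMDiffAt.comp (φ 1, φ 1) (g := φ.symm) hφ contDiff_fst.contMDiff.contMDiffAt
  have hsnd : ContMDiffAt 𝓘(ℝ, E × E) 𝓘(ℝ, E) ∞ (fun p : E × E => φ.symm p.2) (φ 1, φ 1) :=
    ContMDiffAt.comp (φ 1, φ 1) (g := φ.symm) hφ contDiff_snd.contMDiff.contMDiffAt
  refine ContMDiffAt.comp (φ 1, φ 1) (g := Function.uncurry f) ?_ (hfst.prodMk hsnd)
  simpa only [hφ1] using hf

lemma eventually_mdifferentiableAt_chartOne
    (hf : ContMDiffAt (𝓘(ℝ, E).prod 𝓘(ℝ, E)) 𝓘(ℝ, F) ∞ (Function.uncurry f) (1, 1)) :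
    let φ := extChartAt 𝓘(ℝ, E) (1 : G)
    ∀ᶠ u in nhds (φ 1), MDifferentiableAt 𝓘(ℝ, E) 𝓘(ℝ, F) (f (φ.symm u)) 1 := by
  intro φ
  have hφ1 : φ.symm (φ 1) = 1 := extChartAt_to_inv (1 : G)
  have hnear : ∀ᶠ p in nhds ((1 : G), (1 : G)),
      ContMDiffAt (𝓘(ℝ, E).prod 𝓘(ℝ, E)) 𝓘(ℝ, F) 1 (Function.uncurry f) p :=
    (contMDiffAt_iff_contMDiffAt_nhds (by simp)).1 (hf.of_le (by simp))
  have hlim : Filter.Tendsto (fun u => (φ.symm u, (1 : G))) (nhds (φ 1)) (nhds (1, 1)) := by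
    have := (continuousAt_extChartAt_symm (I := 𝓘(ℝ, E)) (1 : G)).prodMk_nhds
      (tendsto_const_nhds (x := (1 : G)))
    rwa [hφ1] at this
  filter_upwards [hlim.eventually hnear] with u hu
  exact (ContMDiffAt.comp (g := Function.uncurry f) (1 : G) hu
    (contMDiffAt_const.prodMk contMDiffAt_id)).mdifferentiableAt (by simp)

lemma derivOne_derivOne_eq_fderiv
    (hf : ContMDiffAt (𝓘(ℝ, E).prod 𝓘(ℝ, E)) 𝓘(ℝ, F) ∞ (Function.uncurry f) (1, 1)) (X Y : E) :
    let φ := extChartAt 𝓘(ℝ, E) (1 : G)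
    derivOne E (fun g => derivOne E (f g) Y) X =
      fderiv ℝ (fun u => fderiv ℝ (fun v => f (φ.symm u) (φ.symm v)) (φ 1) Y) (φ 1) X := by
  intro φ
  have hinner : ((fun g => derivOne E (f g) Y) ∘ φ.symm) =ᶠ[nhds (φ 1)]
      fun u => fderiv ℝ (fun v => f (φ.symm u) (φ.symm v)) (φ 1) Y := by
    filter_upwards [eventually_mdifferentiableAt_chartOne hf] with u hu
    rw [Function.comp_apply, derivOne_eq_fderiv hu]
    rfl
  rw [derivOne_eq_fderiv ((contMDiffAt_derivOne_apply hf Y).mdifferentiableAt (by simp)),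
    hinner.fderiv_eq]

lemma derivOne_comm
    (hf : ContMDiffAt (𝓘(ℝ, E).prod 𝓘(ℝ, E)) 𝓘(ℝ, F) ∞ (Function.uncurry f) (1, 1)) (X Y : E) :
    derivOne E (fun g => derivOne E (f g) Y) X =
      derivOne E (fun h => derivOne E (fun g => f g h) X) Y := by
  have hswap : ContMDiffAt (𝓘(ℝ, E).prod 𝓘(ℝ, E)) 𝓘(ℝ, F) ∞
      (Function.uncurry fun h g => f g h) ((1 : G), (1 : G)) :=
    ContMDiffAt.comp (g := Function.uncurry f) ((1 : G), (1 : G)) hf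
      (contMDiff_snd.prodMk contMDiff_fst).contMDiffAt
  rw [derivOne_derivOne_eq_fderiv hf, derivOne_derivOne_eq_fderiv hswap]
  exact fderiv_partial_comm ((contDiffAt_chartOne_pair hf).of_le ENat.LEInfty.out) X Y

end MixedPartials

noncomputable section BracketFormula

variable {E : Type*} [NormedAddCommGroup E] [NormedSpace ℝ E]
  {G : Type*} [TopologicalSpace G] [ChartedSpace E G] [Group G] [LieGroup 𝓘(ℝ, E) ∞ G]

variable (G) in
/-- The bracket of `𝔤` on the model space `E`; see `adE`. -/
def brE (X Y : E) : E := @Bracket.bracket (LieAlg E G) (LieAlg E G) _ X Y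

lemma dirDeriv_extChartAt_one (X : E) : dirDeriv X (extChartAt 𝓘(ℝ, E) (1 : G)) 1 = X := by
  rw [dirDeriv_one, derivOne_extChartAt_one]
  rfl

section ChartFormula
open VectorField

lemma mpullbackWithin_mulInvariantVectorField (X : E) :
    let φ := extChartAt 𝓘(ℝ, E) (1 : G)
    (mpullbackWithin 𝓘(ℝ, E) 𝓘(ℝ, E) φ.symm (mulInvariantVectorField (X : LieAlg E G))
      (Set.range 𝓘(ℝ, E)) : E → E) =ᶠ[nhds (φ 1)] dirDeriv X φ ∘ φ.symm := by
  intro φ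
  filter_upwards [extChartAt_target_mem_nhds (I := 𝓘(ℝ, E)) (1 : G)] with u hu
  have hinv := ContinuousLinearMap.inverse_eq
    (mfderivWithin_extChartAt_symm_comp_mfderiv_extChartAt hu)
    (mfderiv_extChartAt_comp_mfderivWithin_extChartAt_symm hu)
  exact congrArg (fun A : E →L[ℝ] E => A (mulInvariantVectorField (X : LieAlg E G) (φ.symm u))) hinv

lemma brE_eq_lieBracket (X Y : E) :
    let φ := extChartAt 𝓘(ℝ, E) (1 : G)
    brE G X Y = lieBracket ℝ (dirDeriv X φ ∘ φ.symm) (dirDeriv Y φ ∘ φ.symm) (φ 1) := by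
  intro φ
  let pull (Z : E) : E → E := mpullbackWithin 𝓘(ℝ, E) 𝓘(ℝ, E) φ.symm
    (mulInvariantVectorField (Z : LieAlg E G)) (Set.range 𝓘(ℝ, E))
  let b : E := lieBracketWithin ℝ (pull X) (pull Y) (φ.symm ⁻¹' Set.univ ∩ Set.range 𝓘(ℝ, E)) (φ 1)
  have hφ : mfderiv 𝓘(ℝ, E) 𝓘(ℝ, E) φ (1 : G) = ContinuousLinearMap.id ℝ E :=
    mfderiv_extChartAt_self
  calc brE G X Y = (fun A : E →L[ℝ] E => A.inverse b) (mfderiv 𝓘(ℝ, E) 𝓘(ℝ, E) φ (1 : G)) := rfl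
    _ = (ContinuousLinearMap.id ℝ E).inverse b :=
      congrArg (fun A : E →L[ℝ] E => A.inverse b) hφ
    _ = lieBracket ℝ (pull X) (pull Y) (φ 1) := by
      simp [b, ← lieBracketWithin_univ]
    _ = _ := (mpullbackWithin_mulInvariantVectorField X).lieBracket_vectorField_eq
      (mpullbackWithin_mulInvariantVectorField Y)

end ChartFormula

lemma brE_eq_derivOne (X Y : E) :
    let φ := extChartAt 𝓘(ℝ, E) (1 : G)
    brE G X Y = derivOne E (dirDeriv Y φ) X - derivOne E (dirDeriv X φ) Y := by
  intro φ
  have hd (Z : E) : MDifferentiableAt 𝓘(ℝ, E) 𝓘(ℝ, E) (dirDeriv Z φ) (1 : G) :=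
    (contMDiffAt_dirDeriv Z contMDiffAt_extChartAt).mdifferentiableAt (by simp)
  rw [brE_eq_lieBracket, VectorField.lieBracket_eq, derivOne_eq_fderiv (hd X),
    derivOne_eq_fderiv (hd Y)]
  simp only [Function.comp_apply, extChartAt_to_inv, dirDeriv_extChartAt_one]
  rfl

lemma dirDeriv_eq_derivOne_adE {F : Type*} [NormedAddCommGroup F] [NormedSpace ℝ F] (X : E)
    {f : G → F} {g : G} (hf : MDifferentiableAt 𝓘(ℝ, E) 𝓘(ℝ, F) f g) :
    dirDeriv X f g = derivOne E (fun k => f (k * g)) (adE E g X) := by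
  have hfg : MDifferentiableAt 𝓘(ℝ, E) 𝓘(ℝ, F) (fun k => f (k * g)) 1 :=
    MDifferentiableAt.comp (I' := 𝓘(ℝ, E)) (g := f) 1 (by rwa [one_mul])
      (mdifferentiableAt_mul_right _ _)
  rw [dirDeriv_eq_derivOne X hf, ← derivOne_comp_conj X g hfg]
  simp

/-- The product rule for `g ↦ d(k ↦ f (k g))₁ (Ad_g Y)`, which is `g ↦ dirDeriv Y f g`. -/
lemma derivOne_dirDeriv {F : Type*} [NormedAddCommGroup F] [NormedSpace ℝ F] {f : G → F}
    (hf : ContMDiffAt 𝓘(ℝ, E) 𝓘(ℝ, F) ∞ f 1) (X Y : E) :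
    derivOne E (dirDeriv Y f) X =
      derivOne E (dirDeriv X f) Y + derivOne E f (derivOne E (fun g : G => adE E g Y) X) := by
  have hmul : ContMDiffAt (𝓘(ℝ, E).prod 𝓘(ℝ, E)) 𝓘(ℝ, F) ∞
      (Function.uncurry fun g h : G => f (h * g)) (1, 1) :=
    ContMDiffAt.comp (g := f) ((1 : G), (1 : G)) (by simpa using hf)
      (contMDiff_snd.mul contMDiff_fst).contMDiffAt
  have hR : MDifferentiableAt 𝓘(ℝ, E) 𝓘(ℝ, E →L[ℝ] F)
      (fun g => derivOne E (fun k => f (k * g))) (1 : G) :=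
    (contMDiffAt_derivOne hmul).mdifferentiableAt (by simp)
  have hA : MDifferentiableAt 𝓘(ℝ, E) 𝓘(ℝ, E) (fun g : G => adE E g Y) 1 :=
    (contMDiff_adE Y).mdifferentiable (by simp) 1
  have hfirst : derivOne E (fun g => derivOne E (fun k => f (k * g)) Y) X =
      derivOne E (dirDeriv X f) Y := by
    rw [derivOne_comm hmul X Y, ← dirDeriv_one, ← dirDeriv_one,
      dirDeriv_congr (dirDeriv_eventuallyEq_derivOne X hf)]
  have hread : dirDeriv Y f =ᶠ[nhds (1 : G)]
      fun g => derivOne E (fun k => f (k * g)) (adE E g Y) := by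
    filter_upwards [(contMDiffAt_iff_contMDiffAt_nhds (n := 1) (by simp)).1
      (hf.of_le (by simp))] with g hg
    exact dirDeriv_eq_derivOne_adE Y (hg.mdifferentiableAt (by simp))
  have hprod := dirDeriv_bilin X (ContinuousLinearMap.id ℝ (E →L[ℝ] F)) hR hA
  have hclm := dirDeriv_clm_comp X (ContinuousLinearMap.apply ℝ F Y) hR
  have hone : adE E (1 : G) Y = Y := Ad_one_apply Y
  simp only [ContinuousLinearMap.id_apply, ContinuousLinearMap.apply_apply, hone, mul_one]
    at hprod hclm
  rw [← dirDeriv_one, dirDeriv_congr hread, hprod, ← hclm, dirDeriv_one, dirDeriv_one, hfirst]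

lemma derivOne_adE (X Y : E) :
    derivOne E (fun g : G => adE E g Y) X = brE G X Y := by
  rw [brE_eq_derivOne, derivOne_dirDeriv contMDiffAt_extChartAt X Y, derivOne_extChartAt_one,
    add_sub_cancel_left]
  rfl

end BracketFormula

noncomputable section OneParameterGroups

variable {E : Type*} [NormedAddCommGroup E] [NormedSpace ℝ E]
  {F : Type*} [NormedAddCommGroup F] [NormedSpace ℝ F]
  {G : Type*} [TopologicalSpace G] [ChartedSpace E G]

lemma hasDerivAt_comp_curve {γ : ℝ → G} {t : ℝ} (hγ : MDifferentiableAt 𝓘(ℝ, ℝ) 𝓘(ℝ, E) γ t)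
    {f : G → F} (hf : MDifferentiableAt 𝓘(ℝ, E) 𝓘(ℝ, F) f (γ t)) :
    HasDerivAt (fun t => f (γ t)) ((mfderiv 𝓘(ℝ, E) 𝓘(ℝ, F) f (γ t) : E →L[ℝ] F)
      ((mfderiv 𝓘(ℝ, ℝ) 𝓘(ℝ, E) γ t : ℝ →L[ℝ] E) 1)) t := by
  let A : E →L[ℝ] F := mfderiv 𝓘(ℝ, E) 𝓘(ℝ, F) f (γ t)
  let B : ℝ →L[ℝ] E := mfderiv 𝓘(ℝ, ℝ) 𝓘(ℝ, E) γ t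
  have hchain : HasFDerivAt (fun t => f (γ t)) (A.comp B) t :=
    (hf.hasMFDerivAt.comp t hγ.hasMFDerivAt).hasFDerivAt
  exact hchain.hasDerivAt

lemma hasDerivAt_comp_of_velocity [One G] {X : E} {γ : ℝ → G}
    (hγ : MDifferentiableAt 𝓘(ℝ, ℝ) 𝓘(ℝ, E) γ 0) (h0 : γ 0 = 1)
    (hX : (mfderiv 𝓘(ℝ, ℝ) 𝓘(ℝ, E) γ 0 : ℝ →L[ℝ] E) 1 = X) {f : G → F}
    (hf : MDifferentiableAt 𝓘(ℝ, E) 𝓘(ℝ, F) f 1) :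
    HasDerivAt (fun t => f (γ t)) (derivOne E f X) 0 := by
  refine (hasDerivAt_comp_curve hγ (by rwa [h0])).congr_deriv ?_
  rw [hX]
  exact mfderiv_apply_congr_point h0 f X

variable [Group G]

variable (G) in
/-- The left-invariant vector field of a vector of the model space. -/
abbrev leftField (X : E) (x : G) : TangentSpace 𝓘(ℝ, E) x :=
  mulInvariantVectorField (I := 𝓘(ℝ, E)) (X : LieAlg E G) x

lemma mfderiv_integralCurve {X : E} {γ : ℝ → G} (h : IsMIntegralCurve γ (leftField G X)) (t : ℝ) :
    (mfderiv 𝓘(ℝ, ℝ) 𝓘(ℝ, E) γ t : ℝ →L[ℝ] E) 1 = leftField G X (γ t) :=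
  (congrArg (fun A : ℝ →L[ℝ] E => A 1) (h t).mfderiv).trans (one_smul ℝ (leftField G X (γ t) : E))

lemma mfderiv_integralCurve_zero {X : E} {γ : ℝ → G} (h : IsMIntegralCurve γ (leftField G X))
    (h0 : γ 0 = 1) : (mfderiv 𝓘(ℝ, ℝ) 𝓘(ℝ, E) γ 0 : ℝ →L[ℝ] E) 1 = X := by
  have hpoint : ∀ p : G, p = 1 → (leftField G X p : E) = X := by
    rintro p rfl
    exact mulInvariantVectorField_one (G := G) X
  exact (mfderiv_integralCurve h 0).trans (hpoint _ h0)

lemma hasDerivAt_comp_integralCurve {X : E} {γ : ℝ → G} (h : IsMIntegralCurve γ (leftField G X))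
    {f : G → F} {t : ℝ} (hf : MDifferentiableAt 𝓘(ℝ, E) 𝓘(ℝ, F) f (γ t)) :
    HasDerivAt (fun t => f (γ t)) (dirDeriv X f (γ t)) t :=
  (hasDerivAt_comp_curve (h t).mdifferentiableAt hf).congr_deriv
    (congrArg (mfderiv 𝓘(ℝ, E) 𝓘(ℝ, F) f (γ t) : E →L[ℝ] F) (mfderiv_integralCurve h t))

variable [LieGroup 𝓘(ℝ, E) ∞ G]

lemma contMDiff_leftField (X : E) : ContMDiff 𝓘(ℝ, E) 𝓘(ℝ, E).tangent 1
    (fun x : G => (⟨x, leftField G X x⟩ : TangentBundle 𝓘(ℝ, E) G)) :=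
  (contMDiff_mulInvariantVectorField (I := 𝓘(ℝ, E)) (G := G) (X : LieAlg E G)).of_le (by
    rw [minSmoothness_of_isRCLikeNormedField]; norm_num)

lemma mfderiv_mul_left_leftField (X : E) (x y : G) :
    (mfderiv 𝓘(ℝ, E) 𝓘(ℝ, E) (fun z : G => x * z) y : E →L[ℝ] E) (leftField G X y) =
      leftField G X (x * y) := by
  have hcomp : mfderiv 𝓘(ℝ, E) 𝓘(ℝ, E) ((fun z : G => x * z) ∘ fun z => y * z) 1 = _ :=
    mfderiv_comp (I' := 𝓘(ℝ, E)) 1 (mdifferentiableAt_mul_left x (y * 1))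
      (mdifferentiableAt_mul_left y 1)
  have hassoc : (fun z : G => x * z) ∘ (fun z : G => y * z) = fun z => x * y * z := by
    ext z; simp [mul_assoc]
  rw [hassoc] at hcomp
  exact (mfderiv_congr_point (mul_one y).symm _ _).trans
    (congrArg (fun A : E →L[ℝ] E => A X) hcomp).symm

lemma hasMFDerivWithinAt_mul_left_curve {X : E} {γ : ℝ → G} {t : ℝ} (x : G) {s : Set ℝ}
    (h : HasMFDerivWithinAt 𝓘(ℝ, ℝ) 𝓘(ℝ, E) γ s t
      ((1 : ℝ →L[ℝ] ℝ).smulRight (leftField G X (γ t)))) :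
    HasMFDerivWithinAt 𝓘(ℝ, ℝ) 𝓘(ℝ, E) (fun t => x * γ t) s t
      ((1 : ℝ →L[ℝ] ℝ).smulRight (leftField G X (x * γ t))) := by
  refine ((mdifferentiableAt_mul_left x (γ t)).hasMFDerivAt.comp_hasMFDerivWithinAt t
    h).congr_mfderiv (ContinuousLinearMap.ext_ring ?_)
  change (mfderiv 𝓘(ℝ, E) 𝓘(ℝ, E) (fun z : G => x * z) (γ t) : E →L[ℝ] E)
    ((1 : ℝ) • leftField G X (γ t) : E) = ((1 : ℝ) • leftField G X (x * γ t) : E)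
  rw [one_smul, one_smul]
  exact mfderiv_mul_left_leftField X x (γ t)

lemma isMIntegralCurve_mul_left {X : E} {γ : ℝ → G} (h : IsMIntegralCurve γ (leftField G X))
    (x : G) : IsMIntegralCurve (fun t => x * γ t) (leftField G X) := fun t =>
  hasMFDerivWithinAt_univ.1 (hasMFDerivWithinAt_mul_left_curve x (hasMFDerivWithinAt_univ.2 (h t)))

lemma contDiffOn_comp_integralCurve {X : E} {γ : ℝ → G} (h : IsMIntegralCurve γ (leftField G X))
    {U : Set G} (hU : IsOpen U) (n : ℕ) {f : G → F}
    (hf : ∀ x ∈ U, ContMDiffAt 𝓘(ℝ, E) 𝓘(ℝ, F) ∞ f x) :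
    ContDiffOn ℝ n (fun t => f (γ t)) (γ ⁻¹' U) := by
  have hder {f : G → F} (hf : ∀ x ∈ U, ContMDiffAt 𝓘(ℝ, E) 𝓘(ℝ, F) ∞ f x) (t : ℝ)
      (ht : t ∈ γ ⁻¹' U) : HasDerivAt (fun t => f (γ t)) (dirDeriv X f (γ t)) t :=
    hasDerivAt_comp_integralCurve h ((hf _ ht).mdifferentiableAt (by simp))
  induction n generalizing f with
  | zero =>
    rw [Nat.cast_zero, contDiffOn_zero]
    exact fun t ht => (hder hf t ht).continuousAt.continuousWithinAt
  | succ n ih =>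
    rw [Nat.cast_succ, contDiffOn_succ_iff_deriv_of_isOpen (hU.preimage h.continuous)]
    exact ⟨fun t ht => (hder hf t ht).differentiableAt.differentiableWithinAt, by simp,
      (ih fun x hx => contMDiffAt_dirDeriv X (hf x hx)).congr fun t ht => (hder hf t ht).deriv⟩

lemma contMDiff_of_isMIntegralCurve {X : E} {γ : ℝ → G} (h : IsMIntegralCurve γ (leftField G X)) :
    ContMDiff 𝓘(ℝ, ℝ) 𝓘(ℝ, E) ∞ γ := by
  intro t
  have hU : IsOpen (chartAt E (γ t)).source := (chartAt E (γ t)).open_source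
  rw [contMDiffAt_iff_target, contMDiffAt_iff_contDiffAt, contDiffAt_infty]
  exact ⟨h.continuous.continuousAt, fun n =>
    (contDiffOn_comp_integralCurve h hU n fun x hx => contMDiffAt_extChartAt' hx).contDiffAt
      ((hU.preimage h.continuous).mem_nhds (mem_chart_source E (γ t)))⟩

lemma exists_oneParameterGroup [CompleteSpace E] [T2Space G] (X : E) :
    ∃ γ : ℝ → G, IsMIntegralCurve γ (leftField G X) ∧ ∀ s t, γ (s + t) = γ s * γ t := by
  have hfield := contMDiff_leftField (G := G) X
  obtain ⟨γ₀, hγ₀, hlocal⟩ :=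
    exists_isMIntegralCurveAt_of_contMDiffAt_boundaryless (t₀ := 0) (hfield.contMDiffAt (x := 1))
  obtain ⟨ε, hε, hball⟩ := isMIntegralCurveAt_iff'.1 hlocal
  rw [Real.ball_eq_Ioo, zero_sub, zero_add] at hball
  -- Left translates of `γ₀` are integral curves of one and the same length, so they extend.
  obtain ⟨γ, hγ0, hγ⟩ := exists_isMIntegralCurve_of_isMIntegralCurveOn hfield hε
    (fun x => ⟨fun t => x * γ₀ t, by simp [hγ₀],
      fun t ht => hasMFDerivWithinAt_mul_left_curve x (hball t ht)⟩) 1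
  refine ⟨γ, hγ, fun s t => ?_⟩
  have hshift : IsMIntegralCurve (fun t => γ (s + t)) (leftField G X) := by
    simpa only [Function.comp_def, add_comm] using hγ.comp_add s
  exact congrFun (isMIntegralCurve_Ioo_eq_of_contMDiff_boundaryless (t₀ := 0) hfield hshift
    (isMIntegralCurve_mul_left hγ (γ s)) (by simp [hγ0])) t

end OneParameterGroups

noncomputable section HaarIntegration
open MeasureTheory

lemma isMulRightInvariant_of_compactSpace {G : Type*} [TopologicalSpace G] [Group G]
    [IsTopologicalGroup G] [CompactSpace G] [MeasurableSpace G] [BorelSpace G] (ν : Measure G)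
    [ν.IsHaarMeasure] : ν.IsMulRightInvariant := by
  refine ⟨fun g => ?_⟩
  have huniq := Measure.isMulLeftInvariant_eq_smul_of_innerRegular (ν.map (· * g)) ν
  set c : NNReal := Measure.haarScalarFactor (ν.map (· * g)) ν
  have hmass : ν Set.univ = c * ν Set.univ := by
    have := congrArg (fun m : Measure G => m Set.univ) huniq
    simpa only [Measure.smul_apply, Measure.map_apply (measurable_mul_const g) MeasurableSet.univ,
      Set.preimage_univ, ENNReal.smul_def, smul_eq_mul] using this
  have hpos : ν Set.univ ≠ 0 := (isOpen_univ.measure_pos ν Set.univ_nonempty).ne'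
  have hc : (c : ENNReal) = 1 :=
    (ENNReal.mul_left_inj hpos isCompact_univ.measure_ne_top).1 (by rw [one_mul, ← hmass])
  rw [huniq, show c = 1 from mod_cast hc, one_smul]

lemma secondCountableTopology_of_compactSpace (E : Type*) [NormedAddCommGroup E] [NormedSpace ℝ E]
    [FiniteDimensional ℝ E] (G : Type*) [TopologicalSpace G] [ChartedSpace E G] [CompactSpace G] :
    SecondCountableTopology G :=
  have : ProperSpace E := FiniteDimensional.proper ℝ E
  ChartedSpace.secondCountable_of_sigmaCompact E G

lemma integrable_of_continuous {G : Type*} [TopologicalSpace G] [CompactSpace G]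
    [MeasurableSpace G] [OpensMeasurableSpace G] {F : Type*} [NormedAddCommGroup F]
    (ν : Measure G) [IsFiniteMeasureOnCompacts ν] {f : G → F} (hf : Continuous f) :
    Integrable f ν :=
  hf.integrable_of_hasCompactSupport (HasCompactSupport.of_compactSpace f)

variable {E : Type*} [NormedAddCommGroup E] [NormedSpace ℝ E] [FiniteDimensional ℝ E]
  {F : Type*} [NormedAddCommGroup F] [NormedSpace ℝ F]
  {G : Type*} [TopologicalSpace G] [ChartedSpace E G] [Group G] [LieGroup 𝓘(ℝ, E) ∞ G]
  [CompactSpace G] [MeasurableSpace G] [BorelSpace G]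

lemma hasDerivAt_integral_mul_curve (ν : Measure G) [IsFiniteMeasure ν] {X : E} {γ : ℝ → G}
    (hγ : IsMIntegralCurve γ (leftField G X)) (hγ0 : γ 0 = 1) {f : G → F}
    (hf : ContMDiff 𝓘(ℝ, E) 𝓘(ℝ, F) ∞ f) :
    HasDerivAt (fun t => ∫ x, f (x * γ t) ∂ν) (∫ x, dirDeriv X f x ∂ν) 0 := by
  have : SecondCountableTopology G := secondCountableTopology_of_compactSpace E G
  have : IsTopologicalGroup G := topologicalGroup_of_lieGroup 𝓘(ℝ, E) ∞
  have hX : Continuous (dirDeriv X f) := (contMDiff_dirDeriv X hf).continuous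
  obtain ⟨C, hC⟩ := isCompact_univ.exists_bound_of_continuousOn hX.continuousOn
  have hintegrable {f : G → F} (hf : Continuous f) (t : ℝ) : Integrable (fun x => f (x * γ t)) ν :=
    integrable_of_continuous ν (hf.comp (continuous_mul_const _))
  have hderiv := (hasDerivAt_integral_of_dominated_loc_of_deriv_le (μ := ν) (s := Set.univ)
    (F := fun t x => f (x * γ t)) (F' := fun t x => dirDeriv X f (x * γ t)) (x₀ := 0)
    (bound := fun _ => C) Filter.univ_mem (.of_forall fun t => (hintegrable hf.continuous t).1)
    (hintegrable hf.continuous 0) (hintegrable hX 0).1 (.of_forall fun x t _ => hC _ trivial)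
    (integrable_const C)
    (.of_forall fun x t _ => hasDerivAt_comp_integralCurve (isMIntegralCurve_mul_left hγ x)
      (hf.mdifferentiable (by simp) _))).2
  simpa only [hγ0, mul_one] using hderiv

lemma integral_dirDeriv [T2Space G] (ν : Measure G) [ν.IsHaarMeasure] (X : E) {f : G → F}
    (hf : ContMDiff 𝓘(ℝ, E) 𝓘(ℝ, F) ∞ f) : ∫ x, dirDeriv X f x ∂ν = 0 := by
  have : CompleteSpace E := FiniteDimensional.complete ℝ E
  have : SecondCountableTopology G := secondCountableTopology_of_compactSpace E G
  have : IsTopologicalGroup G := topologicalGroup_of_lieGroup 𝓘(ℝ, E) ∞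
  have : ν.IsMulRightInvariant := isMulRightInvariant_of_compactSpace ν
  have : IsFiniteMeasure ν := ⟨isCompact_univ.measure_lt_top⟩
  obtain ⟨γ, hγ, hmul⟩ := exists_oneParameterGroup (G := G) X
  have hderiv := hasDerivAt_integral_mul_curve ν hγ (by simpa using hmul 0 0) hf
  simp only [integral_mul_right_eq_self f] at hderiv
  exact hderiv.unique (hasDerivAt_const _ _)

end HaarIntegration

noncomputable section InnerProducts

variable {U V : Type*} [AddCommGroup U] [Module ℝ U] [AddCommGroup V] [Module ℝ V]

/-- An inner product on a real vector space, as a bilinear form: spaces such as `𝔤` and `𝔪` carry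
several inner products, none of which is the one of their norm. -/
structure IsInner (B : V →ₗ[ℝ] V →ₗ[ℝ] ℝ) : Prop where
  symm : ∀ X Y, B X Y = B Y X
  pos : ∀ X, X ≠ 0 → 0 < B X X

namespace IsInner

section Orthonormal

variable {B : V →ₗ[ℝ] V →ₗ[ℝ] ℝ} {ι : Type*} [DecidableEq ι] {b : Module.Basis ι ℝ V}
  (hb : ∀ i j, B (b i) (b j) = if i = j then 1 else 0)
include hb

lemma apply_eq_repr (i : ι) (X : V) : B (b i) X = b.repr X i :=
  LinearMap.congr_fun (g := b.coord i)
    (b.ext fun j => by simp [hb, Finsupp.single_apply, eq_comm (a := i)]) X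

variable [Fintype ι]

lemma sum_smul_eq (X : V) : ∑ i, B (b i) X • b i = X := by
  simp only [apply_eq_repr hb, b.sum_repr]

lemma trace_eq (A : V →ₗ[ℝ] V) : LinearMap.trace ℝ V A = ∑ i, B (b i) (A (b i)) := by
  rw [LinearMap.trace_eq_matrix_trace ℝ b, Matrix.trace]
  simp [LinearMap.toMatrix_apply, apply_eq_repr hb]

end Orthonormal

variable {B : V →ₗ[ℝ] V →ₗ[ℝ] ℝ} (hB : IsInner B)
include hB

lemma nonneg (X : V) : 0 ≤ B X X := by
  by_cases h : X = 0
  · simp [h]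
  · exact (hB.pos X h).le

lemma eq_zero {X : V} (h : B X X = 0) : X = 0 := by
  by_contra hX
  exact (hB.pos X hX).ne' h

lemma injective : Function.Injective B :=
  (injective_iff_map_eq_zero B).2 fun X h => hB.eq_zero (by rw [h, LinearMap.zero_apply])

lemma ext {X Y : V} (h : ∀ Z, B X Z = B Y Z) : X = Y := hB.injective (LinearMap.ext h)

lemma restrict (W : Submodule ℝ V) : IsInner (B.domRestrict₁₂ W W) :=
  ⟨fun X Y => hB.symm X Y, fun X hX => hB.pos X fun h => hX (Subtype.ext h)⟩

/-- The inner product space structure of an inner product. -/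
@[reducible]
def core : InnerProductSpace.Core ℝ V where
  inner X Y := B X Y
  conj_inner_symm X Y := by simp [hB.symm X Y]
  re_inner_nonneg X := by simpa using hB.nonneg X
  add_left X Y Z := by simp
  smul_left X Y r := by simp
  definite X h := hB.eq_zero h

variable [FiniteDimensional ℝ V]

lemma exists_eigenbasis {A : V →ₗ[ℝ] V} (hA : ∀ X Y, B (A X) Y = B X (A Y)) :
    ∃ (b : Module.Basis (Fin (Module.finrank ℝ V)) ℝ V) (c : Fin (Module.finrank ℝ V) → ℝ),
      (∀ i j, B (b i) (b j) = if i = j then 1 else 0) ∧ ∀ i, A (b i) = c i • b i := by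
  let := @InnerProductSpace.Core.toNormedAddCommGroup ℝ V _ _ _ hB.core
  let : InnerProductSpace ℝ V := @InnerProductSpace.ofCore ℝ V _ _ _ hB.core.toCore
  have hs : A.IsSymmetric := hA
  refine ⟨(hs.eigenvectorBasis rfl).toBasis, hs.eigenvalues rfl, fun i j => ?_, fun i => ?_⟩
  · rw [OrthonormalBasis.coe_toBasis]
    exact orthonormal_iff_ite.1 (hs.eigenvectorBasis rfl).orthonormal i j
  · simp

lemma exists_orthonormal_basis : ∃ b : Module.Basis (Fin (Module.finrank ℝ V)) ℝ V,
    ∀ i j, B (b i) (b j) = if i = j then 1 else 0 :=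
  let ⟨b, _, hb, _⟩ := hB.exists_eigenbasis (A := 0) fun X Y => by simp
  ⟨b, hb⟩

lemma surjective : Function.Surjective B :=
  (LinearMap.injective_iff_surjective_of_finrank_eq_finrank Subspace.dual_finrank_eq.symm).1
    hB.injective

lemma exists_operator (C : U →ₗ[ℝ] V →ₗ[ℝ] ℝ) : ∃ A : U →ₗ[ℝ] V, ∀ X Y, B (A X) Y = C X Y := by
  let e : V ≃ₗ[ℝ] Module.Dual ℝ V := LinearEquiv.ofBijective B ⟨hB.injective, hB.surjective⟩
  exact ⟨e.symm.toLinearMap ∘ₗ C, fun X Y => LinearMap.congr_fun (e.apply_symm_apply (C X)) Y⟩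

lemma exists_projection (W : Submodule ℝ V) :
    ∃ P : V →ₗ[ℝ] W, ∀ (X : V) (w : W), B (P X : V) w = B X w :=
  (hB.restrict W).exists_operator (B.compl₂ W.subtype)

lemma trace_sq_neg {A : V →ₗ[ℝ] V} (hA : ∀ X Y, B (A X) Y = -B X (A Y)) (h0 : A ≠ 0) :
    LinearMap.trace ℝ V (A ∘ₗ A) < 0 := by
  obtain ⟨b, hb⟩ := hB.exists_orthonormal_basis
  obtain ⟨i, hi⟩ : ∃ i, A (b i) ≠ 0 := by
    by_contra! h
    exact h0 (b.ext h)
  have hsq : ∀ j, B (b j) ((A ∘ₗ A) (b j)) = -B (A (b j)) (A (b j)) := fun j => by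
    rw [hA, neg_neg, LinearMap.comp_apply]
  rw [trace_eq hb, Finset.sum_congr rfl fun j _ => hsq j, Finset.sum_neg_distrib, neg_lt_zero]
  exact Finset.sum_pos' (fun j _ => hB.nonneg _) ⟨i, Finset.mem_univ i, hB.pos _ hi⟩

end IsInner
end InnerProducts

noncomputable section KillingForm
open MeasureTheory

lemma killingForm_neg_of_invariant {L : Type*} [LieRing L] [LieAlgebra ℝ L] [FiniteDimensional ℝ L]
    [LieAlgebra.IsSemisimple ℝ L] {B : L →ₗ[ℝ] L →ₗ[ℝ] ℝ} (hB : IsInner B)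
    (hinv : ∀ X Y Z : L, B ⁅X, Y⁆ Z = -B Y ⁅X, Z⁆) {X : L} (hX : X ≠ 0) :
    killingForm ℝ L X X < 0 := by
  rw [killingForm_apply_apply]
  refine hB.trace_sq_neg (fun Y Z => hinv X Y Z) fun h0 => hX ?_
  have hcenter : X ∈ LieAlgebra.center ℝ L := by
    rw [← LieAlgebra.self_module_ker_eq_center, LieModule.mem_ker]
    exact LinearMap.congr_fun h0
  rw [LieAlgebra.center_eq_bot] at hcenter
  exact (LieSubmodule.mem_bot _).1 hcenter

variable {E : Type*} [NormedAddCommGroup E] [NormedSpace ℝ E]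
  {G : Type*} [TopologicalSpace G] [ChartedSpace E G] [Group G] [LieGroup 𝓘(ℝ, E) ∞ G]

lemma adE_mul (g h : G) (X : E) : adE E (g * h) X = adE E g (adE E h X) := Ad_mul_apply g h X

lemma adE_one (X : E) : adE E (1 : G) X = X := Ad_one_apply X

lemma adE_inv_adE (g : G) (X : E) : adE E g⁻¹ (adE E g X) = X := Ad_inv_Ad g X

lemma adE_adE_inv (g : G) (X : E) : adE E g (adE E g⁻¹ X) = X := Ad_Ad_inv g X

lemma continuous_adE (X : E) : Continuous fun g : G => adE E g X := (contMDiff_adE X).continuous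

lemma mdifferentiableAt_adE (X : E) (g : G) :
    MDifferentiableAt 𝓘(ℝ, E) 𝓘(ℝ, E) (fun g : G => adE E g X) g :=
  (contMDiff_adE X).mdifferentiable (by simp) g

section Averaging

variable (B : E →L[ℝ] E →L[ℝ] ℝ)

lemma continuous_adE_bilin (X Y : E) : Continuous fun g : G => B (adE E g X) (adE E g Y) :=
  (B.continuous.comp (continuous_adE X)).clm_apply (continuous_adE Y)

variable [CompactSpace G] [MeasurableSpace G] [BorelSpace G] (ν : Measure G)
  [IsFiniteMeasureOnCompacts ν]

lemma integrable_adE_bilin (X Y : E) : Integrable (fun g : G => B (adE E g X) (adE E g Y)) ν :=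
  integrable_of_continuous ν (continuous_adE_bilin B X Y)

/-- The average `(X, Y) ↦ ∫ B(Ad_g X, Ad_g Y) dg` of a bilinear form over a compact group, which is
invariant under the adjoint action. -/
def averagedForm : E →ₗ[ℝ] E →ₗ[ℝ] ℝ :=
  LinearMap.mk₂ ℝ (fun X Y => ∫ g : G, B (adE E g X) (adE E g Y) ∂ν)
    (fun X X' Y => by
      rw [← integral_add (integrable_adE_bilin B ν _ _) (integrable_adE_bilin B ν _ _)]
      simp)
    (fun c X Y => by simp [integral_const_mul])
    (fun X Y Y' => by
      rw [← integral_add (integrable_adE_bilin B ν _ _) (integrable_adE_bilin B ν _ _)]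
      simp)
    (fun c X Y => by simp [integral_const_mul])

lemma averagedForm_adE [ν.IsMulRightInvariant] (h : G) (X Y : E) :
    averagedForm B ν (adE E h X) (adE E h Y) = averagedForm B ν X Y := by
  have : IsTopologicalGroup G := topologicalGroup_of_lieGroup 𝓘(ℝ, E) ∞
  change ∫ g : G, B (adE E g (adE E h X)) (adE E g (adE E h Y)) ∂ν =
    ∫ g : G, B (adE E g X) (adE E g Y) ∂ν
  rw [← integral_mul_right_eq_self (fun g : G => B (adE E g X) (adE E g Y)) h]
  simp only [adE_mul]

variable {B} in
lemma isInner_averagedForm [ν.IsOpenPosMeasure] (hsymm : ∀ X Y, B X Y = B Y X)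
    (hpos : ∀ X, X ≠ 0 → 0 < B X X) : IsInner (averagedForm B ν) := by
  have hB : IsInner (ContinuousLinearMap.coeLM ℝ ∘ₗ B.toLinearMap) := ⟨hsymm, hpos⟩
  refine ⟨fun X Y => integral_congr_ae (.of_forall fun g => hsymm _ _), fun X hX => ?_⟩
  refine (continuous_adE_bilin B X X).integral_pos_of_hasCompactSupport_nonneg_nonzero
    (HasCompactSupport.of_compactSpace _) (fun g => hB.nonneg _) (x := 1) ?_
  rw [adE_one]
  exact (hpos X hX).ne'

lemma exists_invariant_inner [FiniteDimensional ℝ E] (ν : Measure G) [ν.IsHaarMeasure] :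
    ∃ B : E →ₗ[ℝ] E →ₗ[ℝ] ℝ, IsInner B ∧ ∀ (g : G) X Y, B (adE E g X) (adE E g Y) = B X Y := by
  have := secondCountableTopology_of_compactSpace E G
  have : IsTopologicalGroup G := topologicalGroup_of_lieGroup 𝓘(ℝ, E) ∞
  have := isMulRightInvariant_of_compactSpace ν
  let e : E ≃L[ℝ] EuclideanSpace ℝ (Fin (Module.finrank ℝ E)) := toEuclidean
  let B : E →L[ℝ] E →L[ℝ] ℝ := (innerSL ℝ).bilinearComp e.toContinuousLinearMap
    e.toContinuousLinearMap
  refine ⟨averagedForm B ν, isInner_averagedForm ν (fun X Y => real_inner_comm (e Y) (e X))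
    fun X hX => ?_, averagedForm_adE B ν⟩
  exact real_inner_self_pos.2 (e.map_ne_zero_iff.2 hX)

end Averaging

variable [FiniteDimensional ℝ E]

lemma bracket_skew_of_invariant {B : E →ₗ[ℝ] E →ₗ[ℝ] ℝ}
    (hB : ∀ (g : G) X Y, B (adE E g X) (adE E g Y) = B X Y) (Z X Y : E) :
    B (brE G Z X) Y = -B X (brE G Z Y) := by
  let B' : E →L[ℝ] E →L[ℝ] ℝ := LinearMap.toContinuousLinearMap
    (LinearMap.toContinuousLinearMap.toLinearMap ∘ₗ B)
  have hderiv := dirDeriv_bilin Z B' (mdifferentiableAt_adE X (1 : G)) (mdifferentiableAt_adE Y 1)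
  have hconst : (fun g : G => B' (adE E g X) (adE E g Y)) = fun _ => B X Y :=
    funext fun g => hB g X Y
  rw [hconst, dirDeriv_const, adE_one, adE_one, dirDeriv_one, dirDeriv_one, derivOne_adE,
    derivOne_adE] at hderiv
  exact eq_neg_of_add_eq_zero_left hderiv.symm

variable [CompleteSpace E]

variable (E G) in
/-- The negative of the Killing form on the model space. -/
def kilE : E →ₗ[ℝ] E →ₗ[ℝ] ℝ := Kil E G

lemma isInner_kilE [CompactSpace G] [MeasurableSpace G] [BorelSpace G]
    [LieAlgebra.IsSemisimple ℝ (LieAlg E G)] (ν : Measure G) [ν.IsHaarMeasure] :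
    IsInner (kilE E G) := by
  obtain ⟨B, hB, hinv⟩ := exists_invariant_inner (E := E) ν
  refine ⟨fun X Y => ?_, fun X hX => ?_⟩
  · exact congrArg Neg.neg (LieModule.traceForm_comm ℝ (LieAlg E G) (LieAlg E G) X Y)
  · have hfin : @FiniteDimensional ℝ (LieAlg E G) _ LieRing.toAddCommGroup LieAlgebra.toModule :=
      ‹FiniteDimensional ℝ E›
    exact neg_pos.2 (@killingForm_neg_of_invariant (LieAlg E G) _ _ hfin _ B ⟨hB.symm, hB.pos⟩
      (fun X Y Z => bracket_skew_of_invariant hinv X Y Z) X hX)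

end KillingForm

noncomputable section StabilizerAlgebra

lemma hasDerivAt_linearMap_comp {V W : Type*} [NormedAddCommGroup V] [NormedSpace ℝ V]
    [FiniteDimensional ℝ V] [NormedAddCommGroup W] [NormedSpace ℝ W] (A : V →ₗ[ℝ] W) {f : ℝ → V}
    {f' : V} {t : ℝ} (hf : HasDerivAt f f' t) : HasDerivAt (fun t => A (f t)) (A f') t :=
  (LinearMap.toContinuousLinearMap A).hasFDerivAt.comp_hasDerivAt t hf

variable {E : Type*} [NormedAddCommGroup E] [NormedSpace ℝ E]
  {G : Type*} [TopologicalSpace G] [ChartedSpace E G] [Group G] [LieGroup 𝓘(ℝ, E) ∞ G]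
  {μ : Module.Dual ℝ (LieAlg E G)}

/-- A functional on `𝔤`, as a functional on the model space. -/
def dualE (μ : Module.Dual ℝ (LieAlg E G)) : E →ₗ[ℝ] ℝ := μ

lemma dualE_adE_of_mem {s : G} (hs : s ∈ stabilizer μ) (Y : E) :
    dualE μ (adE E s Y) = dualE μ Y := by
  have hfix : dualE μ (adE E s⁻¹⁻¹ Y) = dualE μ Y :=
    LinearMap.congr_fun (show coAd s⁻¹ μ = μ from (stabilizer μ).inv_mem hs) Y
  rwa [inv_inv] at hfix

lemma mem_stabilizer_of_dualE_adE {s : G} (h : ∀ Y, dualE μ (adE E s Y) = dualE μ Y) :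
    s ∈ stabilizer μ := by
  rw [← inv_mem_iff]
  refine LinearMap.ext fun Y => ?_
  have hfix := h Y
  rwa [← inv_inv s] at hfix

lemma hasDerivAt_adE_curve {γ : ℝ → G} (hγ : MDifferentiableAt 𝓘(ℝ, ℝ) 𝓘(ℝ, E) γ 0) (h0 : γ 0 = 1)
    {X : E} (hX : (mfderiv 𝓘(ℝ, ℝ) 𝓘(ℝ, E) γ 0 : ℝ →L[ℝ] E) 1 = X) (Y : E) :
    HasDerivAt (fun t => adE E (γ t) Y) (brE G X Y) 0 := by
  rw [← derivOne_adE]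
  exact hasDerivAt_comp_of_velocity hγ h0 hX (mdifferentiableAt_adE Y 1)

lemma exists_curve_of_mem_lieOf {K : Subgroup G} {X : E} (hX : X ∈ lieOf E K) :
    ∃ γ : ℝ → G, (∀ t, γ t ∈ K) ∧ ∀ Y, HasDerivAt (fun t => adE E (γ t) Y) (brE G X Y) 0 := by
  obtain ⟨γ, hγ, hmul, hmem, hvel⟩ := hX
  exact ⟨γ, hmem, hasDerivAt_adE_curve (hγ.mdifferentiable (by simp) 0) (by simpa using hmul 0 0)
    hvel⟩

lemma hasDerivAt_adE_oneParameterGroup {X : E} {γ : ℝ → G}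
    (hγ : IsMIntegralCurve γ (leftField G X)) (hmul : ∀ s t, γ (s + t) = γ s * γ t) (Y : E)
    (t : ℝ) : HasDerivAt (fun s => adE E (γ s) Y) (brE G X (adE E (γ t) Y)) t := by
  have h0 : γ 0 = 1 := by simpa using hmul 0 0
  have hzero := hasDerivAt_adE_curve (hγ 0).mdifferentiableAt h0 (mfderiv_integralCurve_zero hγ h0)
    (adE E (γ t) Y)
  rw [← sub_self t] at hzero
  convert! hzero.comp_sub_const t t using 2 with s
  rw [← adE_mul, ← hmul, sub_add_cancel]

variable [CompleteSpace E]

lemma adE_brE (g : G) (X Y : E) :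
    adE E g (brE G X Y) = brE G (adE E g X) (adE E g Y) := Ad_lie g X Y

lemma kilE_adE (g : G) (X Y : E) :
    kilE E G (adE E g X) (adE E g Y) = kilE E G X Y := Kil_Ad g X Y

lemma brE_skew (X Y : E) : brE G X Y = -brE G Y X :=
  (lie_skew (L := LieAlg E G) X Y).symm

lemma brE_self (X : E) : brE G X X = 0 := lie_self (L := LieAlg E G) X

/-- The Kirillov–Kostant–Souriau form on the model space. -/
def kksE (μ : Module.Dual ℝ (LieAlg E G)) : E →ₗ[ℝ] E →ₗ[ℝ] ℝ :=
  LinearMap.mk₂ ℝ (fun X Y => dualE μ (brE G X Y))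
    (fun X X' Y => (congrArg (dualE μ) (add_lie (L := LieAlg E G) (M := LieAlg E G) X X' Y)).trans
      (map_add _ _ _))
    (fun c X Y => (congrArg (dualE μ) (smul_lie (L := LieAlg E G) (M := LieAlg E G) c X Y)).trans
      (map_smul _ _ _))
    (fun X Y Y' => (congrArg (dualE μ) (lie_add (L := LieAlg E G) (M := LieAlg E G) X Y Y')).trans
      (map_add _ _ _))
    (fun c X Y => (congrArg (dualE μ) (lie_smul (L := LieAlg E G) (M := LieAlg E G) c X Y)).trans
      (map_smul _ _ _))

lemma kksE_apply (X Y : E) : kksE μ X Y = dualE μ (brE G X Y) := rfl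

lemma kksE_skew (μ : Module.Dual ℝ (LieAlg E G)) (X Y : E) : kksE μ X Y = -kksE μ Y X := by
  rw [kksE_apply, brE_skew, map_neg, kksE_apply]

lemma kksE_adE {s : G} (hs : s ∈ stabilizer μ) (X Y : E) :
    kksE μ (adE E s X) (adE E s Y) = kksE μ X Y := by
  rw [kksE_apply, ← adE_brE, dualE_adE_of_mem hs, kksE_apply]

/-- The Lie algebra of the stabilizer, as a subspace of the model space. -/
def stabSubmodule (μ : Module.Dual ℝ (LieAlg E G)) : Submodule ℝ E := LinearMap.ker (kksE μ)

lemma mem_stabSubmodule {X : E} : X ∈ stabSubmodule μ ↔ ∀ Y, kksE μ X Y = 0 :=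
  LinearMap.ext_iff

variable [FiniteDimensional ℝ E]

lemma kilE_brE (Z X Y : E) : kilE E G (brE G Z X) Y = -kilE E G X (brE G Z Y) :=
  bracket_skew_of_invariant (fun g X Y => kilE_adE g X Y) Z X Y

lemma kksE_eq_zero_of_mem_lieOf {X : E} (hX : X ∈ lieOf E (stabilizer μ)) (Y : E) :
    kksE μ X Y = 0 := by
  obtain ⟨γ, hmem, hderiv⟩ := exists_curve_of_mem_lieOf hX
  have hconst := hasDerivAt_linearMap_comp (dualE μ) (hderiv Y)
  simp only [dualE_adE_of_mem (hmem _)] at hconst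
  exact hconst.unique (hasDerivAt_const _ _)

variable [T2Space G]

lemma mem_lieOf_of_kksE_eq_zero {X : E} (hX : ∀ Y, kksE μ X Y = 0) :
    X ∈ lieOf E (stabilizer μ) := by
  obtain ⟨γ, hγ, hmul⟩ := exists_oneParameterGroup (G := G) X
  have h0 : γ 0 = 1 := by simpa using hmul 0 0
  refine ⟨γ, contMDiff_of_isMIntegralCurve hγ, hmul,
    fun t => mem_stabilizer_of_dualE_adE fun Y => ?_, mfderiv_integralCurve_zero hγ h0⟩
  have hderiv : ∀ s, HasDerivAt (fun s => dualE μ (adE E (γ s) Y)) 0 s := fun s =>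
    (hasDerivAt_linearMap_comp (dualE μ)
      (hasDerivAt_adE_oneParameterGroup hγ hmul Y s)).congr_deriv (hX _)
  have hconst := is_const_of_deriv_eq_zero (fun s => (hderiv s).differentiableAt)
    (fun s => (hderiv s).deriv) t 0
  simpa only [h0, adE_one] using hconst

lemma mem_lieOf_stabilizer_iff {X : E} : X ∈ lieOf E (stabilizer μ) ↔ X ∈ stabSubmodule μ :=
  ⟨fun hX => mem_stabSubmodule.2 (kksE_eq_zero_of_mem_lieOf hX),
    fun hX => mem_lieOf_of_kksE_eq_zero (mem_stabSubmodule.1 hX)⟩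

lemma mem_tangent_stabilizer_iff {X : E} :
    X ∈ tangent E (stabilizer μ) ↔ ∀ Y ∈ stabSubmodule μ, kilE E G Y X = 0 :=
  ⟨fun h Y hY => h Y ((mem_lieOf_stabilizer_iff (E := E)).2 hY),
    fun h Y hY => h Y ((mem_lieOf_stabilizer_iff (E := E)).1 hY)⟩

section Positive

variable (hK : IsInner (kilE E G))
include hK

lemma eq_zero_of_mem_stabSubmodule_of_mem_tangent {X : E} (hX : X ∈ stabSubmodule μ)
    (hX' : X ∈ tangent E (stabilizer μ)) : X = 0 :=
  hK.eq_zero (mem_tangent_stabilizer_iff.1 hX' X hX)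

lemma eq_zero_of_kksE_tangent {X : E} (hX : X ∈ tangent E (stabilizer μ))
    (h : ∀ Y ∈ tangent E (stabilizer μ), kksE μ X Y = 0) : X = 0 := by
  refine eq_zero_of_mem_stabSubmodule_of_mem_tangent hK (mem_stabSubmodule.2 fun Y => ?_) hX
  obtain ⟨P, hP⟩ := hK.exists_projection (stabSubmodule μ)
  have htangent : Y - P Y ∈ tangent E (stabilizer μ) := mem_tangent_stabilizer_iff.2 fun Z hZ => by
    rw [map_sub, hK.symm Z, hK.symm Z, hP Y ⟨Z, hZ⟩, sub_self]
  have hproj : kksE μ X (P Y : E) = 0 := by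
    rw [kksE_skew, mem_stabSubmodule.1 (P Y).2, neg_zero]
  simpa only [map_sub, hproj, sub_zero] using h _ htangent

lemma exists_kilE_eq_dualE (μ : Module.Dual ℝ (LieAlg E G)) :
    ∃ Z : E, Z ∈ lieOf E (stabilizer μ) ∧ kilE E G Z = dualE μ := by
  obtain ⟨Z, hZ⟩ := hK.surjective (dualE μ)
  refine ⟨Z, mem_lieOf_of_kksE_eq_zero fun X => ?_, hZ⟩
  rw [kksE_apply, ← hZ, ← neg_eq_zero, ← kilE_brE, brE_self, map_zero, LinearMap.zero_apply]

/-- The vector representing `μ` lies in `𝔨`, so a vector fixed by `K` commutes with it. -/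
lemma eq_zero_of_adE_fixed {Y : E} (hY : Y ∈ tangent E (stabilizer μ))
    (hfix : ∀ s ∈ stabilizer μ, adE E s Y = Y) : Y = 0 := by
  obtain ⟨Z, hZK, hZ⟩ := exists_kilE_eq_dualE hK μ
  obtain ⟨γ, hmem, hderiv⟩ := exists_curve_of_mem_lieOf hZK
  have hcomm : brE G Z Y = 0 := by
    have hconst := hderiv Y
    simp only [hfix _ (hmem _)] at hconst
    exact hconst.unique (hasDerivAt_const _ _)
  refine eq_zero_of_mem_stabSubmodule_of_mem_tangent hK (mem_stabSubmodule.2 fun X => ?_) hY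
  rw [kksE_apply, ← hZ, ← neg_eq_zero, ← kilE_brE, brE_skew, hcomm, neg_zero, map_zero,
    LinearMap.zero_apply]

end Positive

end StabilizerAlgebra

section PolarDecomposition

variable {V : Type*} [AddCommGroup V] [Module ℝ V]

/-- `Om(X, Y) = B(P J X, Y)`, with `P` symmetric and nonnegative and `J` an orthogonal complex
structure for `B`: the polar decomposition of the operator representing `Om`. -/
structure IsPolar (B Om : V →ₗ[ℝ] V →ₗ[ℝ] ℝ) (J P : V →ₗ[ℝ] V) : Prop where
  J_J : ∀ X, J (J X) = -X
  eq : ∀ X Y, Om X Y = B (P (J X)) Y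
  symm : ∀ X Y, B (P X) Y = B X (P Y)
  nonneg : ∀ X, 0 ≤ B (P X) X
  orth : ∀ X Y, B (J X) (J Y) = B X Y

variable {B Om : V →ₗ[ℝ] V →ₗ[ℝ] ℝ} (hB : IsInner B)

namespace IsInner
include hB

lemma apply_eq_sqrt_smul {P : V →ₗ[ℝ] V} (hP : ∀ X, 0 ≤ B (P X) X) {c : ℝ} (hc : 0 < c)
    {X : V} (hX : P (P X) = c • X) : P X = √c • X := by
  rw [← sub_eq_zero]
  apply hB.eq_zero
  set W := P X - √c • X with hW
  have hkernel : P W + √c • W = 0 := by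
    rw [hW, map_sub, map_smul, hX, smul_sub, smul_smul, Real.mul_self_sqrt hc.le]
    abel
  have hsum : B (P W) W + √c * B W W = 0 := by
    simpa using congrArg (fun Y => B Y W) hkernel
  have hzero : √c * B W W = 0 := by
    linarith [hP W, mul_nonneg (Real.sqrt_nonneg c) (hB.nonneg W)]
  exact (mul_eq_zero.1 hzero).resolve_left (Real.sqrt_pos.2 hc).ne'

variable [FiniteDimensional ℝ V]

lemma exists_eigenbasis_of_pos {A : V →ₗ[ℝ] V} (hA : ∀ X Y, B (A X) Y = B X (A Y))
    (hpos : ∀ X, X ≠ 0 → 0 < B (A X) X) :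
    ∃ (b : Module.Basis (Fin (Module.finrank ℝ V)) ℝ V) (c : Fin (Module.finrank ℝ V) → ℝ),
      (∀ i j, B (b i) (b j) = if i = j then 1 else 0) ∧ (∀ i, 0 < c i) ∧
        ∀ i, A (b i) = c i • b i := by
  obtain ⟨b, c, hb, hc⟩ := hB.exists_eigenbasis hA
  refine ⟨b, c, hb, fun i => ?_, hc⟩
  simpa [hc, hb] using hpos (b i) (b.ne_zero i)

lemma exists_sqrt {A : V →ₗ[ℝ] V} (hA : ∀ X Y, B (A X) Y = B X (A Y))
    (hpos : ∀ X, X ≠ 0 → 0 < B (A X) X) :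
    ∃ P : V →ₗ[ℝ] V, (∀ X Y, B (P X) Y = B X (P Y)) ∧ (∀ X, X ≠ 0 → 0 < B (P X) X) ∧
      ∀ X, P (P X) = A X := by
  obtain ⟨b, c, hb, hc, hbc⟩ := hB.exists_eigenbasis_of_pos hA hpos
  let P : V →ₗ[ℝ] V := b.constr ℝ fun i => √(c i) • b i
  have hPb : ∀ i, P (b i) = √(c i) • b i := fun i => b.constr_basis ..
  have hBP : ∀ X Y, B (P X) Y = ∑ i, √(c i) * (B (b i) X * B (b i) Y) := fun X Y => by
    conv_lhs => rw [← IsInner.sum_smul_eq hb X]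
    simp only [map_sum, map_smul, hPb, LinearMap.sum_apply, LinearMap.smul_apply, smul_eq_mul]
    exact Finset.sum_congr rfl fun i _ => by ring
  refine ⟨P, fun X Y => ?_, fun X hX => ?_, fun X => ?_⟩
  · rw [hB.symm X, hBP, hBP]
    exact Finset.sum_congr rfl fun i _ => by ring
  · obtain ⟨i, hi⟩ : ∃ i, B (b i) X ≠ 0 := by
      by_contra! h
      exact hX (by rw [← IsInner.sum_smul_eq hb X]; simp [h])
    rw [hBP]
    exact Finset.sum_pos' (fun j _ => mul_nonneg (Real.sqrt_nonneg _) (mul_self_nonneg _))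
      ⟨i, Finset.mem_univ i, mul_pos (Real.sqrt_pos.2 (hc i)) (mul_self_pos.2 hi)⟩
  · refine LinearMap.congr_fun (f := P ∘ₗ P) (b.ext fun i => ?_) X
    rw [LinearMap.comp_apply, hPb, map_smul, hPb, smul_smul, Real.mul_self_sqrt (hc i).le, hbc]

/-- Both sides act on an eigenvector of `P ∘ P` as the square root of the eigenvalue. -/
lemma sqrt_intertwine {P P' C : V →ₗ[ℝ] V} (hP : ∀ X Y, B (P X) Y = B X (P Y))
    (hPnonneg : ∀ X, 0 ≤ B (P X) X) (hPinj : Function.Injective P)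
    (hP'nonneg : ∀ X, 0 ≤ B (P' X) X) (hC : ∀ X, P' (P' (C X)) = C (P (P X))) (X : V) :
    P' (C X) = C (P X) := by
  obtain ⟨b, c, -, hc, hbc⟩ := hB.exists_eigenbasis_of_pos (A := P ∘ₗ P)
    (fun X Y => by rw [LinearMap.comp_apply, LinearMap.comp_apply, hP, hP])
    fun X hX => by
      rw [LinearMap.comp_apply, hP]
      exact hB.pos _ ((map_ne_zero_iff P hPinj).2 hX)
  refine LinearMap.congr_fun (f := P' ∘ₗ C) (g := C ∘ₗ P) (b.ext fun i => ?_) X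
  have hCb : P' (P' (C (b i))) = c i • C (b i) := by
    rw [hC, ← map_smul, ← hbc, LinearMap.comp_apply]
  rw [LinearMap.comp_apply, LinearMap.comp_apply, hB.apply_eq_sqrt_smul hP'nonneg (hc i) hCb,
    hB.apply_eq_sqrt_smul hPnonneg (hc i) (hbc i), map_smul]

end IsInner

section Skew

variable (hOm : ∀ X Y, Om X Y = -Om Y X)
include hB hOm

namespace IsPolar

lemma comm {J P : V →ₗ[ℝ] V} (h : IsPolar B Om J P) (X : V) : P (J X) = J (P X) := by
  refine hB.ext fun Y => ?_
  have hJskew : ∀ X Y, B (J X) Y = -B X (J Y) := fun X Y => by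
    rw [← h.orth X (J Y), h.J_J, map_neg, neg_neg]
  rw [hJskew, ← h.eq, hOm, h.eq, h.symm (J Y), hB.symm (J Y)]

lemma sq_comp_sq {J P : V →ₗ[ℝ] V} (h : IsPolar B Om J P) (X : V) :
    P (J (P (J X))) = -P (P X) := by
  rw [← h.comm hB hOm (J X), h.J_J, map_neg, map_neg]

omit hB hOm in
lemma injective {J P : V →ₗ[ℝ] V} (h : IsPolar B Om J P) (hnd : ∀ X, (∀ Y, Om X Y = 0) → X = 0) :
    Function.Injective P := by
  refine (injective_iff_map_eq_zero P).2 fun X hX => ?_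
  have hJX : J X = 0 := hnd _ fun Y => by
    rw [h.eq, h.J_J, map_neg, hX, neg_zero, map_zero, LinearMap.zero_apply]
  rw [← neg_eq_zero, ← h.J_J, hJX, map_zero]

lemma unique [FiniteDimensional ℝ V] (hnd : ∀ X, (∀ Y, Om X Y = 0) → X = 0)
    {J P J' P' : V →ₗ[ℝ] V} (h : IsPolar B Om J P) (h' : IsPolar B Om J' P') :
    J = J' ∧ P = P' := by
  have hfactor : ∀ X, P (J X) = P' (J' X) := fun X => hB.ext fun Y => by rw [← h.eq, ← h'.eq]
  have hsq : ∀ X, P' (P' X) = P (P X) := fun X => by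
    rw [← neg_inj, ← h.sq_comp_sq hB hOm, ← h'.sq_comp_sq hB hOm, hfactor, hfactor]
  have hP : P = P' := LinearMap.ext fun X =>
    (hB.sqrt_intertwine (C := LinearMap.id) h.symm h.nonneg (h.injective hnd) h'.nonneg hsq X).symm
  exact ⟨LinearMap.ext fun X => h.injective hnd (by rw [hfactor, hP]), hP⟩

end IsPolar

lemma exists_isPolar [FiniteDimensional ℝ V] (hnd : ∀ X, (∀ Y, Om X Y = 0) → X = 0) :
    ∃ J P : V →ₗ[ℝ] V, IsPolar B Om J P ∧ ∀ X, X ≠ 0 → 0 < B (P X) X := by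
  obtain ⟨Γ, hΓ⟩ := hB.exists_operator Om
  have hΓskew : ∀ X Y, B (Γ X) Y = -B X (Γ Y) := fun X Y => by rw [hΓ, hOm, hB.symm X, hΓ]
  have hΓne : ∀ X, X ≠ 0 → Γ X ≠ 0 := fun X hX h0 => hX <| hnd X fun Y => by
    rw [← hΓ, h0, map_zero, LinearMap.zero_apply]
  obtain ⟨P, hPsymm, hPpos, hPsq⟩ := hB.exists_sqrt (A := -(Γ ∘ₗ Γ))
    (fun X Y => by simp [hΓskew])
    fun X hX => by simpa [hΓskew] using hB.pos _ (hΓne X hX)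
  have hPnonneg : ∀ X, 0 ≤ B (P X) X := fun X => by
    by_cases hX : X = 0
    · simp [hX]
    · exact (hPpos X hX).le
  have hPinj : Function.Injective P := (injective_iff_map_eq_zero P).2 fun X hX => by
    by_contra hne
    exact (hPpos X hne).ne' (by rw [hX, map_zero, LinearMap.zero_apply])
  have hPΓ : ∀ X, P (Γ X) = Γ (P X) := hB.sqrt_intertwine hPsymm hPnonneg hPinj hPnonneg fun X => by
    simp [hPsq]
  let e : V ≃ₗ[ℝ] V := LinearEquiv.ofInjectiveEndo P hPinj
  let J : V →ₗ[ℝ] V := e.symm.toLinearMap ∘ₗ Γ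
  have hPJ : ∀ X, P (J X) = Γ X := fun X => e.apply_symm_apply (Γ X)
  have hJP : ∀ X, J (P X) = Γ X := fun X => hPinj (by rw [hPJ, hPΓ])
  refine ⟨J, P, ⟨fun X => ?_, fun X Y => by rw [hPJ, hΓ], hPsymm, hPnonneg, fun X Y => ?_⟩, hPpos⟩
  · apply hPinj
    apply hPinj
    rw [hPJ, hPΓ, hPJ, map_neg, map_neg, hPsq, LinearMap.neg_apply, neg_neg, LinearMap.comp_apply]
  · obtain ⟨U, rfl⟩ := e.surjective X
    obtain ⟨W, rfl⟩ := e.surjective Y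
    change B (J (P U)) (J (P W)) = B (P U) (P W)
    rw [hJP, hJP, hΓskew, hPsymm, hPsq, LinearMap.neg_apply, map_neg, LinearMap.comp_apply]

end Skew

end PolarDecomposition

noncomputable section KahlerStructure

variable {E : Type*} [NormedAddCommGroup E] [NormedSpace ℝ E] [CompleteSpace E]
  {G : Type*} [TopologicalSpace G] [ChartedSpace E G] [Group G] [LieGroup 𝓘(ℝ, E) ∞ G]
  {K : Subgroup G} {μ : Module.Dual ℝ (LieAlg E G)}

lemma coe_adTangent (s : K) (X : tangent E K) :
    (adTangent s X : E) = adE E (s : G) X := rfl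

lemma adTangent_inv_adTangent (s : K) (X : tangent E K) :
    adTangent s⁻¹ (adTangent s X) = X := Subtype.ext (adE_inv_adE (s : G) (X : E))

lemma adTangent_adTangent_inv (s : K) (X : tangent E K) :
    adTangent s (adTangent s⁻¹ X) = X := Subtype.ext (adE_adE_inv (s : G) (X : E))

variable (E) in
/-- The negative of the Killing form on `𝔪`. -/
def kilT (K : Subgroup G) : tangent E K →ₗ[ℝ] tangent E K →ₗ[ℝ] ℝ :=
  (kilE E G).domRestrict₁₂ (tangent E K) (tangent E K)

/-- The Kirillov–Kostant–Souriau form on `𝔪`. -/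
def kksT (μ : Module.Dual ℝ (LieAlg E G)) :
    tangent E (stabilizer μ) →ₗ[ℝ] tangent E (stabilizer μ) →ₗ[ℝ] ℝ :=
  (kksE μ).domRestrict₁₂ (tangent E (stabilizer μ)) (tangent E (stabilizer μ))

lemma kilT_apply (X Y : tangent E K) : kilT E K X Y = kilE E G (X : E) (Y : E) := rfl

lemma kilT_adTangent (s : K) (X Y : tangent E K) :
    kilT E K (adTangent s X) (adTangent s Y) = kilT E K X Y := kilE_adE (s : G) (X : E) (Y : E)

lemma kilT_adTangent_left (s : K) (X Y : tangent E K) :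
    kilT E K (adTangent s X) Y = kilT E K X (adTangent s⁻¹ Y) := by
  rw [← kilT_adTangent s X, adTangent_adTangent_inv]

lemma kksT_skew (μ : Module.Dual ℝ (LieAlg E G)) (X Y : tangent E (stabilizer μ)) :
    kksT μ X Y = -kksT μ Y X := kksE_skew μ _ _

lemma kksT_adTangent (s : stabilizer μ) (X Y : tangent E (stabilizer μ)) :
    kksT μ (adTangent s X) (adTangent s Y) = kksT μ X Y := kksE_adE s.2 (X : E) (Y : E)

lemma IsKahler.isPolar {H : AlmostHermitian E (stabilizer μ)} (h : IsKahler μ H) :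
    ∃ P, IsPolar (kilT E (stabilizer μ)) (kksT μ) H.J P := by
  obtain ⟨Γ, P, hΓ, hΓPJ, hsymm, hnonneg, horth⟩ := h.polar
  refine ⟨P, H.J_J, fun X Y => ?_, hsymm, hnonneg, horth⟩
  rw [← hΓPJ]
  exact hΓ X Y

lemma IsPolar.conj {J P : tangent E (stabilizer μ) →ₗ[ℝ] tangent E (stabilizer μ)}
    (h : IsPolar (kilT E (stabilizer μ)) (kksT μ) J P) (s : stabilizer μ) :
    IsPolar (kilT E (stabilizer μ)) (kksT μ) (adTangent s ∘ₗ J ∘ₗ adTangent s⁻¹)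
      (adTangent s ∘ₗ P ∘ₗ adTangent s⁻¹) where
  J_J X := by
    simp only [LinearMap.comp_apply, adTangent_inv_adTangent, h.J_J, map_neg,
      adTangent_adTangent_inv]
  eq X Y := by
    simp only [LinearMap.comp_apply, adTangent_inv_adTangent, kilT_adTangent_left]
    rw [← h.eq, kksT_adTangent]
  symm X Y := by
    simp only [LinearMap.comp_apply, kilT_adTangent_left]
    rw [h.symm, kilT_adTangent_left, inv_inv]
  nonneg X := by
    simp only [LinearMap.comp_apply, kilT_adTangent_left]
    exact h.nonneg _
  orth X Y := by
    simp only [LinearMap.comp_apply, kilT_adTangent, h.orth]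

variable (hK : IsInner (kilE E G))
include hK

lemma isInner_kilT (K : Subgroup G) : IsInner (kilT E K) := hK.restrict _

variable [FiniteDimensional ℝ E] [T2Space G]

lemma eq_zero_of_kksT (X : tangent E (stabilizer μ)) (h : ∀ Y, kksT μ X Y = 0) : X = 0 :=
  Subtype.ext (eq_zero_of_kksE_tangent hK X.2 fun Y hY => h ⟨Y, hY⟩)

lemma IsPolar.unique_kksT {J P J' P' : tangent E (stabilizer μ) →ₗ[ℝ] tangent E (stabilizer μ)}
    (h : IsPolar (kilT E (stabilizer μ)) (kksT μ) J P)
    (h' : IsPolar (kilT E (stabilizer μ)) (kksT μ) J' P') : J = J' ∧ P = P' :=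
  h.unique (isInner_kilT hK _) (kksT_skew μ) (eq_zero_of_kksT hK) h'

lemma IsPolar.comm_adTangent {J P : tangent E (stabilizer μ) →ₗ[ℝ] tangent E (stabilizer μ)}
    (h : IsPolar (kilT E (stabilizer μ)) (kksT μ) J P) (s : stabilizer μ)
    (X : tangent E (stabilizer μ)) :
    J (adTangent s X) = adTangent s (J X) ∧ P (adTangent s X) = adTangent s (P X) := by
  obtain ⟨hJ, hP⟩ := h.unique_kksT hK (h.conj s)
  constructor
  · conv_lhs => rw [hJ]
    simp only [LinearMap.comp_apply, adTangent_inv_adTangent]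
  · conv_lhs => rw [hP]
    simp only [LinearMap.comp_apply, adTangent_inv_adTangent]

lemma IsKahler.ext {H H' : AlmostHermitian E (stabilizer μ)} (h : IsKahler μ H)
    (h' : IsKahler μ H') : H = H' := by
  obtain ⟨P, hP⟩ := h.isPolar
  obtain ⟨P', hP'⟩ := h'.isPolar
  have hJ : H.J = H'.J := (hP.unique_kksT hK hP').1
  have hg : H.g = H'.g := LinearMap.ext₂ fun X Y => by rw [h.metric, h'.metric, hJ]
  obtain ⟨⟨J, g, _, _, _, _⟩, _, _⟩ := H
  obtain ⟨⟨J', g', _, _, _, _⟩, _, _⟩ := H'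
  obtain rfl : J = J' := hJ
  obtain rfl : g = g' := hg
  rfl

lemma existsUnique_isKahler (μ : Module.Dual ℝ (LieAlg E G)) :
    ∃! H : AlmostHermitian E (stabilizer μ), IsKahler μ H := by
  have hkil := isInner_kilT hK (stabilizer μ)
  obtain ⟨J, P, hP, hpos⟩ := exists_isPolar hkil (kksT_skew μ) (eq_zero_of_kksT hK)
  have hPJ := hP.comm hkil (kksT_skew μ)
  let H : AlmostHermitian E (stabilizer μ) :=
    { J := J
      g := kilT E (stabilizer μ) ∘ₗ P
      J_J := hP.J_J
      g_symm X Y := by rw [LinearMap.comp_apply, LinearMap.comp_apply, hP.symm, hkil.symm]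
      g_pos := hpos
      g_J X Y := by rw [LinearMap.comp_apply, LinearMap.comp_apply, hPJ, hP.orth]
      J_Ad s X := (hP.comm_adTangent hK s X).1
      g_Ad s X Y := by
        rw [LinearMap.comp_apply, LinearMap.comp_apply, (hP.comm_adTangent hK s X).2,
          kilT_adTangent] }
  have hH : IsKahler μ H :=
    { polar := ⟨P ∘ₗ J, P, hP.eq, fun _ => rfl, hP.symm, hP.nonneg, hP.orth⟩
      metric X Y := by
        change kilT E (stabilizer μ) (P X) Y = kksT μ X (J Y)
        rw [hP.eq, hPJ, hP.orth] }
  exact ⟨H, hH, fun H' hH' => hH'.ext hK hH⟩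

end KahlerStructure

noncomputable section FockSpace

open ExteriorAlgebra (ι ιMulti)

section Induction

variable {R M : Type*} [CommRing R] [AddCommGroup M] [Module R M] {P : ExteriorAlgebra R M → Prop}

lemma exterior_induction (one : P 1) (add : ∀ φ ψ, P φ → P ψ → P (φ + ψ))
    (smul : ∀ (r : R) φ, P φ → P (r • φ)) (ι_mul : ∀ X φ, P φ → P (ι R X * φ))
    (φ : ExteriorAlgebra R M) : P φ := by
  induction φ using CliffordAlgebra.left_induction with
  | algebraMap r => exact Algebra.algebraMap_eq_smul_one (A := ExteriorAlgebra R M) r ▸ smul r 1 one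
  | add φ ψ hφ hψ => exact add φ ψ hφ hψ
  | ι_mul φ X hφ => exact ι_mul X φ hφ

lemma ιMulti_induction (mem : ∀ p (X : Fin p → M), P (ιMulti R p X))
    (add : ∀ φ ψ, P φ → P ψ → P (φ + ψ)) (smul : ∀ (r : R) φ, P φ → P (r • φ))
    (φ : ExteriorAlgebra R M) : P φ := by
  have hφ : φ ∈ Submodule.span R (Set.range fun X : Σ p, (Fin p → M) => ιMulti R X.1 X.2) :=
    ExteriorAlgebra.ιMulti_span (R := R) (M := M) ▸ Submodule.mem_top
  induction hφ using Submodule.span_induction with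
  | mem φ hφ =>
    obtain ⟨⟨p, X⟩, rfl⟩ := hφ
    exact mem p X
  | zero => simpa only [zero_smul] using smul 0 _ (mem 0 0)
  | add φ ψ _ _ hφ hψ => exact add φ ψ hφ hψ
  | smul r φ _ hφ => exact smul r φ hφ

end Induction

variable {M : Type*} [NormedAddCommGroup M] [InnerProductSpace ℂ M]

lemma extDeriv_one (T : M →ₗ[ℂ] M) : extDeriv T 1 = 0 := by
  simpa only [one_mul, mul_one, left_eq_add] using extDeriv_mul T 1 1

lemma extDeriv_ι_mul (T : M →ₗ[ℂ] M) (X : M) (φ : ExteriorAlgebra ℂ M) :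
    extDeriv T (ι ℂ X * φ) = ι ℂ (T X) * φ + ι ℂ X * extDeriv T φ := by
  rw [extDeriv_mul, extDeriv_ι]

lemma extDeriv_add (T T' : M →ₗ[ℂ] M) (φ : ExteriorAlgebra ℂ M) :
    extDeriv (T + T') φ = extDeriv T φ + extDeriv T' φ := by
  induction φ using exterior_induction with
  | one => simp only [extDeriv_one, add_zero]
  | add φ ψ hφ hψ => simp only [map_add, hφ, hψ]; abel
  | smul z φ hφ => simp only [map_smul, hφ, smul_add]
  | ι_mul X φ hφ =>
    simp only [extDeriv_ι_mul, hφ, LinearMap.add_apply, map_add, add_mul, mul_add]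
    abel

lemma extDeriv_smul (z : ℂ) (T : M →ₗ[ℂ] M) (φ : ExteriorAlgebra ℂ M) :
    extDeriv (z • T) φ = z • extDeriv T φ := by
  induction φ using exterior_induction with
  | one => simp only [extDeriv_one, smul_zero]
  | add φ ψ hφ hψ => simp only [map_add, hφ, hψ, smul_add]
  | smul w φ hφ => rw [map_smul, map_smul, hφ, smul_comm]
  | ι_mul X φ hφ =>
    simp only [extDeriv_ι_mul, hφ, LinearMap.smul_apply, map_smul, smul_add, smul_mul_assoc,
      mul_smul_comm]

lemma extDeriv_map {S T T' : M →ₗ[ℂ] M} (hS : ∀ X, S (T X) = T' (S X))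
    (φ : ExteriorAlgebra ℂ M) :
    ExteriorAlgebra.map S (extDeriv T φ) = extDeriv T' (ExteriorAlgebra.map S φ) := by
  induction φ using exterior_induction with
  | one => simp only [extDeriv_one, map_one, map_zero]
  | add φ ψ hφ hψ => simp only [map_add, hφ, hψ]
  | smul w φ hφ => simp only [map_smul, hφ]
  | ι_mul X φ hφ =>
    simp only [extDeriv_ι_mul, map_add, map_mul, ExteriorAlgebra.map_apply_ι, hφ, hS]

lemma fockAnnihilate_map {S : M →ₗ[ℂ] M} (hS : ∀ X Y, inner ℂ (S X) (S Y) = inner ℂ X Y) (X : M)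
    (φ : ExteriorAlgebra ℂ M) :
    ExteriorAlgebra.map S (fockAnnihilate X φ) =
      fockAnnihilate (S X) (ExteriorAlgebra.map S φ) := by
  induction φ using exterior_induction with
  | one => simp only [fockAnnihilate_one, map_one, map_zero]
  | add φ ψ hφ hψ => simp only [map_add, hφ, hψ]
  | smul w φ hφ => simp only [map_smul, hφ]
  | ι_mul Y φ hφ =>
    simp only [fockAnnihilate_ι_mul, map_sub, map_mul, map_smul, ExteriorAlgebra.map_apply_ι, hφ,
      hS]

lemma fockClifford_apply (X : M) (φ : ExteriorAlgebra ℂ M) :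
    fockClifford X φ = Complex.I • (fockAnnihilate X φ + ι ℂ X * φ) := rfl

lemma fockClifford_map {S : M →ₗ[ℂ] M} (hS : ∀ X Y, inner ℂ (S X) (S Y) = inner ℂ X Y) (X : M)
    (φ : ExteriorAlgebra ℂ M) :
    ExteriorAlgebra.map S (fockClifford X φ) = fockClifford (S X) (ExteriorAlgebra.map S φ) := by
  simp only [fockClifford_apply, map_smul, map_add, map_mul, ExteriorAlgebra.map_apply_ι,
    fockAnnihilate_map hS]

lemma extDeriv_fockAnnihilate {T : M →ₗ[ℂ] M} (hT : ∀ X Y, inner ℂ (T X) Y = -inner ℂ X (T Y))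
    (X : M) (φ : ExteriorAlgebra ℂ M) :
    extDeriv T (fockAnnihilate X φ) =
      fockAnnihilate X (extDeriv T φ) + fockAnnihilate (T X) φ := by
  induction φ using exterior_induction with
  | one => simp only [fockAnnihilate_one, extDeriv_one, map_zero, add_zero]
  | add φ ψ hφ hψ => simp only [map_add, hφ, hψ]; abel
  | smul w φ hφ => simp only [map_smul, hφ, smul_add]
  | ι_mul Y φ hφ =>
    simp only [fockAnnihilate_ι_mul, extDeriv_ι_mul, map_add, map_sub, map_smul, hφ, hT, mul_add,
      neg_smul]
    abel

lemma extDeriv_fockClifford {T : M →ₗ[ℂ] M} (hT : ∀ X Y, inner ℂ (T X) Y = -inner ℂ X (T Y))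
    (X : M) (φ : ExteriorAlgebra ℂ M) :
    extDeriv T (fockClifford X φ) = fockClifford X (extDeriv T φ) + fockClifford (T X) φ := by
  simp only [fockClifford_apply, map_smul, map_add, extDeriv_ι_mul, extDeriv_fockAnnihilate hT,
    ← smul_add]
  congr 1
  abel

lemma fockAnnihilate_add (X Y : M) (φ : ExteriorAlgebra ℂ M) :
    fockAnnihilate (X + Y) φ = fockAnnihilate X φ + fockAnnihilate Y φ := by
  simp only [fockAnnihilate, map_add, LinearMap.add_apply]

lemma fockAnnihilate_smul (z : ℂ) (X : M) (φ : ExteriorAlgebra ℂ M) :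
    fockAnnihilate (z • X) φ = starRingEnd ℂ z • fockAnnihilate X φ := by
  simp only [fockAnnihilate, LinearMap.map_smulₛₗ, LinearMap.smul_apply, RingHom.id_apply]

lemma fockClifford_add (X Y : M) (φ : ExteriorAlgebra ℂ M) :
    fockClifford (X + Y) φ = fockClifford X φ + fockClifford Y φ := by
  simp only [fockClifford_apply, fockAnnihilate_add, map_add, add_mul, ← smul_add]
  congr 1
  abel

lemma fockClifford_smul_real (r : ℝ) (X : M) (φ : ExteriorAlgebra ℂ M) :
    fockClifford ((r : ℂ) • X) φ = (r : ℂ) • fockClifford X φ := by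
  simp only [fockClifford_apply, fockAnnihilate_smul, map_smul, smul_mul_assoc,
    Complex.conj_ofReal, ← smul_add]
  rw [smul_comm]

lemma fockAnnihilate_ιMulti (X : M) (q : ℕ) (Y : Fin (q + 1) → M) :
    fockAnnihilate X (ιMulti ℂ (q + 1) Y) =
      ∑ j : Fin (q + 1), ((-1) ^ (j : ℕ) * inner ℂ X (Y j) : ℂ) •
        ιMulti ℂ q (fun i => Y (j.succAbove i)) := by
  induction q with
  | zero =>
    rw [ExteriorAlgebra.ιMulti_succ_apply, fockAnnihilate_ι_mul, ExteriorAlgebra.ιMulti_zero_apply,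
      fockAnnihilate_one]
    simp
  | succ q ih =>
    rw [ExteriorAlgebra.ιMulti_succ_apply, fockAnnihilate_ι_mul, ih, Fin.sum_univ_succ (n := q + 1),
      sub_eq_add_neg, Finset.mul_sum, ← Finset.sum_neg_distrib]
    simp only [Fin.val_zero, pow_zero, one_mul, Fin.zero_succAbove, Fin.val_succ, pow_succ]
    congr 1
    refine Finset.sum_congr rfl fun j _ => ?_
    have htail : Matrix.vecTail (fun i => Y (j.succ.succAbove i)) =
        fun i => Matrix.vecTail Y (j.succAbove i) := by
      ext i
      simp only [Matrix.vecTail, Function.comp_apply, Fin.succ_succAbove_succ]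
    rw [ExteriorAlgebra.ιMulti_succ_apply (v := fun i => Y (j.succ.succAbove i)), htail]
    simp only [Fin.succ_succAbove_zero, mul_smul_comm, mul_neg, mul_one, neg_mul, neg_smul]
    rfl

section InnerProduct

variable [FiniteDimensional ℂ M]

lemma extInner_conj (φ ψ : ExteriorAlgebra ℂ M) : starRingEnd ℂ (extInner φ ψ) = extInner ψ φ :=
  extCore.conj_inner_symm ψ φ

lemma extInner_add_left (φ φ' ψ : ExteriorAlgebra ℂ M) :
    extInner (φ + φ') ψ = extInner φ ψ + extInner φ' ψ :=
  extCore.add_left φ φ' ψ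

lemma extInner_smul_left (z : ℂ) (φ ψ : ExteriorAlgebra ℂ M) :
    extInner (z • φ) ψ = starRingEnd ℂ z * extInner φ ψ :=
  extCore.smul_left φ ψ z

lemma extInner_add_right (φ ψ ψ' : ExteriorAlgebra ℂ M) :
    extInner φ (ψ + ψ') = extInner φ ψ + extInner φ ψ' := by
  rw [← extInner_conj, extInner_add_left, map_add, extInner_conj, extInner_conj]

lemma extInner_smul_right (z : ℂ) (φ ψ : ExteriorAlgebra ℂ M) :
    extInner φ (z • ψ) = z * extInner φ ψ := by
  rw [← extInner_conj, extInner_smul_left, map_mul, extInner_conj, Complex.conj_conj]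

/-- The linear functional `⟨φ, ·⟩` on the exterior algebra. -/
def extInnerₗ (φ : ExteriorAlgebra ℂ M) : ExteriorAlgebra ℂ M →ₗ[ℂ] ℂ where
  toFun := extInner φ
  map_add' := extInner_add_right φ
  map_smul' z := extInner_smul_right z φ

lemma extInner_zero_right (φ : ExteriorAlgebra ℂ M) : extInner φ 0 = 0 :=
  (extInnerₗ φ).map_zero

lemma extInner_zero_left (φ : ExteriorAlgebra ℂ M) : extInner 0 φ = 0 := by
  rw [← extInner_conj, extInner_zero_right, map_zero]

lemma extInner_sum_smul_right {κ : Type*} (s : Finset κ) (φ : ExteriorAlgebra ℂ M) (z : κ → ℂ)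
    (ψ : κ → ExteriorAlgebra ℂ M) :
    extInner φ (∑ j ∈ s, z j • ψ j) = ∑ j ∈ s, z j * extInner φ (ψ j) :=
  (map_sum (extInnerₗ φ) (fun j => z j • ψ j) s).trans
    (Finset.sum_congr rfl fun j _ => extInner_smul_right (z j) φ (ψ j))

-- For equal degrees this is the expansion of the Gram determinant along the row of `X`.
lemma extInner_ι_mul_ιMulti (X : M) (p q : ℕ) (W : Fin p → M) (Y : Fin q → M) :
    extInner (ι ℂ X * ιMulti ℂ p W) (ιMulti ℂ q Y) =
      extInner (ιMulti ℂ p W) (fockAnnihilate X (ιMulti ℂ q Y)) := by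
  have hcons : ι ℂ X * ιMulti ℂ p W = ιMulti ℂ (p + 1) (Fin.cons X W) := by
    rw [ExteriorAlgebra.ιMulti_succ_apply]; rfl
  rw [hcons, extInner_ιMulti]
  cases q with
  | zero =>
    rw [dif_neg p.succ_ne_zero, ExteriorAlgebra.ιMulti_zero_apply, fockAnnihilate_one,
      extInner_zero_right]
  | succ q =>
    simp only [fockAnnihilate_ιMulti, extInner_sum_smul_right, extInner_ιMulti]
    by_cases hpq : p = q
    · subst hpq
      simp only [↓reduceDIte, Matrix.det_succ_row_zero]
      rfl
    · simp only [Nat.add_right_cancel_iff, hpq, ↓reduceDIte, mul_zero, Finset.sum_const_zero]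

lemma extInner_ι_mul (X : M) (φ ψ : ExteriorAlgebra ℂ M) :
    extInner (ι ℂ X * φ) ψ = extInner φ (fockAnnihilate X ψ) := by
  induction φ using ιMulti_induction with
  | mem p W =>
    induction ψ using ιMulti_induction with
    | mem q Y => exact extInner_ι_mul_ιMulti X p q W Y
    | add ψ ψ' hψ hψ' => rw [extInner_add_right, hψ, hψ', map_add, extInner_add_right]
    | smul z ψ hψ => rw [extInner_smul_right, hψ, map_smul, extInner_smul_right]
  | add φ φ' hφ hφ' => rw [mul_add, extInner_add_left, hφ, hφ', extInner_add_left]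
  | smul z φ hφ => rw [mul_smul_comm, extInner_smul_left, hφ, extInner_smul_left]

lemma extInner_fockAnnihilate (X : M) (φ ψ : ExteriorAlgebra ℂ M) :
    extInner (fockAnnihilate X φ) ψ = extInner φ (ι ℂ X * ψ) := by
  rw [← extInner_conj, ← extInner_ι_mul, extInner_conj]

lemma extInner_fockClifford (X : M) (φ ψ : ExteriorAlgebra ℂ M) :
    extInner (fockClifford X φ) ψ = -extInner φ (fockClifford X ψ) := by
  simp only [fockClifford_apply, extInner_smul_left, extInner_add_left, extInner_smul_right,
    extInner_add_right, extInner_ι_mul, extInner_fockAnnihilate, Complex.conj_I]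
  ring

lemma extInner_one_extDeriv (T : M →ₗ[ℂ] M) (φ : ExteriorAlgebra ℂ M) :
    extInner 1 (extDeriv T φ) = 0 := by
  have one_ι_mul (X : M) (ψ : ExteriorAlgebra ℂ M) : extInner 1 (ι ℂ X * ψ) = 0 := by
    rw [← extInner_fockAnnihilate, fockAnnihilate_one, extInner_zero_left]
  induction φ using exterior_induction with
  | one => rw [extDeriv_one, extInner_zero_right]
  | add φ ψ hφ hψ => rw [map_add, extInner_add_right, hφ, hψ, add_zero]
  | smul z φ hφ => rw [map_smul, extInner_smul_right, hφ, mul_zero]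
  | ι_mul X φ _ => rw [extDeriv_ι_mul, extInner_add_right, one_ι_mul, one_ι_mul, add_zero]

lemma extInner_extDeriv {T : M →ₗ[ℂ] M} (hT : ∀ X Y, inner ℂ (T X) Y = -inner ℂ X (T Y))
    (φ ψ : ExteriorAlgebra ℂ M) : extInner (extDeriv T φ) ψ = -extInner φ (extDeriv T ψ) := by
  induction φ using exterior_induction generalizing ψ with
  | one => rw [extDeriv_one, extInner_zero_left, extInner_one_extDeriv, neg_zero]
  | add φ φ' hφ hφ' => rw [map_add, extInner_add_left, hφ, hφ', extInner_add_left, neg_add]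
  | smul z φ hφ => rw [map_smul, extInner_smul_left, hφ, extInner_smul_left, mul_neg]
  | ι_mul X φ hφ =>
    rw [extDeriv_ι_mul, extInner_add_left, extInner_ι_mul, extInner_ι_mul, hφ, extInner_ι_mul,
      extDeriv_fockAnnihilate hT, extInner_add_right]
    ring

end InnerProduct

end FockSpace

noncomputable section SpinorOperators

namespace HermitianStructure

variable {V : Type*} [AddCommGroup V] [Module ℝ V] (h : HermitianStructure V)

lemma isInner_g : IsInner h.g := ⟨h.g_symm, h.g_pos⟩

lemma ofReal_smul_toCplx (r : ℝ) (X : V) : (r : ℂ) • h.toCplx X = h.toCplx (r • X) := by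
  simp only [smul_toCplx, Complex.ofReal_re, Complex.ofReal_im, zero_smul, add_zero]

variable {h} {S T T' : V →ₗ[ℝ] V} (hS : ∀ X, S (h.J X) = h.J (S X))
  (hT : ∀ X, T (h.J X) = h.J (T X)) (hT' : ∀ X, T' (h.J X) = h.J (T' X))

lemma cplxMap_toCplx (X : V) : h.cplxMap T hT (h.toCplx X) = h.toCplx (T X) := rfl

lemma inner_cplxMap_of_skew (hskew : ∀ X Y, h.g (T X) Y = -h.g X (T Y)) (X Y : h.Cplx) :
    inner ℂ (h.cplxMap T hT X) Y = -inner ℂ X (h.cplxMap T hT Y) := by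
  obtain ⟨X, rfl⟩ := h.toCplx.surjective X
  obtain ⟨Y, rfl⟩ := h.toCplx.surjective Y
  rw [cplxMap_toCplx, cplxMap_toCplx, inner_toCplx, inner_toCplx, hskew, ← hT, hskew]
  push_cast
  ring

lemma inner_cplxMap_of_orthogonal (horth : ∀ X Y, h.g (S X) (S Y) = h.g X Y) (X Y : h.Cplx) :
    inner ℂ (h.cplxMap S hS X) (h.cplxMap S hS Y) = inner ℂ X Y := by
  obtain ⟨X, rfl⟩ := h.toCplx.surjective X
  obtain ⟨Y, rfl⟩ := h.toCplx.surjective Y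
  rw [cplxMap_toCplx, cplxMap_toCplx, inner_toCplx, inner_toCplx, ← hS, horth, horth]

variable [FiniteDimensional ℝ V]

variable (h) in
/-- The inner product of spinors as a real bilinear map. -/
def spinorInner : h.Spinor →ₗ[ℝ] h.Spinor →ₗ[ℝ] ℂ :=
  LinearMap.mk₂ ℝ (fun φ ψ => inner ℂ φ ψ) inner_add_left
    (fun r φ ψ => (inner_smul_left (𝕜 := ℂ) φ ψ (r : ℂ)).trans
      (by rw [Complex.conj_ofReal]; exact Complex.real_smul.symm))
    inner_add_right
    (fun r φ ψ => (inner_smul_right (𝕜 := ℂ) φ ψ (r : ℂ)).trans Complex.real_smul.symm)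

lemma spinorInner_cliffordAction (X : V) (φ ψ : h.Spinor) :
    h.spinorInner (h.cliffordAction X φ) ψ = -h.spinorInner φ (h.cliffordAction X ψ) :=
  extInner_fockClifford (h.toCplx X) φ ψ

variable (h) in
/-- The Clifford action of vectors on spinors as a real bilinear map. -/
def cliffordBilin : V →ₗ[ℝ] h.Spinor →ₗ[ℝ] h.Spinor :=
  LinearMap.mk₂ ℝ (fun X φ => h.cliffordAction X φ)
    (fun X Y => fockClifford_add (h.toCplx X) (h.toCplx Y))
    (fun r X φ => by
      have hsmul := fockClifford_smul_real r (h.toCplx X) φ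
      rw [ofReal_smul_toCplx] at hsmul
      exact hsmul)
    (fun X => map_add (h.cliffordAction X))
    (fun r X φ => by rw [← Complex.coe_smul, map_smul, Complex.coe_smul])

lemma spinorInner_spinorDeriv (hskew : ∀ X Y, h.g (T X) Y = -h.g X (T Y)) (φ ψ : h.Spinor) :
    h.spinorInner (h.spinorDeriv (h.cplxMap T hT) φ) ψ =
      -h.spinorInner φ (h.spinorDeriv (h.cplxMap T hT) ψ) :=
  extInner_extDeriv (inner_cplxMap_of_skew hT hskew) φ ψ

lemma spinorDeriv_cliffordAction (hskew : ∀ X Y, h.g (T X) Y = -h.g X (T Y)) (X : V)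
    (φ : h.Spinor) :
    h.spinorDeriv (h.cplxMap T hT) (h.cliffordAction X φ) =
      h.cliffordAction X (h.spinorDeriv (h.cplxMap T hT) φ) + h.cliffordAction (T X) φ :=
  extDeriv_fockClifford (inner_cplxMap_of_skew hT hskew) (h.toCplx X) φ

lemma spinorMap_cliffordAction (horth : ∀ X Y, h.g (S X) (S Y) = h.g X Y) (X : V)
    (φ : h.Spinor) :
    h.spinorMap (h.cplxMap S hS) (h.cliffordAction X φ) =
      h.cliffordAction (S X) (h.spinorMap (h.cplxMap S hS) φ) :=
  fockClifford_map (inner_cplxMap_of_orthogonal hS horth) (h.toCplx X) φ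

lemma spinorMap_spinorDeriv (hc : ∀ X, S (T X) = T' (S X)) (φ : h.Spinor) :
    h.spinorMap (h.cplxMap S hS) (h.spinorDeriv (h.cplxMap T hT) φ) =
      h.spinorDeriv (h.cplxMap T' hT') (h.spinorMap (h.cplxMap S hS) φ) :=
  extDeriv_map (S := h.cplxMap S hS) (T := h.cplxMap T hT) (T' := h.cplxMap T' hT') hc φ

/-- The action on a fixed spinor of a real-linear family of complex endomorphisms of `V_J`, as a
linear function of the parameter. -/
def spinorDerivₗ {A : V →ₗ[ℝ] V →ₗ[ℝ] V} (hA : ∀ X Y, A X (h.J Y) = h.J (A X Y)) (φ : h.Spinor) :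
    V →ₗ[ℝ] h.Spinor where
  toFun X := h.spinorDeriv (h.cplxMap (A X) (hA X)) φ
  map_add' X Y := by
    have hsum : h.cplxMap (A (X + Y)) (hA (X + Y)) =
        h.cplxMap (A X) (hA X) + h.cplxMap (A Y) (hA Y) :=
      LinearMap.ext fun Z => LinearMap.congr_fun (A.map_add X Y) (h.toCplx.symm Z)
    rw [hsum]
    exact extDeriv_add _ _ φ
  map_smul' r X := by
    have hsmul : h.cplxMap (A (r • X)) (hA (r • X)) = (r : ℂ) • h.cplxMap (A X) (hA X) := by
      refine LinearMap.ext fun Z => ?_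
      obtain ⟨Z, rfl⟩ := h.toCplx.surjective Z
      rw [LinearMap.smul_apply, cplxMap_toCplx, cplxMap_toCplx, ofReal_smul_toCplx, map_smul,
        LinearMap.smul_apply]
    rw [hsmul, RingHom.id_apply, ← Complex.coe_smul]
    exact extDeriv_smul _ _ φ

end HermitianStructure

end SpinorOperators

section OrthonormalSums

variable {V W : Type*} [AddCommGroup V] [Module ℝ V] [AddCommGroup W] [Module ℝ W]
  {B : V →ₗ[ℝ] V →ₗ[ℝ] ℝ} {ι : Type*} [Fintype ι] [DecidableEq ι] {b b' : Module.Basis ι ℝ V}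

lemma IsInner.sum_smul_map (hb : ∀ i j, B (b i) (b j) = if i = j then 1 else 0) (L : V →ₗ[ℝ] W)
    (X : V) : ∑ i, B (b i) X • L (b i) = L X := by
  simpa only [map_sum, map_smul] using congrArg L (IsInner.sum_smul_eq hb X)

lemma IsInner.sum_orthonormal_eq (hB : IsInner B)
    (hb : ∀ i j, B (b i) (b j) = if i = j then 1 else 0)
    (hb' : ∀ i j, B (b' i) (b' j) = if i = j then 1 else 0) (A : V →ₗ[ℝ] V →ₗ[ℝ] W) :
    ∑ j, A (b' j) (b' j) = ∑ i, A (b i) (b i) := by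
  calc ∑ j, A (b' j) (b' j) = ∑ j, ∑ i, B (b i) (b' j) • A (b i) (b' j) :=
        Finset.sum_congr rfl fun j _ => (IsInner.sum_smul_map hb (A.flip (b' j)) (b' j)).symm
    _ = ∑ i, ∑ j, B (b' j) (b i) • A (b i) (b' j) := by
        rw [Finset.sum_comm]
        simp only [hB.symm]
    _ = ∑ i, A (b i) (b i) :=
        Finset.sum_congr rfl fun i _ => IsInner.sum_smul_map hb' (A (b i)) (b i)

end OrthonormalSums

noncomputable section SmoothMultilinear

variable {E : Type*} [NormedAddCommGroup E] [NormedSpace ℝ E]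
  {G : Type*} [TopologicalSpace G] [ChartedSpace E G]
  {F F' F'' : Type*} [NormedAddCommGroup F] [NormedSpace ℝ F] [FiniteDimensional ℝ F]
  [NormedAddCommGroup F'] [NormedSpace ℝ F'] [NormedAddCommGroup F''] [NormedSpace ℝ F'']
  {f : G → F} {f' : G → F'}

lemma contMDiff_linearMap_comp (A : F →ₗ[ℝ] F') (hf : ContMDiff 𝓘(ℝ, E) 𝓘(ℝ, F) ∞ f) :
    ContMDiff 𝓘(ℝ, E) 𝓘(ℝ, F') ∞ (fun x => A (f x)) :=
  (LinearMap.toContinuousLinearMap A).contMDiff.comp hf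

lemma dirDeriv_linearMap_comp [Group G] (X : E) (A : F →ₗ[ℝ] F')
    (hf : ContMDiff 𝓘(ℝ, E) 𝓘(ℝ, F) ∞ f) (x : G) :
    dirDeriv X (fun y => A (f y)) x = A (dirDeriv X f x) :=
  dirDeriv_clm_comp X (LinearMap.toContinuousLinearMap A) (hf.mdifferentiable (by simp) x)

variable [FiniteDimensional ℝ F'] (A : F →ₗ[ℝ] F' →ₗ[ℝ] F'')
  (hf : ContMDiff 𝓘(ℝ, E) 𝓘(ℝ, F) ∞ f) (hf' : ContMDiff 𝓘(ℝ, E) 𝓘(ℝ, F') ∞ f')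
include hf hf'

lemma contMDiff_bilinMap_comp : ContMDiff 𝓘(ℝ, E) 𝓘(ℝ, F'') ∞ (fun x => A (f x) (f' x)) :=
  A.toContinuousBilinearMap.isBoundedBilinearMap.contDiff.contMDiff.comp (hf.prodMk_space hf')

lemma dirDeriv_bilinMap_comp [Group G] (X : E) (x : G) :
    dirDeriv X (fun y => A (f y) (f' y)) x =
      A (dirDeriv X f x) (f' x) + A (f x) (dirDeriv X f' x) :=
  dirDeriv_bilin X A.toContinuousBilinearMap (hf.mdifferentiable (by simp) x)
    (hf'.mdifferentiable (by simp) x)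

end SmoothMultilinear

noncomputable section Frames

variable {E : Type*} [NormedAddCommGroup E] [NormedSpace ℝ E] [FiniteDimensional ℝ E]
  [CompleteSpace E]
  {G : Type*} [TopologicalSpace G] [ChartedSpace E G] [Group G] [LieGroup 𝓘(ℝ, E) ∞ G]
  (hK : IsInner (kilE E G)) {K : Subgroup G}

variable (K) in
/-- The orthogonal projection of `𝔤` onto `𝔪`. -/
def projT : E →ₗ[ℝ] tangent E K := Classical.choose (hK.exists_projection (tangent E K))

lemma kilE_projT (X : E) (Y : tangent E K) : kilE E G (projT hK K X : E) Y = kilE E G X Y :=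
  Classical.choose_spec (hK.exists_projection (tangent E K)) X Y

lemma projT_eq {X : E} {Y : tangent E K}
    (h : ∀ Z : tangent E K, kilE E G X Z = kilE E G (Y : E) Z) : projT hK K X = Y :=
  (isInner_kilT hK K).ext fun Z => (kilE_projT hK X Z).trans (h Z)

lemma projT_coe (X : tangent E K) : projT hK K (X : E) = X := projT_eq hK fun _ => rfl

lemma projT_adE (s : K) (X : E) : projT hK K (adE E (s : G) X) = adTangent s (projT hK K X) := by
  refine projT_eq hK fun Z => ?_
  have hZ : (Z : E) = adE E (s : G) (adTangent s⁻¹ Z : tangent E K) :=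
    (adE_adE_inv (s : G) (Z : E)).symm
  rw [coe_adTangent, hZ, kilE_adE, kilE_adE, kilE_projT]

/-- The vector field `x ↦ pr_𝔪 (Ad_{x⁻¹} Y)` on `G/K`, the fundamental field of `Y ∈ 𝔤` for the
action of `G`. These fields take every value in `𝔪` at every point. -/
def fieldOf (Y : E) : VectorFields E K :=
  ⟨fun x => projT hK K (adE E x⁻¹ Y),
    contMDiff_linearMap_comp (projT hK K) ((contMDiff_adE Y).comp (contMDiff_inv 𝓘(ℝ, E) ∞)),
    fun x s => by
      change projT hK K (adE E (x * (s : G))⁻¹ Y) = _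
      rw [mul_inv_rev, adE_mul]
      exact projT_adE hK s⁻¹ _⟩

lemma fieldOf_apply (Y : E) (x : G) :
    (fieldOf hK Y : VectorFields E K).1 x = projT hK K (adE E x⁻¹ Y) :=
  rfl

lemma fieldOf_adE (x : G) (X : tangent E K) :
    (fieldOf hK (adE E x (X : E)) : VectorFields E K).1 x = X := by
  rw [fieldOf_apply, adE_inv_adE, projT_coe]

lemma fieldOf_one (X : tangent E K) : (fieldOf hK (X : E) : VectorFields E K).1 1 = X := by
  simpa only [adE_one] using fieldOf_adE hK 1 X

/-- The function `Kil(V, W)` on `G/K`. -/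
def kilFun (V W : VectorFields E K) : Functions E K :=
  ⟨fun x => kilT E K (V.1 x) (W.1 x), contMDiff_bilinMap_comp _ V.2.1 W.2.1, fun x s => by
    change kilT E K (V.1 (x * s)) (W.1 (x * s)) = kilT E K (V.1 x) (W.1 x)
    rw [V.2.2, W.2.2, kilT_adTangent]⟩

variable {ι : Type*} [Fintype ι] [DecidableEq ι] {b : Module.Basis ι ℝ E}
  (hb : ∀ i j, kilE E G (b i) (b j) = if i = j then 1 else 0)
include hb

lemma sum_kilT_smul_fieldOf (x : G) (X : tangent E K) :
    ∑ k, kilT E K ((fieldOf hK (b k) : VectorFields E K).1 x) X •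
      (fieldOf hK (b k) : VectorFields E K).1 x = X := by
  have hcoeff (k : ι) : kilT E K ((fieldOf hK (b k) : VectorFields E K).1 x) X =
      kilE E G (b k) (adE E x X) := by
    rw [kilT_apply, fieldOf_apply, kilE_projT, ← kilE_adE x, adE_adE_inv]
  simp only [hcoeff]
  refine (IsInner.sum_smul_map hb (projT hK K ∘ₗ adE E x⁻¹) (adE E x (X : E))).trans ?_
  rw [LinearMap.comp_apply, adE_inv_adE, projT_coe]

lemma eq_sum_mulField_fieldOf (V : VectorFields E K) :
    V = ∑ k, mulField (kilFun (fieldOf hK (b k)) V) (fieldOf hK (b k)) := by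
  refine Subtype.ext (funext fun x => ?_)
  rw [Submodule.coe_sum, Finset.sum_apply]
  exact (sum_kilT_smul_fieldOf hK hb x (V.1 x)).symm

end Frames

noncomputable section Connections

variable {E : Type*} [NormedAddCommGroup E] [NormedSpace ℝ E] [CompleteSpace E]
  {G : Type*} [TopologicalSpace G] [ChartedSpace E G] [Group G] [LieGroup 𝓘(ℝ, E) ∞ G]
  {K : Subgroup G}

namespace Connection

/-- The difference `∇_V W - ∇ᶜ_V W` of `∇` and the canonical connection. -/
def diff (D : Connection E K) (V W : VectorFields E K) (x : G) : tangent E K :=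
  (D.toFun V W).1 x - dirDeriv (V.1 x : E) W.1 x

variable (D : Connection E K)

lemma diff_add_left (V V' W : VectorFields E K) (x : G) :
    D.diff (V + V') W x = D.diff V W x + D.diff V' W x := by
  have hderiv : dirDeriv ((V + V').1 x : E) W.1 x =
      dirDeriv (V.1 x : E) W.1 x + dirDeriv (V'.1 x : E) W.1 x := map_add (dirDerivₗ W.1 x) _ _
  rw [diff, D.add_left, hderiv]
  exact add_sub_add_comm _ _ _ _

lemma diff_add_right (V W W' : VectorFields E K) (x : G) :
    D.diff V (W + W') x = D.diff V W x + D.diff V W' x := by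
  have hderiv : dirDeriv (V.1 x : E) (W + W').1 x =
      dirDeriv (V.1 x : E) W.1 x + dirDeriv (V.1 x : E) W'.1 x :=
    dirDeriv_add _ (W.2.1.mdifferentiable (by simp) x) (W'.2.1.mdifferentiable (by simp) x)
  rw [diff, D.add_right, hderiv]
  exact add_sub_add_comm _ _ _ _

lemma diff_mulField_left (f : Functions E K) (V W : VectorFields E K) (x : G) :
    D.diff (mulField f V) W x = f.1 x • D.diff V W x := by
  have hderiv : dirDeriv ((mulField f V).1 x : E) W.1 x = f.1 x • dirDeriv (V.1 x : E) W.1 x :=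
    map_smul (dirDerivₗ W.1 x) _ _
  rw [diff, D.smul_left, hderiv, diff, smul_sub]
  rfl

lemma diff_sum_left {ι : Type*} (s : Finset ι) (V : ι → VectorFields E K) (W : VectorFields E K)
    (x : G) : D.diff (∑ k ∈ s, V k) W x = ∑ k ∈ s, D.diff (V k) W x :=
  map_sum (AddMonoidHom.mk' (fun V => D.diff V W x) fun V V' => D.diff_add_left V V' W x) V s

lemma diff_sum_right {ι : Type*} (s : Finset ι) (V : VectorFields E K) (W : ι → VectorFields E K)
    (x : G) : D.diff V (∑ k ∈ s, W k) x = ∑ k ∈ s, D.diff V (W k) x :=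
  map_sum (AddMonoidHom.mk' (fun W => D.diff V W x) fun W W' => D.diff_add_right V W W' x) W s

variable [FiniteDimensional ℝ E]

lemma diff_mulField_right (f : Functions E K) (V W : VectorFields E K) (x : G) :
    D.diff V (mulField f W) x = f.1 x • D.diff V W x := by
  have hderiv : dirDeriv (V.1 x : E) (mulField f W).1 x =
      diffFun V f x • W.1 x + f.1 x • dirDeriv (V.1 x : E) W.1 x :=
    dirDeriv_bilinMap_comp (LinearMap.lsmul ℝ (tangent E K)) f.2.1 W.2.1 (V.1 x : E) x
  rw [diff, D.leibniz, hderiv, diff, smul_sub]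
  abel

variable (hK : IsInner (kilE E G))

section Tensoriality
include hK

lemma diff_congr_left {V V' : VectorFields E K} (W : VectorFields E K) {x : G}
    (h : V.1 x = V'.1 x) : D.diff V W x = D.diff V' W x := by
  obtain ⟨b, hb⟩ := hK.exists_orthonormal_basis
  rw [eq_sum_mulField_fieldOf hK hb V, eq_sum_mulField_fieldOf hK hb V', diff_sum_left,
    diff_sum_left]
  refine Finset.sum_congr rfl fun k _ => ?_
  rw [diff_mulField_left, diff_mulField_left]
  change kilT E K _ (V.1 x) • _ = kilT E K _ (V'.1 x) • _
  rw [h]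

lemma diff_congr_right (V : VectorFields E K) {W W' : VectorFields E K} {x : G}
    (h : W.1 x = W'.1 x) : D.diff V W x = D.diff V W' x := by
  obtain ⟨b, hb⟩ := hK.exists_orthonormal_basis
  rw [eq_sum_mulField_fieldOf hK hb W, eq_sum_mulField_fieldOf hK hb W', diff_sum_right,
    diff_sum_right]
  refine Finset.sum_congr rfl fun k _ => ?_
  rw [diff_mulField_right, diff_mulField_right]
  change kilT E K _ (W.1 x) • _ = kilT E K _ (W'.1 x) • _
  rw [h]

end Tensoriality

lemma fieldOf_add_apply_one (X Y : tangent E K) :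
    (fieldOf hK ((X + Y : tangent E K) : E) : VectorFields E K).1 1 =
      (fieldOf hK (X : E) + fieldOf hK (Y : E) : VectorFields E K).1 1 :=
  (fieldOf_one hK _).trans (congrArg₂ _ (fieldOf_one hK X) (fieldOf_one hK Y)).symm

lemma fieldOf_smul_apply_one (r : ℝ) (X : tangent E K) :
    (fieldOf hK ((r • X : tangent E K) : E) : VectorFields E K).1 1 =
      (mulField (algebraMap ℝ (Functions E K) r) (fieldOf hK (X : E))).1 1 :=
  (fieldOf_one hK _).trans (congrArg (r • ·) (fieldOf_one hK X)).symm

/-- The bilinear map on `𝔪` that gives the difference of `∇` and the canonical connection at `1`. -/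
def diffTensor : tangent E K →ₗ[ℝ] tangent E K →ₗ[ℝ] tangent E K :=
  LinearMap.mk₂ ℝ (fun X Y => D.diff (fieldOf hK (X : E)) (fieldOf hK (Y : E)) 1)
    (fun X X' _ => (D.diff_congr_left hK _ (fieldOf_add_apply_one hK X X')).trans
      (D.diff_add_left _ _ _ 1))
    (fun r X _ => (D.diff_congr_left hK _ (fieldOf_smul_apply_one hK r X)).trans
      (D.diff_mulField_left _ _ _ 1))
    (fun _ Y Y' => (D.diff_congr_right hK _ (fieldOf_add_apply_one hK Y Y')).trans
      (D.diff_add_right _ _ _ 1))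
    (fun r _ Y => (D.diff_congr_right hK _ (fieldOf_smul_apply_one hK r Y)).trans
      (D.diff_mulField_right _ _ _ 1))

lemma diffTensor_apply_one (V W : VectorFields E K) :
    D.diffTensor hK (V.1 1) (W.1 1) = D.diff V W 1 :=
  (D.diff_congr_left hK _ (fieldOf_one hK _)).trans (D.diff_congr_right hK V (fieldOf_one hK _))

variable {D}

lemma IsInvariant.diff_eq (hD : D.IsInvariant) (V W : VectorFields E K) (x : G) :
    D.diff V W x = D.diffTensor hK (V.1 x) (W.1 x) := by
  have htranslate (V : VectorFields E K) : (translate x⁻¹ V).1 = fun z => V.1 (x * z) :=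
    funext fun z => congrArg (fun y => V.1 (y * z)) (inv_inv x)
  have hone (V : VectorFields E K) : (translate x⁻¹ V).1 1 = V.1 x :=
    (congrFun (htranslate V) 1).trans (congrArg V.1 (mul_one x))
  have hderiv : dirDeriv (V.1 x : E) (translate x⁻¹ W).1 1 = dirDeriv (V.1 x : E) W.1 x := by
    rw [htranslate, dirDeriv_comp_mul_left _ _ (W.2.1.mdifferentiable (by simp) _), mul_one]
  rw [← hone V, ← hone W, diffTensor_apply_one, diff, diff, ← hD, hone, hone, hderiv]

lemma IsInvariant.apply_eq (hD : D.IsInvariant) (V W : VectorFields E K) (x : G) :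
    (D.toFun V W).1 x = dirDeriv (V.1 x : E) W.1 x + D.diffTensor hK (V.1 x) (W.1 x) := by
  rw [← hD.diff_eq hK, diff, add_sub_cancel]

lemma IsInvariant.diffTensor_adTangent (hD : D.IsInvariant) (s : K) (X Y : tangent E K) :
    D.diffTensor hK (adTangent s⁻¹ X) (adTangent s⁻¹ Y) = adTangent s⁻¹ (D.diffTensor hK X Y) := by
  let V : VectorFields E K := fieldOf hK (X : E)
  let W : VectorFields E K := fieldOf hK (Y : E)
  have hV : V.1 1 = X := fieldOf_one hK X
  have hW : W.1 1 = Y := fieldOf_one hK Y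
  have hderiv : dirDeriv (adTangent s⁻¹ X : E) W.1 (1 * (s : G)) =
      adTangent s⁻¹ (dirDeriv (X : E) W.1 1) := by
    rw [coe_adTangent, Subgroup.coe_inv,
      ← dirDeriv_comp_mul_right _ _ (W.2.1.mdifferentiable (by simp) _),
      ← dirDeriv_linearMap_comp _ _ W.2.1]
    exact congrArg (dirDeriv (X : E) · 1) (funext fun z => W.2.2 z s)
  have happly := hD.apply_eq hK V W (1 * (s : G))
  rw [V.2.2, W.2.2, (D.toFun V W).2.2, hD.apply_eq hK V W 1, hV, hW, map_add, hderiv] at happly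
  exact (add_left_cancel happly).symm

variable {H : AlmostHermitian E K}

lemma CommutesWithJ.diffTensor_J (hJ : D.CommutesWithJ H) (hD : D.IsInvariant)
    (X Y : tangent E K) : D.diffTensor hK X (H.J Y) = H.J (D.diffTensor hK X Y) := by
  let V : VectorFields E K := fieldOf hK (X : E)
  let W : VectorFields E K := fieldOf hK (Y : E)
  have hV : V.1 1 = X := fieldOf_one hK X
  have hW : W.1 1 = Y := fieldOf_one hK Y
  have hJW : (H.JField W).1 1 = H.J Y := congrArg H.J hW
  have hderiv : dirDeriv (X : E) (H.JField W).1 1 = H.J (dirDeriv (X : E) W.1 1) :=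
    dirDeriv_linearMap_comp _ H.J W.2.1 1
  have hcomm : (D.toFun V (H.JField W)).1 1 = H.J ((D.toFun V W).1 1) :=
    congrFun (congrArg Subtype.val (hJ V W)) 1
  rw [hD.apply_eq hK, hD.apply_eq hK, map_add, hV, hJW, hW, hderiv] at hcomm
  exact add_left_cancel hcomm

lemma IsCompatible.diffTensor_skew (hg : D.IsCompatible H) (hD : D.IsInvariant)
    (X Y Z : tangent E K) : H.g (D.diffTensor hK X Y) Z = -H.g Y (D.diffTensor hK X Z) := by
  let U : VectorFields E K := fieldOf hK (X : E)
  let V : VectorFields E K := fieldOf hK (Y : E)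
  let W : VectorFields E K := fieldOf hK (Z : E)
  have hU : U.1 1 = X := fieldOf_one hK X
  have hV : V.1 1 = Y := fieldOf_one hK Y
  have hW : W.1 1 = Z := fieldOf_one hK Z
  have hcompat := hg U V W 1
  rw [dirDeriv_bilinMap_comp H.g V.2.1 W.2.1, hD.apply_eq hK, hD.apply_eq hK, hU, hV, hW]
    at hcompat
  simp only [map_add, LinearMap.add_apply] at hcompat
  linarith

lemma form_eq (hJ : D.CommutesWithJ H) (hD : D.IsInvariant) (V : VectorFields E K) (x : G) :
    D.form H V x = H.cplxMap (D.diffTensor hK (V.1 x)) (hJ.diffTensor_J hK hD (V.1 x)) := by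
  have hspec (W : VectorFields E K) :
      H.cplxMap (D.diffTensor hK (V.1 x)) (hJ.diffTensor_J hK hD (V.1 x)) (H.toCplx (W.1 x)) =
        H.toCplx ((D.toFun V W).1 x - dirDeriv (V.1 x : E) W.1 x) := by
    rw [HermitianStructure.cplxMap_toCplx, ← hD.diff_eq hK, diff]
  have hform := Classical.epsilon_spec (p := fun T : H.Cplx →ₗ[ℂ] H.Cplx =>
    ∀ W : VectorFields E K,
      T (H.toCplx (W.1 x)) = H.toCplx ((D.toFun V W).1 x - dirDeriv (V.1 x : E) W.1 x)) ⟨_, hspec⟩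
  refine LinearMap.ext fun Y => ?_
  obtain ⟨Y, rfl⟩ := H.toCplx.surjective Y
  rw [← fieldOf_adE hK x Y, hspec]
  exact hform _

/-- The trace does not depend on the orthonormal basis, so it is a vector of `𝔪` fixed by `K`, and
such a vector is zero. -/
lemma IsInvariant.sum_diffTensor_eq_zero [T2Space G] {μ : Module.Dual ℝ (LieAlg E G)}
    {H : AlmostHermitian E (stabilizer μ)} {D : Connection E (stabilizer μ)} (hD : D.IsInvariant)
    {ι : Type*} [Fintype ι] [DecidableEq ι] {e : Module.Basis ι ℝ (tangent E (stabilizer μ))}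
    (he : ∀ i j, H.g (e i) (e j) = if i = j then 1 else 0) :
    ∑ j, D.diffTensor hK (e j) (e j) = 0 := by
  have hfixed (s : stabilizer μ) :
      adTangent s (∑ j, D.diffTensor hK (e j) (e j)) = ∑ j, D.diffTensor hK (e j) (e j) := by
    let S : tangent E (stabilizer μ) ≃ₗ[ℝ] tangent E (stabilizer μ) :=
      LinearEquiv.ofLinearMap (adTangent s) (adTangent s⁻¹)
        (LinearMap.ext (adTangent_adTangent_inv s)) (LinearMap.ext (adTangent_inv_adTangent s))
    have hSe (i j : ι) : H.g ((e.map S) i) ((e.map S) j) = if i = j then 1 else 0 :=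
      (H.g_Ad s (e i) (e j)).trans (he i j)
    have hequiv (X Y : tangent E (stabilizer μ)) :
        adTangent s (D.diffTensor hK X Y) = D.diffTensor hK (adTangent s X) (adTangent s Y) := by
      simpa only [inv_inv] using (hD.diffTensor_adTangent hK s⁻¹ X Y).symm
    rw [map_sum, ← H.isInner_g.sum_orthonormal_eq he hSe (D.diffTensor hK)]
    exact Finset.sum_congr rfl fun j _ => hequiv (e j) (e j)
  exact Subtype.ext (eq_zero_of_adE_fixed hK (Subtype.prop _) fun s hs =>
    congrArg Subtype.val (hfixed ⟨s, hs⟩))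

end Connection

end Connections

noncomputable section DiracOperator

open MeasureTheory

variable {E : Type*} [NormedAddCommGroup E] [NormedSpace ℝ E] [FiniteDimensional ℝ E]
  [CompleteSpace E]
  {G : Type*} [TopologicalSpace G] [ChartedSpace E G] [Group G] [LieGroup 𝓘(ℝ, E) ∞ G]
  {K : Subgroup G}

namespace AlmostHermitian

/-- A `K`-invariant bilinear map `A` on `𝔪` such that each `A X` is a skew-Hermitian operator
of `𝔪_J`. These are the differences between an invariant Hermitian connection and the canonical
one. -/
structure IsConnectionTensor (H : AlmostHermitian E K)
    (A : tangent E K →ₗ[ℝ] tangent E K →ₗ[ℝ] tangent E K) : Prop where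
  comm : ∀ X Y, A X (H.J Y) = H.J (A X Y)
  skew : ∀ X Y Z, H.g (A X Y) Z = -H.g Y (A X Z)
  equivariant : ∀ (s : K) X Y, A (adTangent s⁻¹ X) (adTangent s⁻¹ Y) = adTangent s⁻¹ (A X Y)

variable {H : AlmostHermitian E K} {A : tangent E K →ₗ[ℝ] tangent E K →ₗ[ℝ] tangent E K}
  (hA : H.IsConnectionTensor A)

lemma dirDeriv_spinor_map (S : H.Spinor →ₗ[ℂ] H.Spinor) {ψ : G → H.Spinor}
    (hψ : ContMDiff 𝓘(ℝ, E) 𝓘(ℝ, H.Spinor) ∞ ψ) (X : E) (x : G) :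
    dirDeriv X (fun y => S (ψ y)) x = S (dirDeriv X ψ x) :=
  dirDeriv_linearMap_comp X (S.restrictScalars ℝ) hψ x

/-- The covariant derivative of a spinor-valued function at `x`, as a function of the direction. -/
def nabla (ψ : G → H.Spinor) (x : G) : tangent E K →ₗ[ℝ] H.Spinor :=
  dirDerivₗ ψ x ∘ₗ (tangent E K).subtype + HermitianStructure.spinorDerivₗ hA.comm (ψ x)

lemma nabla_apply (ψ : G → H.Spinor) (x : G) (X : tangent E K) :
    nabla hA ψ x X =
      dirDeriv (X : E) ψ x + H.spinorDeriv (H.cplxMap (A X) (hA.comm X)) (ψ x) :=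
  rfl

section Smooth

variable {ψ φ : G → H.Spinor} (hψ : ContMDiff 𝓘(ℝ, E) 𝓘(ℝ, H.Spinor) ∞ ψ)
  (hφ : ContMDiff 𝓘(ℝ, E) 𝓘(ℝ, H.Spinor) ∞ φ)
include hψ

lemma contMDiff_nabla (X : tangent E K) :
    ContMDiff 𝓘(ℝ, E) 𝓘(ℝ, H.Spinor) ∞ fun x => nabla hA ψ x X :=
  (contMDiff_dirDeriv (X : E) hψ).add (contMDiff_linearMap_comp
    ((H.spinorDeriv (H.cplxMap (A X) (hA.comm X))).restrictScalars ℝ) hψ)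

lemma contMDiff_nabla_field (V : VectorFields E K) :
    ContMDiff 𝓘(ℝ, E) 𝓘(ℝ, H.Spinor) ∞ fun x => nabla hA ψ x (V.1 x) := by
  obtain ⟨e, he⟩ := H.isInner_g.exists_orthonormal_basis
  have hexpand : (fun x => nabla hA ψ x (V.1 x)) =
      fun x => ∑ i, H.g (e i) (V.1 x) • nabla hA ψ x (e i) :=
    funext fun x => (IsInner.sum_smul_map he _ _).symm
  rw [hexpand]
  exact contMDiff_finsetSum fun i _ => (contMDiff_linearMap_comp (H.g (e i)) V.2.1).smul
    (contMDiff_nabla hA hψ (e i))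

lemma nabla_smul (z : ℂ) (x : G) (X : tangent E K) :
    nabla hA (z • ψ) x X = z • nabla hA ψ x X := by
  have hderiv : dirDeriv (X : E) (z • ψ) x = z • dirDeriv (X : E) ψ x :=
    dirDeriv_spinor_map (z • LinearMap.id) hψ X x
  rw [nabla_apply, nabla_apply, hderiv, Pi.smul_apply, map_smul, smul_add]

lemma nabla_cliffordAction (X Y : tangent E K) (x : G) :
    nabla hA (fun y => H.cliffordAction X (ψ y)) x Y =
      H.cliffordAction X (nabla hA ψ x Y) + H.cliffordAction (A Y X) (ψ x) := by
  rw [nabla_apply, nabla_apply, dirDeriv_spinor_map _ hψ,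
    HermitianStructure.spinorDeriv_cliffordAction (hA.comm Y) (hA.skew Y), map_add, add_assoc]

include hφ

lemma nabla_add (x : G) (X : tangent E K) :
    nabla hA (ψ + φ) x X = nabla hA ψ x X + nabla hA φ x X := by
  have hderiv : dirDeriv (X : E) (ψ + φ) x = dirDeriv (X : E) ψ x + dirDeriv (X : E) φ x :=
    dirDeriv_add _ (hψ.mdifferentiable (by simp) x) (hφ.mdifferentiable (by simp) x)
  rw [nabla_apply, nabla_apply, nabla_apply, hderiv, Pi.add_apply, map_add]
  exact add_add_add_comm _ _ _ _

lemma dirDeriv_spinorInner (X : tangent E K) (x : G) :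
    dirDeriv (X : E) (fun y => H.spinorInner (ψ y) (φ y)) x =
      H.spinorInner (nabla hA ψ x X) (φ x) + H.spinorInner (ψ x) (nabla hA φ x X) := by
  rw [dirDeriv_bilinMap_comp H.spinorInner hψ hφ, nabla_apply, nabla_apply, map_add,
    LinearMap.add_apply, map_add,
    HermitianStructure.spinorInner_spinorDeriv (hA.comm X) (hA.skew X)]
  ring

end Smooth

section FrameDirac

variable {ι : Type*} [Fintype ι] (e : ι → tangent E K)

/-- The expression `∑ⱼ κ(eⱼ) ∇_{eⱼ} ψ` of the Dirac operator in a frame `e` of `𝔪`. -/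
def frameDirac (ψ : G → H.Spinor) (x : G) : H.Spinor :=
  ∑ j, H.cliffordAction (e j) (nabla hA ψ x (e j))

variable {e} {ψ φ : G → H.Spinor} (hψ : ContMDiff 𝓘(ℝ, E) 𝓘(ℝ, H.Spinor) ∞ ψ)
  (hφ : ContMDiff 𝓘(ℝ, E) 𝓘(ℝ, H.Spinor) ∞ φ)
include hφ

lemma contMDiff_frameDirac : ContMDiff 𝓘(ℝ, E) 𝓘(ℝ, H.Spinor) ∞ (frameDirac hA e φ) :=
  contMDiff_finsetSum fun j _ => contMDiff_linearMap_comp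
    ((H.cliffordAction (e j)).restrictScalars ℝ) (contMDiff_nabla hA hφ (e j))

lemma sum_nabla_cliffordAction (htr : ∑ j, A (e j) (e j) = 0) (x : G) :
    ∑ j, nabla hA (fun y => H.cliffordAction (e j) (φ y)) x (e j) = frameDirac hA e φ x := by
  have htrace : ∑ j, H.cliffordAction (A (e j) (e j)) (φ x) = 0 := by
    have hmap := congrArg (H.cliffordBilin.flip (φ x)) htr
    rwa [map_sum, map_zero] at hmap
  simp only [nabla_cliffordAction hA hφ, Finset.sum_add_distrib, htrace, add_zero, frameDirac]

include hψ

lemma contMDiff_spinorInner_cliffordAction (X : tangent E K) :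
    ContMDiff 𝓘(ℝ, E) 𝓘(ℝ, ℂ) ∞ fun x => H.spinorInner (ψ x) (H.cliffordAction X (φ x)) :=
  contMDiff_bilinMap_comp H.spinorInner hψ
    (contMDiff_linearMap_comp ((H.cliffordAction X).restrictScalars ℝ) hφ)

lemma spinorInner_frameDirac (htr : ∑ j, A (e j) (e j) = 0) (x : G) :
    H.spinorInner (frameDirac hA e ψ x) (φ x) = H.spinorInner (ψ x) (frameDirac hA e φ x) -
      ∑ j, dirDeriv (e j : E)
        (fun y => H.spinorInner (ψ y) (H.cliffordAction (e j) (φ y))) x := by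
  have hderiv (j : ι) := dirDeriv_spinorInner hA hψ (contMDiff_linearMap_comp
    ((H.cliffordAction (e j)).restrictScalars ℝ) hφ) (e j) x
  simp only [LinearMap.coe_restrictScalars] at hderiv
  simp only [hderiv, Finset.sum_add_distrib]
  rw [← map_sum, sum_nabla_cliffordAction hA hφ htr, frameDirac, map_sum, LinearMap.sum_apply]
  simp only [HermitianStructure.spinorInner_cliffordAction, Finset.sum_neg_distrib]
  ring

lemma integral_spinorInner_frameDirac [CompactSpace G] [T2Space G] [MeasurableSpace G]
    [BorelSpace G] (ν : Measure G) [ν.IsHaarMeasure] (htr : ∑ j, A (e j) (e j) = 0) :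
    ∫ x, H.spinorInner (frameDirac hA e ψ x) (φ x) ∂ν =
      ∫ x, H.spinorInner (ψ x) (frameDirac hA e φ x) ∂ν := by
  have hsmooth (j : ι) := contMDiff_spinorInner_cliffordAction hψ hφ (e j)
  have hintegrable (j : ι) : Integrable (dirDeriv (e j : E) fun y =>
      H.spinorInner (ψ y) (H.cliffordAction (e j) (φ y))) ν :=
    integrable_of_continuous ν (contMDiff_dirDeriv (e j : E) (hsmooth j)).continuous
  have hintegrable_frameDirac : Integrable (fun x => H.spinorInner (ψ x) (frameDirac hA e φ x)) ν :=
    integrable_of_continuous ν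
      (contMDiff_bilinMap_comp _ hψ (contMDiff_frameDirac hA hφ)).continuous
  simp only [spinorInner_frameDirac hA hψ hφ htr]
  rw [integral_sub hintegrable_frameDirac (integrable_finsetSum _ fun j _ => hintegrable j),
    integral_finsetSum _ fun j _ => hintegrable j]
  simp only [integral_dirDeriv ν _ (hsmooth _), Finset.sum_const_zero, sub_zero]

end FrameDirac

section SpinorFields

variable {χ : K →ₜ* Circle}

lemma nabla_mul_right (ψ : H.SpinorFields χ) (x : G) (s : K) (X : tangent E K) :
    nabla hA ψ.1 (x * s) (adTangent s⁻¹ X) =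
      starRingEnd ℂ (χ s : ℂ) • H.spinorAd s⁻¹ (nabla hA ψ.1 x X) := by
  have hderiv : dirDeriv (adTangent s⁻¹ X : E) ψ.1 (x * s) =
      starRingEnd ℂ (χ s : ℂ) • H.spinorAd s⁻¹ (dirDeriv (X : E) ψ.1 x) := by
    rw [coe_adTangent, Subgroup.coe_inv,
      ← dirDeriv_comp_mul_right _ _ (ψ.2.1.mdifferentiable (by simp) _),
      ← LinearMap.smul_apply, ← dirDeriv_spinor_map _ ψ.2.1]
    exact congrArg (dirDeriv (X : E) · x) (funext fun z => ψ.2.2 z s)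
  have htensor : H.spinorAd s⁻¹ (H.spinorDeriv (H.cplxMap (A X) (hA.comm X)) (ψ.1 x)) =
      H.spinorDeriv (H.cplxMap (A (adTangent s⁻¹ X)) (hA.comm (adTangent s⁻¹ X)))
        (H.spinorAd s⁻¹ (ψ.1 x)) :=
    HermitianStructure.spinorMap_spinorDeriv (fun Y => (H.J_Ad s⁻¹ Y).symm) (hA.comm X)
      (hA.comm (adTangent s⁻¹ X)) (fun Y => (hA.equivariant s X Y).symm) (ψ.1 x)
  rw [nabla_apply, nabla_apply, hderiv, ψ.2.2, map_smul, map_add, smul_add, htensor]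

variable (H χ) in
/-- The Clifford product of spinor fields by a vector field. -/
def cliffordField (U : VectorFields E K) : H.SpinorFields χ →ₗ[ℂ] H.SpinorFields χ where
  toFun ψ := ⟨fun x => H.cliffordAction (U.1 x) (ψ.1 x),
    contMDiff_bilinMap_comp H.cliffordBilin U.2.1 ψ.2.1, fun x s => by
      change H.cliffordAction (U.1 (x * s)) (ψ.1 (x * s)) =
        starRingEnd ℂ (χ s : ℂ) • H.spinorAd s⁻¹ (H.cliffordAction (U.1 x) (ψ.1 x))
      rw [U.2.2, ψ.2.2, map_smul]
      exact congrArg (starRingEnd ℂ (χ s : ℂ) • ·) (HermitianStructure.spinorMap_cliffordAction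
        (fun Y => (H.J_Ad s⁻¹ Y).symm) (H.g_Ad s⁻¹) (U.1 x) (ψ.1 x)).symm⟩
  map_add' _ _ := Subtype.ext (funext fun _ => map_add _ _ _)
  map_smul' z ψ := Subtype.ext (funext fun x => map_smul (H.cliffordAction (U.1 x)) z (ψ.1 x))

variable (χ) in
/-- The covariant derivative of spinor fields along a vector field. -/
def nablaField (V : VectorFields E K) : H.SpinorFields χ →ₗ[ℂ] H.SpinorFields χ where
  toFun ψ := ⟨fun x => nabla hA ψ.1 x (V.1 x), contMDiff_nabla_field hA ψ.2.1 V, fun x s => by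
    change nabla hA ψ.1 (x * s) (V.1 (x * s)) = _
    rw [V.2.2, nabla_mul_right]⟩
  map_add' ψ φ := Subtype.ext (funext fun x => nabla_add hA ψ.2.1 φ.2.1 x _)
  map_smul' z ψ := Subtype.ext (funext fun x => nabla_smul hA ψ.2.1 z x _)

end SpinorFields

lemma exists_field_g_eq_kilT (H : AlmostHermitian E K) (V : VectorFields E K) :
    ∃ U : VectorFields E K, ∀ x Y, H.g (U.1 x) Y = kilT E K (V.1 x) Y := by
  obtain ⟨S, hS⟩ := H.isInner_g.exists_operator (kilT E K)
  have hequiv (s : K) (X : tangent E K) : S (adTangent s X) = adTangent s (S X) :=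
    H.isInner_g.ext fun Y => by
      rw [hS, kilT_adTangent_left, ← hS, ← H.g_Ad s, adTangent_adTangent_inv]
  exact ⟨⟨fun x => S (V.1 x), contMDiff_linearMap_comp S V.2.1, fun x s =>
    (congrArg S (V.2.2 x s)).trans (hequiv s⁻¹ (V.1 x))⟩, fun x Y => hS _ _⟩

lemma sum_cliffordAction_eq {ι : Type*} [Fintype ι] [DecidableEq ι]
    {e : Module.Basis ι ℝ (tangent E K)} (he : ∀ i j, H.g (e i) (e j) = if i = j then 1 else 0)
    {n : ℕ} {U : Fin n → tangent E K} {φ : Fin n → H.Spinor} {L : tangent E K →ₗ[ℝ] H.Spinor}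
    (hL : ∀ X, L X = ∑ k, (H.g (U k) X : ℂ) • φ k) :
    ∑ k, H.cliffordAction (U k) (φ k) = ∑ j, H.cliffordAction (e j) (L (e j)) := by
  simp only [hL, map_sum, map_smul]
  rw [Finset.sum_comm]
  refine Finset.sum_congr rfl fun k _ => ?_
  have hexpand := IsInner.sum_smul_map he (H.cliffordBilin.flip (φ k)) (U k)
  refine hexpand.symm.trans (Finset.sum_congr rfl fun j _ => ?_)
  rw [H.g_symm, Complex.coe_smul]
  rfl

variable {D : Connection E K} (hK : IsInner (kilE E G))
  (hform : ∀ (V : VectorFields E K) x, D.form H V x = H.cplxMap (A (V.1 x)) (hA.comm (V.1 x)))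
include hform

lemma spinorConnection_eq (V : VectorFields E K) (ψ : G → H.Spinor) (x : G) :
    H.spinorConnection D V ψ x = nabla hA ψ x (V.1 x) := by
  rw [spinorConnection, nabla_apply, hform]

include hK

lemma IsDirac.apply_eq_frameDirac {χ : K →ₜ* Circle}
    {𝒟 : H.SpinorFields χ →ₗ[ℂ] H.SpinorFields χ} (h𝒟 : H.IsDirac D χ 𝒟) {ι : Type*} [Fintype ι]
    [DecidableEq ι] {e : Module.Basis ι ℝ (tangent E K)}
    (he : ∀ i j, H.g (e i) (e j) = if i = j then 1 else 0) (ψ : H.SpinorFields χ) (x : G) :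
    (𝒟 ψ).1 x = frameDirac hA e ψ.1 x := by
  obtain ⟨n, U, φ, hgrad, hdirac⟩ := h𝒟 ψ
  rw [hdirac]
  refine sum_cliffordAction_eq he fun X => ?_
  have hfield := hgrad (fieldOf hK (adE E x (X : E))) x
  rwa [spinorConnection_eq hA hform, fieldOf_adE] at hfield

lemma exists_isDirac (χ : K →ₜ* Circle) :
    ∃ 𝒟 : H.SpinorFields χ →ₗ[ℂ] H.SpinorFields χ, H.IsDirac D χ 𝒟 := by
  obtain ⟨b, hb⟩ := hK.exists_orthonormal_basis
  choose U hU using fun k => H.exists_field_g_eq_kilT (fieldOf hK (b k))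
  refine ⟨∑ k, H.cliffordField χ (U k) ∘ₗ nablaField hA χ (fieldOf hK (b k)), fun ψ =>
    ⟨_, U, fun k => nablaField hA χ (fieldOf hK (b k)) ψ, fun V x => ?_, fun x => ?_⟩⟩
  · rw [spinorConnection_eq hA hform]
    conv_lhs => rw [← sum_kilT_smul_fieldOf hK hb x (V.1 x), map_sum]
    refine Finset.sum_congr rfl fun k _ => ?_
    rw [map_smul, hU, Complex.coe_smul]
    rfl
  · rw [LinearMap.sum_apply, Submodule.coe_sum, Finset.sum_apply]
    rfl

lemma existsUnique_isDirac (χ : K →ₜ* Circle) :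
    ∃! 𝒟 : H.SpinorFields χ →ₗ[ℂ] H.SpinorFields χ, H.IsDirac D χ 𝒟 := by
  obtain ⟨e, he⟩ := H.isInner_g.exists_orthonormal_basis
  obtain ⟨𝒟, h𝒟⟩ := exists_isDirac hA hK hform χ
  refine ⟨𝒟, h𝒟, fun 𝒟' h𝒟' => LinearMap.ext fun ψ => Subtype.ext (funext fun x => ?_)⟩
  rw [h𝒟.apply_eq_frameDirac hA hK hform he, h𝒟'.apply_eq_frameDirac hA hK hform he]

lemma IsDirac.isFormallySelfAdjoint [CompactSpace G] [T2Space G] [MeasurableSpace G]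
    [BorelSpace G] (ν : Measure G) [ν.IsHaarMeasure] {χ : K →ₜ* Circle}
    {𝒟 : H.SpinorFields χ →ₗ[ℂ] H.SpinorFields χ} (h𝒟 : H.IsDirac D χ 𝒟) {ι : Type*} [Fintype ι]
    [DecidableEq ι] {e : Module.Basis ι ℝ (tangent E K)}
    (he : ∀ i j, H.g (e i) (e j) = if i = j then 1 else 0) (htr : ∑ j, A (e j) (e j) = 0) :
    H.IsFormallySelfAdjoint ν χ 𝒟 := by
  intro ψ φ
  simp only [h𝒟.apply_eq_frameDirac hA hK hform he]
  exact integral_spinorInner_frameDirac hA ψ.2.1 φ.2.1 ν htr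

end AlmostHermitian

end DiracOperator

end CoadjointDirac

theorem corollary7p9_general {E : Type*} [NormedAddCommGroup E] [NormedSpace ℝ E]
    [FiniteDimensional ℝ E] [CompleteSpace E] {G : Type*} [TopologicalSpace G] [ChartedSpace E G]
    [Group G] [LieGroup 𝓘(ℝ, E) ∞ G] [T2Space G] [CompactSpace G]
    [LieAlgebra.IsSemisimple ℝ (LieAlg E G)]
    [MeasurableSpace G] [BorelSpace G] (ν : MeasureTheory.Measure G) [ν.IsHaarMeasure]
    (μ : Module.Dual ℝ (LieAlg E G)) :
    (∃! H : AlmostHermitian E (stabilizer μ), IsKahler μ H) ∧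
      ∀ (H : AlmostHermitian E (stabilizer μ)) (D : Connection E (stabilizer μ)),
        D.IsInvariant → D.IsCompatible H → D.CommutesWithJ H →
          ∀ χ : stabilizer μ →ₜ* Circle,
            (∃! 𝒟 : H.SpinorFields χ →ₗ[ℂ] H.SpinorFields χ, H.IsDirac D χ 𝒟) ∧
              ∀ 𝒟 : H.SpinorFields χ →ₗ[ℂ] H.SpinorFields χ,
                H.IsDirac D χ 𝒟 → H.IsFormallySelfAdjoint ν χ 𝒟 := by
  have hK : IsInner (kilE E G) := isInner_kilE ν
  refine ⟨existsUnique_isKahler hK μ, fun H D hD hg hJ χ => ?_⟩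
  have hA : H.IsConnectionTensor (D.diffTensor hK) :=
    ⟨hJ.diffTensor_J hK hD, hg.diffTensor_skew hK hD, hD.diffTensor_adTangent hK⟩
  have hform := Connection.form_eq hK hJ hD
  obtain ⟨e, he⟩ := H.isInner_g.exists_orthonormal_basis
  exact ⟨AlmostHermitian.existsUnique_isDirac hA hK hform χ, fun 𝒟 h𝒟 =>
    h𝒟.isFormallySelfAdjoint hA hK hform ν he (hD.sum_diffTensor_eq_zero hK he)⟩

theorem corollary7p9 {E : Type*} [NormedAddCommGroup E] [NormedSpace ℝ E] [FiniteDimensional ℝ E]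
    [CompleteSpace E] {G : Type*} [TopologicalSpace G] [ChartedSpace E G] [Group G]
    [LieGroup 𝓘(ℝ, E) ∞ G] [T2Space G] [CompactSpace G] [ConnectedSpace G]
    [LieAlgebra.IsSemisimple ℝ (LieAlg E G)]
    [MeasurableSpace G] [BorelSpace G] (ν : MeasureTheory.Measure G) [ν.IsHaarMeasure]
    (μ : Module.Dual ℝ (LieAlg E G)) :
    (∃! H : AlmostHermitian E (stabilizer μ), IsKahler μ H) ∧
      ∀ H : AlmostHermitian E (stabilizer μ), IsKahler μ H →
        ∀ D : Connection E (stabilizer μ),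
          D.IsInvariant → D.IsCompatible H → D.CommutesWithJ H →
            ∀ χ : stabilizer μ →ₜ* Circle,
              (∃! 𝒟 : H.SpinorFields χ →ₗ[ℂ] H.SpinorFields χ, H.IsDirac D χ 𝒟) ∧
                ∀ 𝒟 : H.SpinorFields χ →ₗ[ℂ] H.SpinorFields χ,
                  H.IsDirac D χ 𝒟 → H.IsFormallySelfAdjoint ν χ 𝒟 :=
  let ⟨hKahler, hDirac⟩ := corollary7p9_general ν μ
  ⟨hKahler, fun H _ => hDirac H⟩
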